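/- Let $n\ge 2$ and let $\theta$ be a real antisymmetric $n\times n$ matrix with columns $\theta_1,\dots,\theta_n$. Let $A_\theta=C(\mathbb{T}^n_\theta)$ be the $C^*$-algebra generated by the unitary operators $(U_j\xi)(x)=e^{ix_j}\xi(x+\pi\theta_j)$ on $L^2(\mathbb{T}^n)$, $\mathbb{T}^n=\mathbb{R}^n/2\pi\mathbb{Z}^n$, and put $U^k=U_1^{k_1}\cdots U_n^{k_n}$, $k\in\mathbb{Z}^n$. Let $\tau(a)=\langle a1,1\rangle$ be its canonical tracial state (for the inner product with measure $(2\pi)^{-n}dx$), let $\mathscr{H}_\theta$ be the Hilbert space of the GNS representation of $\tau$, on which $A_\theta$ acts by (the extension of) left multiplication, and let $\mathcal{A}_\theta=C^\infty(\mathbb{T}^n_\theta)\subset A_\theta$ be the smooth subalgebra for the action $\alpha_s(U^k)=e^{is\cdot k}U^k$ of $\mathbb{R}^n$, with derivations $\delta_j=\frac1i\partial_{s_j}\alpha_s|_{s=0}$, $\delta^\alpha=\delta_1^{\alpha_1}\cdots\delta_n^{\alpha_n}$, and the topology of the seminorms $\|\delta^\alpha u\|$. Let $P\in\Psi^{-n}(\mathbb{T}^n_\theta)$.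 That is, $P:\mathcal{A}_\theta\to\mathcal{A}_\theta$ is the linear operator $$Pu=\sum_{k\in\mathbb{Z}^n}u_k\,\rho(k)U^k,\qquad u=\sum_{k\in\mathbb{Z}^n} u_kU^k\in\mathcal{A}_\theta,$$ for a smooth map $\rho:\mathbb{R}^n\to\mathcal{A}_\theta$ with an expansion $\rho\sim\sum_{j\ge0}\rho_{-n-j}$, where each $\rho_{-n-j}:\mathbb{R}^n\setminus0\to\mathcal{A}_\theta$ is smooth and homogeneous of degree $-n-j$ and, for all $N\ge 0$ and all multi-orders $\alpha,\beta$, there is a constant $C_{N\alpha\beta}$ with $$\Big\|\delta^\alpha\partial_\xi^\beta\Big(\rho-\sum_{j<N}\rho_{-n-j}\Big)(\xi)\Big\|\le C_{N\alpha\beta}|\xi|^{-n-N-|\beta|}\qquad\text{for } |\xi|\ge1 .$$ Then $P$ extends uniquely to a bounded operator on $\mathscr{H}_\theta$, again denoted by $P$, and $$c_P:=\int_{\mathbb{S}^{n-1}}\rho_{-n}(\xi)\,d^{n-1}\xi$$ is an element of $\mathcal{A}_\theta$. For every $a\in A_\theta$, the operator $aP$ on $\mathscr{H}_\theta$ is strongly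 measurable, and $$-\!\!\!\!\!\!\int aP=\frac1n\,\tau(a\,c_P).$$ Here $\mathscr{L}^{1,\infty}$ is the space of compact operators $T$ on $\mathscr{H}_\theta$ whose characteristic values $\mu_k(T)=\inf\{\|T|_{E^\perp}\|:\dim E=k\}$ are $O(k^{-1})$. A normalized positive trace is a linear form $\varphi$ on $\mathscr{L}^{1,\infty}$ that vanishes on all commutators $[A,T]$ with $A$ bounded and $T\in\mathscr{L}^{1,\infty}$, is non-negative on positive operators, and satisfies $\varphi(T_0)=1$, where $T_0\xi_k=(k+1)^{-1}\xi_k$ $(k\ge0)$ for an orthonormal basis $(\xi_k)_{k\ge 0}$ of $\mathscr{H}_\theta$. An operator $T\in\mathscr{L}^{1,\infty}$ is strongly measurable with NC integral $-\!\!\!\!\!\!\int T=L$ when $\varphi(T)=L$ for every normalized positive trace $\varphi$. -/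

import Mathlib

open MeasureTheory
open scoped ENNReal ContDiff InnerProductSpace

noncomputable section

/-! ### Characteristic values and the weak trace class -/

section WeakTraceClass

variable {H : Type*} [NormedAddCommGroup H] [InnerProductSpace ℂ H]

/-- The norms `‖T|_{Eᗮ}‖`, where `E` ranges over the subspaces of dimension at most `k`.
(On an infinite-dimensional space, "at most `k`" and "exactly `k`" give the same infimum, because
enlarging `E` decreases the norm.) -/
def charValueSet (k : ℕ) (T : H →L[ℂ] H) : Set ℝ :=
  {r | ∃ E : Submodule ℂ H, FiniteDimensional ℂ E ∧ Module.finrank ℂ E ≤ k ∧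
    r = ‖T ∘L (Eᗮ).subtypeL‖}

/-- The `k`-th characteristic value (singular value)
`μ_k(T) = inf {‖T|_{Eᗮ}‖ ; dim E = k}`, `k ≥ 0`. -/
def charValue (k : ℕ) (T : H →L[ℂ] H) : ℝ := sInf (charValueSet k T)

theorem charValueSet_nonempty (k : ℕ) (T : H →L[ℂ] H) : (charValueSet k T).Nonempty :=
  ⟨_, ⊥, inferInstance, by simp, rfl⟩

theorem charValueSet_bddBelow (k : ℕ) (T : H →L[ℂ] H) : BddBelow (charValueSet k T) :=
  ⟨0, by rintro r ⟨E, -, -, rfl⟩; exact norm_nonneg (T ∘L (Eᗮ).subtypeL)⟩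

theorem charValue_nonneg (k : ℕ) (T : H →L[ℂ] H) : 0 ≤ charValue k T :=
  le_csInf (charValueSet_nonempty k T) 
    (by rintro r ⟨E, -, -, rfl⟩; exact norm_nonneg (T ∘L (Eᗮ).subtypeL))

theorem charValue_anti {k l : ℕ} (h : k ≤ l) (T : H →L[ℂ] H) : charValue l T ≤ charValue k T := by
  refine csInf_le_csInf (charValueSet_bddBelow l T) (charValueSet_nonempty k T) ?_
  rintro r ⟨E, hE, hk, rfl⟩
  exact ⟨E, hE, hk.trans h, rfl⟩

/-- The comparison principle behind the properties of `μ_k` below. -/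
theorem charValue_le_of_forall {k : ℕ} {T : H →L[ℂ] H} {b : ℝ} (hb : 0 ≤ b) (E : Submodule ℂ H)
    [FiniteDimensional ℂ E] (hE : Module.finrank ℂ E ≤ k)
    (h : ∀ x ∈ Eᗮ, ‖T x‖ ≤ b * ‖x‖) : charValue k T ≤ b := by
  refine (csInf_le (charValueSet_bddBelow k T) ⟨E, inferInstance, hE, rfl⟩).trans ?_
  exact ContinuousLinearMap.opNorm_le_bound _ hb fun x => h x x.2

theorem exists_of_charValue_lt {k : ℕ} {T : H →L[ℂ] H} {b : ℝ} (h : charValue k T < b) :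
    ∃ E : Submodule ℂ H, FiniteDimensional ℂ E ∧ Module.finrank ℂ E ≤ k ∧
      ∀ x ∈ Eᗮ, ‖T x‖ ≤ b * ‖x‖ := by
  obtain ⟨r, ⟨E, hE, hk, rfl⟩, hr⟩ := exists_lt_of_csInf_lt (charValueSet_nonempty k T) h
  refine ⟨E, hE, hk, fun x hx => ?_⟩
  have := (T ∘L (Eᗮ).subtypeL).le_opNorm ⟨x, hx⟩
  exact this.trans (mul_le_mul_of_nonneg_right hr.le (norm_nonneg _))

theorem charValue_add_le (k l : ℕ) (S T : H →L[ℂ] H) :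
    charValue (k + l) (S + T) ≤ charValue k S + charValue l T := by
  refine le_of_forall_pos_le_add fun ε hε => ?_
  obtain ⟨E, hE, hk, hS⟩ := exists_of_charValue_lt
    (show charValue k S < charValue k S + ε / 2 by linarith)
  obtain ⟨F, hF, hl, hT⟩ := exists_of_charValue_lt
    (show charValue l T < charValue l T + ε / 2 by linarith)
  have h1 := charValue_nonneg k S
  have h2 := charValue_nonneg l T
  refine charValue_le_of_forall (by linarith) (E ⊔ F)
    ((Submodule.finrank_add_le_finrank_add_finrank E F).trans (by omega)) fun x hx => ?_
  have hxE := hS x (Submodule.orthogonal_le le_sup_left hx)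
  have hxF := hT x (Submodule.orthogonal_le le_sup_right hx)
  calc ‖(S + T) x‖ ≤ ‖S x‖ + ‖T x‖ := norm_add_le _ _
    _ ≤ _ := by linarith

theorem charValue_comp_le (k : ℕ) (A T : H →L[ℂ] H) :
    charValue k (A * T) ≤ ‖A‖ * charValue k T := by
  refine le_of_forall_pos_le_add fun ε hε => ?_
  have hA : 0 < ‖A‖ + 1 := by positivity
  obtain ⟨E, hE, hk, hT⟩ := exists_of_charValue_lt
    (show charValue k T < charValue k T + ε / (‖A‖ + 1) by
      have : 0 < ε / (‖A‖ + 1) := by positivity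
      linarith)
  have h1 := charValue_nonneg k T
  refine charValue_le_of_forall (by positivity) E hk fun x hx => ?_
  have h2 : ‖A‖ * (ε / (‖A‖ + 1)) ≤ ε := by
    rw [mul_div_assoc', div_le_iff₀ hA]
    nlinarith [norm_nonneg A]
  calc ‖A (T x)‖ ≤ ‖A‖ * ‖T x‖ := A.le_opNorm _
    _ ≤ ‖A‖ * ((charValue k T + ε / (‖A‖ + 1)) * ‖x‖) := by gcongr; exact hT x hx
    _ = (‖A‖ * charValue k T + ‖A‖ * (ε / (‖A‖ + 1))) * ‖x‖ := by ring
    _ ≤ _ := by gcongr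

theorem charValue_smul_le (k : ℕ) (c : ℂ) (T : H →L[ℂ] H) :
    charValue k (c • T) ≤ ‖c‖ * charValue k T := by
  have h : c • T = (c • (1 : H →L[ℂ] H)) * T := by ext; simp
  rw [h]
  refine (charValue_comp_le k _ T).trans
    (mul_le_mul_of_nonneg_right ?_ (charValue_nonneg k T))
  refine (norm_smul_le c (1 : H →L[ℂ] H)).trans (mul_le_of_le_one_right (norm_nonneg c) ?_)
  exact ContinuousLinearMap.norm_id_le

theorem charValue_comp_right_le [CompleteSpace H] (k : ℕ) (T A : H →L[ℂ] H) :
    charValue k (T * A) ≤ charValue k T * ‖A‖ := by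
  refine le_of_forall_pos_le_add fun ε hε => ?_
  have hA : 0 < ‖A‖ + 1 := by positivity
  obtain ⟨E, hE, hk, hT⟩ := exists_of_charValue_lt
    (show charValue k T < charValue k T + ε / (‖A‖ + 1) by
      have : 0 < ε / (‖A‖ + 1) := by positivity
      linarith)
  have h1 := charValue_nonneg k T
  have h3 : 0 < ε / (‖A‖ + 1) := by positivity
  refine charValue_le_of_forall (by positivity)
    (E.map (ContinuousLinearMap.adjoint A : H →L[ℂ] H).toLinearMap)
    ((Submodule.finrank_map_le _ _).trans hk) fun x hx => ?_
  have hAx : A x ∈ Eᗮ := by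
    rw [Submodule.mem_orthogonal]
    intro u hu
    rw [← ContinuousLinearMap.adjoint_inner_left]
    exact (Submodule.mem_orthogonal _ _).1 hx _ (Submodule.mem_map_of_mem hu)
  have h2 : (ε / (‖A‖ + 1)) * ‖A‖ ≤ ε := by
    rw [div_mul_eq_mul_div, div_le_iff₀ hA]
    nlinarith [norm_nonneg A]
  calc ‖T (A x)‖ ≤ (charValue k T + ε / (‖A‖ + 1)) * ‖A x‖ := hT _ hAx
    _ ≤ (charValue k T + ε / (‖A‖ + 1)) * (‖A‖ * ‖x‖) := by
        gcongr
        exact A.le_opNorm x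
    _ = (charValue k T * ‖A‖ + (ε / (‖A‖ + 1)) * ‖A‖) * ‖x‖ := by ring
    _ ≤ _ := by gcongr

variable (H) in
/-- The weak trace class `𝓛^{1,∞}`: compact operators with `μ_k(T) = O(k⁻¹)`. -/
def weakTraceClass : Submodule ℂ (H →L[ℂ] H) where
  carrier := {T | IsCompactOperator T ∧ ∃ C : ℝ, ∀ k : ℕ, (k + 1 : ℝ) * charValue k T ≤ C}
  zero_mem' := by
    refine ⟨isCompactOperator_zero, 0, fun k => ?_⟩
    have h : charValue k (0 : H →L[ℂ] H) ≤ 0 :=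
      charValue_le_of_forall le_rfl ⊥ (by simp) (by simp)
    exact mul_nonpos_of_nonneg_of_nonpos (by positivity) h
  add_mem' := by
    rintro S T ⟨hS, C, hC⟩ ⟨hT, D, hD⟩
    refine ⟨hS.add hT, 2 * (C + D), fun m => ?_⟩
    have h1 : charValue m (S + T) ≤ charValue (m / 2) S + charValue (m / 2) T :=
      (charValue_anti (by omega) _).trans (charValue_add_le _ _ S T)
    have h2 := hC (m / 2)
    have h3 := hD (m / 2)
    have h4 : (m + 1 : ℝ) ≤ 2 * (((m / 2 : ℕ) : ℝ) + 1) := by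
      have : m + 1 ≤ 2 * (m / 2 + 1) := by omega
      exact_mod_cast this
    have h5 := charValue_nonneg (m / 2) S
    have h6 := charValue_nonneg (m / 2) T
    calc (m + 1 : ℝ) * charValue m (S + T)
        ≤ (2 * (((m / 2 : ℕ) : ℝ) + 1)) * (charValue (m / 2) S + charValue (m / 2) T) :=
          mul_le_mul h4 h1 (charValue_nonneg _ _) (by positivity)
      _ ≤ _ := by linarith
  smul_mem' := by
    rintro c T ⟨hT, C, hC⟩
    refine ⟨hT.smul c, ‖c‖ * C, fun k => ?_⟩
    calc (k + 1 : ℝ) * charValue k (c • T) ≤ (k + 1 : ℝ) * (‖c‖ * charValue k T) := by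
          gcongr; exact charValue_smul_le k c T
      _ = ‖c‖ * ((k + 1 : ℝ) * charValue k T) := by ring
      _ ≤ _ := by gcongr; exact hC k

theorem mul_mem_weakTraceClass (A : H →L[ℂ] H) {T : H →L[ℂ] H} (hT : T ∈ weakTraceClass H) :
    A * T ∈ weakTraceClass H := by
  obtain ⟨hT, C, hC⟩ := hT
  refine ⟨hT.clm_comp A, ‖A‖ * C, fun k => ?_⟩
  calc (k + 1 : ℝ) * charValue k (A * T) ≤ (k + 1 : ℝ) * (‖A‖ * charValue k T) := by
        gcongr; exact charValue_comp_le k A T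
    _ = ‖A‖ * ((k + 1 : ℝ) * charValue k T) := by ring
    _ ≤ _ := by gcongr; exact hC k

theorem mem_weakTraceClass_mul [CompleteSpace H] {T : H →L[ℂ] H} (hT : T ∈ weakTraceClass H)
    (A : H →L[ℂ] H) : T * A ∈ weakTraceClass H := by
  obtain ⟨hT, C, hC⟩ := hT
  refine ⟨hT.comp_clm A, C * ‖A‖, fun k => ?_⟩
  calc (k + 1 : ℝ) * charValue k (T * A) ≤ (k + 1 : ℝ) * (charValue k T * ‖A‖) := by
        gcongr; exact charValue_comp_right_le k T A
    _ = ((k + 1 : ℝ) * charValue k T) * ‖A‖ := by ring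
    _ ≤ _ := by gcongr; exact hC k

/-! ### Positive normalized traces, strong measurability, the NC integral -/

variable [CompleteSpace H]

/-- A linear form `φ` on `𝓛^{1,∞}` is a normalized positive trace when it vanishes on the
commutators `[A, T]`, `A ∈ 𝓛(H)`, `T ∈ 𝓛^{1,∞}`, takes values in `[0, ∞)` on positive operators,
and `φ(T₀) = 1`, where `T₀` is an operator with `T₀ ξ_k = (k+1)⁻¹ ξ_k`, `k ≥ 0`, for some
orthonormal basis `(ξ_k)` (any two such `T₀` are unitarily equivalent, so that the choice of `T₀`
is immaterial). -/
structure IsNormalizedPositiveTrace (φ : weakTraceClass H →ₗ[ℂ] ℂ) : Prop where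
  commutator : ∀ (A : H →L[ℂ] H) (T : weakTraceClass H),
    φ ⟨A * (T : H →L[ℂ] H) - (T : H →L[ℂ] H) * A,
      Submodule.sub_mem _ (mul_mem_weakTraceClass A T.2) (mem_weakTraceClass_mul T.2 A)⟩ = 0
  positive : ∀ T : weakTraceClass H, (T : H →L[ℂ] H).IsPositive → 0 ≤ (φ T).re ∧ (φ T).im = 0
  normalized : ∃ (ξ : HilbertBasis ℕ ℂ H) (T₀ : weakTraceClass H),
    (∀ k : ℕ, (T₀ : H →L[ℂ] H) (ξ k) = ((k : ℂ) + 1)⁻¹ • ξ k) ∧ φ T₀ = 1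

/-- `T` is strongly measurable with NC integral `⨍ T = L`: `T` is in `𝓛^{1,∞}` and `φ(T) = L` for
every normalized positive trace `φ` on `𝓛^{1,∞}`. -/
def HasNCIntegral (T : H →L[ℂ] H) (L : ℂ) : Prop :=
  ∃ hT : T ∈ weakTraceClass H, ∀ φ : weakTraceClass H →ₗ[ℂ] ℂ,
    IsNormalizedPositiveTrace φ → φ ⟨T, hT⟩ = L

/-- `T` is strongly measurable. -/
def IsStronglyMeasurableOp (T : H →L[ℂ] H) : Prop := ∃ L : ℂ, HasNCIntegral T L

end WeakTraceClass

/-- A closed `*`-subalgebra of `𝓛(H)` is a `*`-ordered ring for the order of operators. -/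
theorem starOrderedRing_of_isClosed {H : Type*} [NormedAddCommGroup H] [InnerProductSpace ℂ H]
    [CompleteSpace H] (S : StarSubalgebra ℂ (H →L[ℂ] H)) (hS : IsClosed (S : Set (H →L[ℂ] H))) :
    StarOrderedRing S := by
  refine StarOrderedRing.of_nonneg_iff' (fun {x y} h z => ?_) fun x => ⟨fun h => ?_, ?_⟩
  · have h' : (x : H →L[ℂ] H) ≤ (y : H →L[ℂ] H) := h
    change (z : H →L[ℂ] H) + (x : H →L[ℂ] H) ≤ (z : H →L[ℂ] H) + (y : H →L[ℂ] H)
    gcongr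
  · have hx : (0 : H →L[ℂ] H) ≤ (x : H →L[ℂ] H) := h
    have hs : CFC.sqrt (x : H →L[ℂ] H) ∈ S := by
      rw [CFC.sqrt_eq_real_sqrt (x : H →L[ℂ] H) hx, cfcₙ_eq_cfc]
      have := hS
      exact cfc_mem (𝕜' := ℂ) _ x.2
    refine ⟨⟨CFC.sqrt (x : H →L[ℂ] H), hs⟩, Subtype.ext ?_⟩
    change (x : H →L[ℂ] H) = star (CFC.sqrt (x : H →L[ℂ] H)) * CFC.sqrt (x : H →L[ℂ] H)
    rw [(CFC.sqrt_nonneg (x : H →L[ℂ] H)).isSelfAdjoint.star_eq,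
      CFC.sqrt_mul_sqrt_self (x : H →L[ℂ] H) hx]
  · rintro ⟨s, rfl⟩
    change (0 : H →L[ℂ] H) ≤ star (s : H →L[ℂ] H) * (s : H →L[ℂ] H)
    exact star_mul_self_nonneg (s : H →L[ℂ] H)

/-! ### The noncommutative torus

The torus `ℝⁿ/2πℤⁿ` is parametrized by `UnitAddTorus (Fin n) = ℝⁿ/ℤⁿ` through `x = 2πy`. -/

namespace NCTorus

variable {n : ℕ}

/-- Euclidean space `ℝⁿ`. -/
abbrev E (n : ℕ) : Type := EuclideanSpace ℝ (Fin n)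

/-- The normalized Haar measure `(2π)⁻ⁿ dx = dy` on the torus. -/
abbrev torusMeasure (n : ℕ) : Measure (UnitAddTorus (Fin n)) :=
  Measure.pi fun _ => (AddCircle.haarAddCircle : Measure UnitAddCircle)

/-- The Hilbert space `L²(𝕋ⁿ)`. -/
abbrev L2T (n : ℕ) : Type := Lp ℂ 2 (torusMeasure n)

/-- The bounded operators on `L²(𝕋ⁿ)`. -/
abbrev B (n : ℕ) : Type := L2T n →L[ℂ] L2T n

/-- The point of the torus with coordinates `x`, where `x ∈ ℝⁿ` is counted modulo `2πℤⁿ`. -/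
def toTorus (x : Fin n → ℝ) : UnitAddTorus (Fin n) :=
  fun i => ((x i / (2 * Real.pi) : ℝ) : UnitAddCircle)

/-- Translation `(V_v ξ)(y) = ξ(y + v)` on `L²(𝕋ⁿ)`. -/
def transl (v : UnitAddTorus (Fin n)) : B n :=
  (Lp.compMeasurePreservingₗᵢ ℂ (fun y => y + v)
    (measurePreserving_add_right (torusMeasure n) v)).toContinuousLinearMap

/-- Multiplication by a continuous function on `L²(𝕋ⁿ)`. -/
def mulOp (f : C(UnitAddTorus (Fin n), ℂ)) : B n :=
  (ContinuousLinearMap.mul ℂ ℂ).holderL (torusMeasure n) ∞ 2 2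
    (ContinuousMap.toLp ∞ (torusMeasure n) ℂ f)

theorem mulOp_coeFn (f : C(UnitAddTorus (Fin n), ℂ)) (ξ : L2T n) :
    (mulOp f ξ : UnitAddTorus (Fin n) → ℂ) =ᵐ[torusMeasure n] fun y => f y * ξ y := by
  filter_upwards [(ContinuousLinearMap.mul ℂ ℂ).coeFn_holder (r := 2)
    (ContinuousMap.toLp ∞ (torusMeasure n) ℂ f) ξ,
    ContinuousMap.coeFn_toLp (p := ∞) (𝕜 := ℂ) (torusMeasure n) f] with y h1 h2
  refine h1.trans ?_
  rw [h2]
  rfl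

theorem mulOp_mulOp (f g : C(UnitAddTorus (Fin n), ℂ)) (ξ : L2T n) :
    mulOp f (mulOp g ξ) = mulOp (f * g) ξ := by
  refine Lp.ext ?_
  filter_upwards [mulOp_coeFn f (mulOp g ξ), mulOp_coeFn g ξ, mulOp_coeFn (f * g) ξ]
    with y h1 h2 h3
  rw [h1, h2, h3, ContinuousMap.mul_apply, mul_assoc]

theorem mulOp_one (ξ : L2T n) : mulOp 1 ξ = ξ := by
  refine Lp.ext ?_
  filter_upwards [mulOp_coeFn 1 ξ] with y h1
  rw [h1, ContinuousMap.one_apply, one_mul]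

theorem norm_mulOp (f : C(UnitAddTorus (Fin n), ℂ)) (hf : ∀ y, ‖f y‖ = 1) (ξ : L2T n) :
    ‖mulOp f ξ‖ = ‖ξ‖ := by
  rw [Lp.norm_def, Lp.norm_def]
  congr 1
  refine eLpNorm_congr_norm_ae ?_
  filter_upwards [mulOp_coeFn f ξ] with y h1
  rw [h1, norm_mul, hf, one_mul]

theorem transl_coeFn (v : UnitAddTorus (Fin n)) (ξ : L2T n) :
    (transl v ξ : UnitAddTorus (Fin n) → ℂ) =ᵐ[torusMeasure n] fun y => ξ (y + v) :=
  Lp.coeFn_compMeasurePreserving ξ (measurePreserving_add_right (torusMeasure n) v)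

theorem norm_transl (v : UnitAddTorus (Fin n)) (ξ : L2T n) : ‖transl v ξ‖ = ‖ξ‖ :=
  LinearIsometry.norm_map _ ξ

theorem transl_transl (v w : UnitAddTorus (Fin n)) (ξ : L2T n) :
    transl v (transl w ξ) = transl (v + w) ξ := by
  refine Lp.ext ?_
  filter_upwards [transl_coeFn v (transl w ξ), transl_coeFn (v + w) ξ,
    (measurePreserving_add_right (torusMeasure n) v).quasiMeasurePreserving.ae
      (transl_coeFn w ξ)] with y h1 h2 h3
  rw [h1, h2, h3, add_assoc]

theorem transl_zero (ξ : L2T n) : transl 0 ξ = ξ := by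
  refine Lp.ext ?_
  filter_upwards [transl_coeFn 0 ξ] with y h1
  rw [h1, add_zero]

/-- The operator `(U_j ξ)(x) = e^{i x_j} ξ(x + π θ_j)` on `L²(𝕋ⁿ)`, where `θ_j` is the `j`-th
column of `θ`. -/
def genOp (θ : Matrix (Fin n) (Fin n) ℝ) (j : Fin n) : B n :=
  mulOp (UnitAddTorus.mFourier (Pi.single j 1)) * transl (toTorus fun i => Real.pi * θ i j)

theorem genOp_mem_unitary (θ : Matrix (Fin n) (Fin n) ℝ) (j : Fin n) :
    genOp θ j ∈ unitary (B n) := by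
  set v := toTorus fun i => Real.pi * θ i j with hv
  set f : C(UnitAddTorus (Fin n), ℂ) := UnitAddTorus.mFourier (Pi.single j 1) with hf
  set g : C(UnitAddTorus (Fin n), ℂ) := UnitAddTorus.mFourier (-Pi.single j 1) with hg
  have hfg : f * g = 1 := by
    ext y
    rw [ContinuousMap.mul_apply, hf, hg, ← UnitAddTorus.mFourier_add, add_neg_cancel,
      UnitAddTorus.mFourier_zero]
  have hf1 : ∀ y, ‖f y‖ = 1 := fun y => by
    simp only [hf, UnitAddTorus.mFourier, fourier_apply, ContinuousMap.coe_mk, norm_prod,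
      Circle.norm_coe, Finset.prod_const_one]
  have hU : genOp θ j = mulOp f * transl v := rfl
  have h1 : star (genOp θ j) * genOp θ j = 1 := by
    have : ∀ x, ‖genOp θ j x‖ = ‖x‖ := fun x => by
      rw [hU, mul_apply_eq_comp, norm_mulOp f hf1, norm_transl]
    exact (ContinuousLinearMap.norm_map_iff_adjoint_comp_self _).1 this
  have h2 : genOp θ j * (transl (-v) * mulOp g) = 1 := by
    ext1 ξ
    rw [hU]
    simp only [mul_apply_eq_comp, one_apply_eq_self]
    rw [transl_transl, add_neg_cancel, transl_zero, mulOp_mulOp, hfg, mulOp_one]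
  have h3 : star (genOp θ j) = transl (-v) * mulOp g := by
    rw [← mul_one (star (genOp θ j)), ← h2, ← mul_assoc, h1, one_mul]
  exact Unitary.mem_iff.2 ⟨h1, by rw [h3, h2]⟩

/-- The unitary operators `U_1, …, U_n`. -/
def gen (θ : Matrix (Fin n) (Fin n) ℝ) (j : Fin n) : unitary (B n) :=
  ⟨genOp θ j, genOp_mem_unitary θ j⟩

/-- The C*-algebra `A_θ = C(𝕋ⁿ_θ)`, i.e., the closed `*`-subalgebra of `𝓛(L²(𝕋ⁿ))` generated by
`U_1, …, U_n`. -/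
def alg (θ : Matrix (Fin n) (Fin n) ℝ) : StarSubalgebra ℂ (B n) :=
  (StarAlgebra.adjoin ℂ (Set.range fun j => (gen θ j : B n))).topologicalClosure

instance isClosed_alg (θ : Matrix (Fin n) (Fin n) ℝ) : IsClosed (alg θ : Set (B n)) :=
  StarSubalgebra.isClosed_topologicalClosure _

theorem gen_mem_alg (θ : Matrix (Fin n) (Fin n) ℝ) (j : Fin n) : (gen θ j : B n) ∈ alg θ :=
  StarSubalgebra.le_topologicalClosure _ (StarAlgebra.subset_adjoin ℂ _ ⟨j, rfl⟩)

/-- `U^k = U_1^{k_1} ⋯ U_n^{k_n}`, `k ∈ ℤⁿ`, as a unitary operator on `L²(𝕋ⁿ)`. -/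
def UOp (θ : Matrix (Fin n) (Fin n) ℝ) (k : Fin n → ℤ) : unitary (B n) :=
  ((List.finRange n).map fun j => gen θ j ^ k j).prod

theorem UOp_mem_alg (θ : Matrix (Fin n) (Fin n) ℝ) (k : Fin n → ℤ) :
    (UOp θ k : B n) ∈ alg θ := by
  have hz : ∀ (j : Fin n) (m : ℤ), ((gen θ j ^ m : unitary (B n)) : B n) ∈ alg θ := by
    intro j m
    cases m with
    | ofNat m =>
      rw [Int.ofNat_eq_natCast, zpow_natCast]
      simpa using pow_mem (gen_mem_alg θ j) m
    | negSucc m =>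
      rw [zpow_negSucc, ← Unitary.star_eq_inv]
      simpa using star_mem (pow_mem (gen_mem_alg θ j) (m + 1))
  have hl : ∀ l : List (Fin n),
      (((l.map fun j => gen θ j ^ k j).prod : unitary (B n)) : B n) ∈ alg θ := by
    intro l
    induction l with
    | nil => simp
    | cons j l ih => simpa using mul_mem (hz j (k j)) ih
  exact hl _

/-- `U^k` as an element of `A_θ`. -/
def U (θ : Matrix (Fin n) (Fin n) ℝ) (k : Fin n → ℤ) : alg θ := ⟨UOp θ k, UOp_mem_alg θ k⟩

/-- `A_θ` carries the order of operators on `L²(𝕋ⁿ)`. Its non-negative elements are the elements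
`s* s`, `s ∈ A_θ`. -/
instance starOrderedRing_alg (θ : Matrix (Fin n) (Fin n) ℝ) : StarOrderedRing (alg θ) :=
  starOrderedRing_of_isClosed (alg θ) (isClosed_alg θ)

/-- The constant function `1` in `L²(𝕋ⁿ)`. -/
def oneL2 (n : ℕ) : L2T n := Lp.const 2 (torusMeasure n) (1 : ℂ)

/-- The linear form `τ(a) = ⟨a 1, 1⟩` on `A_θ` (for the inner product that is linear in the first
variable, which Mathlib writes `⟪1, a 1⟫`). -/
def tauLin (θ : Matrix (Fin n) (Fin n) ℝ) : alg θ →ₗ[ℂ] ℂ where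
  toFun a := ⟪oneL2 n, (a : B n) (oneL2 n)⟫_ℂ
  map_add' a b := by simp [inner_add_right]
  map_smul' c a := by simp [inner_smul_right]

open scoped ComplexOrder in
/-- The state `τ` on `A_θ` as a positive linear form. -/
def tau (θ : Matrix (Fin n) (Fin n) ℝ) : alg θ →ₚ[ℂ] ℂ :=
  PositiveLinearMap.mk₀ (tauLin θ) fun a ha =>
    ((ContinuousLinearMap.nonneg_iff_isPositive _).1
      (show (0 : B n) ≤ (a : B n) from ha)).inner_nonneg_right _

/-- The Hilbert space `𝓗_θ = L²(𝕋ⁿ_θ)` of the GNS representation of `τ`, i.e., the completion of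
`A_θ` for the inner product of `τ`. -/
abbrev Hilb (θ : Matrix (Fin n) (Fin n) ℝ) : Type := (tau θ).GNS

/-- The canonical map `A_θ → 𝓗_θ`. -/
def toHilb (θ : Matrix (Fin n) (Fin n) ℝ) (a : alg θ) : Hilb θ :=
  (((tau θ).toPreGNS a : (tau θ).PreGNS) : Hilb θ)

/-- The representation of `A_θ` in `𝓗_θ` which extends left multiplication. -/
def leftRep (θ : Matrix (Fin n) (Fin n) ℝ) : alg θ →⋆ₐ[ℂ] (Hilb θ →L[ℂ] Hilb θ) :=
  (tau θ).gnsStarAlgHom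

/-! ### The smooth noncommutative torus -/

/-- The action `α_s(T) = V_s T V_s⁻¹` of `s ∈ ℝⁿ`, where `V_s` is the translation by `s`. It
satisfies `α_s(U^k) = e^{i s·k} U^k`. -/
def action (s : E n) (T : B n) : B n := transl (toTorus s) * T * transl (toTorus (-s))

/-- The smooth noncommutative torus `𝓐_θ = C^∞(𝕋ⁿ_θ)`: the elements `u` of `A_θ` for which
`s ↦ α_s(u)` is a smooth map. -/
def smooth (θ : Matrix (Fin n) (Fin n) ℝ) : Submodule ℂ (alg θ) where
  carrier := {u | ContDiff ℝ ∞ fun s : E n => action s (u : B n)}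
  zero_mem' := by
    have h : (fun s : E n => action s ((0 : alg θ) : B n)) = fun _ => 0 := by
      ext1 s; simp [action]
    change ContDiff ℝ ∞ _
    rw [h]; exact contDiff_const
  add_mem' := by
    intro u v hu hv
    have h : (fun s : E n => action s ((u + v : alg θ) : B n)) =
        fun s => action s (u : B n) + action s (v : B n) := by
      ext1 s; simp [action, mul_add, add_mul]
    change ContDiff ℝ ∞ _
    rw [h]; exact ContDiff.add hu hv
  smul_mem' := by
    intro c u hu
    have h : (fun s : E n => action s ((c • u : alg θ) : B n)) =
        fun s => c • action s (u : B n) := by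
      ext1 s; simp [action]
    change ContDiff ℝ ∞ _
    rw [h]; exact ContDiff.const_smul c hu

/-- The derivation `δ_j(u) = (1/i) ∂_{s_j} α_s(u)|_{s=0}`. It maps `𝓐_θ` to itself. -/
def delta (j : Fin n) (T : B n) : B n :=
  (1 / Complex.I) • lineDeriv ℝ (fun s : E n => action s T) 0 (EuclideanSpace.single j 1)

/-- `δ^β = δ_1^{β_1} ⋯ δ_n^{β_n}`, `β ∈ ℕ₀ⁿ`. -/
def deltaPow (β : Fin n → ℕ) (T : B n) : B n :=
  (List.finRange n).foldr (fun j S => (delta j)^[β j] S) T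

/-! ### Symbols and pseudodifferential operators

The topology of `𝓐_θ` is given by the semi-norms `‖δ^α(u)‖`, and the operators `δ^α` are closed.
Therefore, a map `ρ` from an open set of `ℝⁿ` to `𝓐_θ` is smooth if and only if all the maps
`ξ ↦ δ^α(ρ(ξ))` are smooth for the C*-norm. In this case `δ^α ∂_ξ^β ρ = ∂_ξ^β δ^α ρ`, and a bound
on all the partial derivatives of order `m` amounts to a bound on the `m`-th Fréchet derivative. -/

variable (θ : Matrix (Fin n) (Fin n) ℝ)

/-- `S_q(ℝⁿ; 𝓐_θ)`: smooth maps `ρ : ℝⁿ \ 0 → 𝓐_θ` that are homogeneous of degree `q`.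
The value at `0` is immaterial. -/
structure IsHomogeneousSymbol (q : ℂ) (ρ : E n → smooth θ) : Prop where
  contDiffOn : ∀ α : Fin n → ℕ,
    ContDiffOn ℝ ∞ (fun ξ => deltaPow α ((ρ ξ : alg θ) : B n)) {0}ᶜ
  homogeneous : ∀ (t : ℝ) (ξ : E n), 0 < t → ξ ≠ 0 → ρ (t • ξ) = (t : ℂ) ^ q • ρ ξ

/-- `ρ ∈ S^q(ℝⁿ; 𝓐_θ)` with `ρ ∼ ∑_{j ≥ 0} ρ_{q-j}`, `ρ_{q-j} ∈ S_{q-j}(ℝⁿ; 𝓐_θ)`. Here `hom j`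
is `ρ_{q-j}`. -/
structure IsClassicalSymbol (q : ℂ) (ρ : E n → smooth θ) (hom : ℕ → E n → smooth θ) : Prop where
  contDiff : ∀ α : Fin n → ℕ, ContDiff ℝ ∞ fun ξ => deltaPow α ((ρ ξ : alg θ) : B n)
  homogeneous : ∀ j : ℕ, IsHomogeneousSymbol θ (q - j) (hom j)
  asymptotic : ∀ (N : ℕ) (α : Fin n → ℕ) (m : ℕ), ∃ C : ℝ, ∀ ξ : E n, 1 ≤ ‖ξ‖ →
    ‖iteratedFDeriv ℝ m (fun η : E n =>
        deltaPow α (((ρ η - ∑ j ∈ Finset.range N, hom j η : smooth θ) : alg θ) : B n)) ξ‖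
      ≤ C * ‖ξ‖ ^ (q.re - N - m)

/-- The point `k ∈ ℤⁿ ⊂ ℝⁿ`. -/
def latticePoint (k : Fin n → ℤ) : E n := WithLp.toLp 2 fun i => (k i : ℝ)

/-- `P = P_ρ`, i.e., `P u = ∑_{k ∈ ℤⁿ} u_k ρ(k) U^k` for all `u = ∑ u_k U^k` in `𝓐_θ`, where
`u_k = τ(u (U^k)*)`. -/
def IsOperatorOf (P : smooth θ →ₗ[ℂ] smooth θ) (ρ : E n → smooth θ) : Prop :=
  ∀ u : smooth θ, HasSum
    (fun k : Fin n → ℤ => tau θ ((u : alg θ) * star (U θ k)) •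
      ((ρ (latticePoint k) : alg θ) * U θ k))
    (P u : alg θ)

/-- `P ∈ Ψ^q(𝕋ⁿ_θ)` with symbol `ρ ∼ ∑_{j ≥ 0} ρ_{q-j}`. -/
structure IsPsiDOWithSymbol (q : ℂ) (P : smooth θ →ₗ[ℂ] smooth θ) (ρ : E n → smooth θ)
    (hom : ℕ → E n → smooth θ) : Prop where
  symbol : IsClassicalSymbol θ q ρ hom
  operator : IsOperatorOf θ P ρ

/-- `∫_{𝕊^{n-1}} σ(ξ) d^{n-1}ξ`, the integral for the surface measure of the unit sphere. -/
def sphereIntegral (σ : E n → smooth θ) : alg θ :=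
  ∫ ξ : Metric.sphere (0 : E n) 1, (σ (ξ : E n) : alg θ) ∂((volume : Measure (E n)).toSphere)

/-- The bounded operator `T` on `𝓗_θ` extends the operator `P` on `𝓐_θ`. -/
def Extends (T : Hilb θ →L[ℂ] Hilb θ) (P : smooth θ →ₗ[ℂ] smooth θ) : Prop :=
  ∀ u : smooth θ, T (toHilb θ (u : alg θ)) = toHilb θ (P u : alg θ)

end NCTorus

end

open MeasureTheory
open scoped ENNReal ContDiff InnerProductSpace

noncomputable section

/-! ### Diagonal operators -/

section Diagonal

variable {ι H : Type*} [NormedAddCommGroup H] [InnerProductSpace ℂ H]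

/-! In the orthonormal basis e_k = U^k of 𝓗_θ, expanding ρ(k) in its Fourier series gives Pe_k =
ρ(k)U^k = ∑_l f_l(k) U^l U^k with f_l(k) = τ(ρ(k)(U^l)*). Hence P = ∑_l U^l diag(f_l), where diag
refers to the basis (e_k). The theorem thereby splits into the NC integral of each diag(f_l) and a
rule for passing from diagonal operators to their products with elements of A_θ.

Convergence. Enumerate ℤⁿ so that k_j satisfies j + 1 ≤ C|k_j|ⁿ for k_j ≠ 0, and let D e_{k_j} =
(j+1)⁻¹ e_{k_j}. Then diag(f_l) = diag(s_l) D with s_l(k_j) = (j+1) f_l(k_j). The symbol estimates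
make sup|s_l| rapidly decreasing in l, so S = ∑_l U^l diag(s_l) converges in operator norm and P =
SD lies in 𝓛^{1,∞}. A trace φ is not assumed continuous, but A ↦ φ(AD) is a positive linear form on
bounded operators, hence norm continuous (`exists_norm_traceMul_le`). Therefore φ(aP) can be
computed term by term, without any topology on 𝓛^{1,∞} (`exists_hasNCIntegral_mul`).

Factorization. φ(c·diag(f)) = τ(c) φ(diag(f)) for c in A_θ when f = sr, with s bounded and D =
diag(r). By continuity only c = U^m matters. For m ≠ 0, conjugation by the diagonal unitary of the
characters k ↦ e^{is·k} fixes diag(f) and multiplies U^m by e^{is·m}, so the trace vanishes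
(`trace_shift_mul_diagOp`, `traceMul_rep_mul_diagOp`).

Diagonal operators. Divergence of the harmonic series forces φ to vanish on rank-one projections, so
that φ(diag(f)) = c whenever (j+1) f_j → c in some ordering (`hasNCIntegral_diagOp`). For a positive
G homogeneous of degree −n, counting lattice points in the dilates of {G^{-1/n} < 1} shows that the
values of G on ℤⁿ∖0 in decreasing order are asymptotic to (1/(nj)) ∫_𝕊 G
(`exists_enumeration_tendsto`). By linearity this extends to complex G, and errors o(|k|⁻ⁿ)
contribute nothing (`hasDiagIntegral_of_asymptotic`).

Summing over l gives φ(aP) = ∑_l τ(aU^l)·(1/n)·τ(c_P (U^l)*) = (1/n) τ(a c_P). The last series is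
the Fourier series of c_P, which converges in norm because c_P has rapidly decreasing coefficients.
-/

theorem HilbertBasis.ext_repr (b : HilbertBasis ι ℂ H) {x y : H}
    (h : ∀ i, b.repr x i = b.repr y i) : x = y :=
  b.repr.injective (lp.ext (funext h))

theorem HilbertBasis.clm_ext (b : HilbertBasis ι ℂ H) {S T : H →L[ℂ] H}
    (h : ∀ i, S (b i) = T (b i)) : S = T := by
  refine ContinuousLinearMap.ext_on (s := Set.range b) ?_ ?_
  · exact Submodule.dense_iff_topologicalClosure_eq_top.2 b.dense_span
  · rintro _ ⟨i, rfl⟩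
    exact h i

open Classical in
/-- The operator with `diagOp b f (b i) = f i • b i` for bounded `f`. It is `0` if `f` is
unbounded. -/
def diagOp (b : HilbertBasis ι ℂ H) (f : ι → ℂ) : H →L[ℂ] H :=
  if h : ∃ C : ℝ, ∀ i, ‖f i‖ ≤ C then
    (b.repr.symm.toContinuousLinearEquiv : _ →L[ℂ] H) ∘L
      -- The maximum with 0 keeps the constant non-negative even if `ι` is empty, where a negative
      -- bound is possible.
      (lp.mapCLM 2 (fun i => f i • ContinuousLinearMap.id ℂ ℂ) (K := max h.choose 0)
        (le_max_right _ _) fun i => (norm_smul_le _ _).trans (by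
          simpa using Or.inl (h.choose_spec i))) ∘L
      (b.repr.toContinuousLinearEquiv : H →L[ℂ] _)
  else 0

variable {b : HilbertBasis ι ℂ H} {f g : ι → ℂ}

theorem diagOp_repr {C : ℝ} (hf : ∀ i, ‖f i‖ ≤ C) (x : H) (i : ι) :
    b.repr (diagOp b f x) i = f i * b.repr x i := by
  have h : ∃ C : ℝ, ∀ i, ‖f i‖ ≤ C := ⟨C, hf⟩
  rw [diagOp, dif_pos h]
  simp

theorem repr_basis_mul (f : ι → ℂ) (i j : ι) :
    f j * b.repr (b i) j = f i * b.repr (b i) j := by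
  classical
  rw [b.repr_self]
  by_cases h : j = i
  · rw [h]
  · simp [h]

theorem diagOp_basis {C : ℝ} (hf : ∀ i, ‖f i‖ ≤ C) (i : ι) : diagOp b f (b i) = f i • b i := by
  refine b.ext_repr fun j => ?_
  rw [diagOp_repr hf, map_smul, repr_basis_mul]
  rfl

theorem eq_diagOp {C : ℝ} (hf : ∀ i, ‖f i‖ ≤ C) {T : H →L[ℂ] H} (hT : ∀ i, T (b i) = f i • b i) :
    T = diagOp b f :=
  b.clm_ext fun i => by rw [hT, diagOp_basis hf]

/-- The comparison is made coordinate by coordinate, so that `D` may be smaller than the supremum of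
`f` when some coordinates of `x` vanish. This is what bounds the characteristic values of
`harmonicOp`. -/
theorem norm_diagOp_apply_le {C : ℝ} (hf : ∀ i, ‖f i‖ ≤ C) {x y : H}
    {D : ℝ} (hD : 0 ≤ D) (h : ∀ i, ‖f i * b.repr x i‖ ≤ D * ‖b.repr y i‖) :
    ‖diagOp b f x‖ ≤ D * ‖y‖ := by
  rw [← b.repr.norm_map, ← b.repr.norm_map y]
  have : ‖b.repr (diagOp b f x)‖ ≤ ‖(D : ℂ) • b.repr y‖ := by
    refine lp.norm_mono (by simp) fun i => ?_
    rw [diagOp_repr hf]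
    refine (h i).trans (le_of_eq ?_)
    change _ = ‖(D : ℂ) * b.repr y i‖
    rw [norm_mul, Complex.norm_real, Real.norm_of_nonneg hD]
  rwa [norm_smul, Complex.norm_real, Real.norm_of_nonneg hD] at this

theorem norm_diagOp_le {C : ℝ} (hC : 0 ≤ C) (hf : ∀ i, ‖f i‖ ≤ C) : ‖diagOp b f‖ ≤ C :=
  ContinuousLinearMap.opNorm_le_bound _ hC fun x =>
    norm_diagOp_apply_le hf hC fun i => by
      rw [norm_mul]; exact mul_le_mul_of_nonneg_right (hf i) (norm_nonneg _)

theorem diagOp_mul {C D : ℝ} (hf : ∀ i, ‖f i‖ ≤ C) (hg : ∀ i, ‖g i‖ ≤ D) :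
    diagOp b f * diagOp b g = diagOp b fun i => f i * g i := by
  refine eq_diagOp (C := C * D) (fun i => ?_) fun i => ?_
  · rw [norm_mul]
    exact mul_le_mul (hf i) (hg i) (norm_nonneg _) ((norm_nonneg _).trans (hf i))
  · change diagOp b f (diagOp b g (b i)) = _
    rw [diagOp_basis hg, map_smul, diagOp_basis hf, smul_smul, mul_comm]

theorem diagOp_add {C D : ℝ} (hf : ∀ i, ‖f i‖ ≤ C) (hg : ∀ i, ‖g i‖ ≤ D) :
    diagOp b f + diagOp b g = diagOp b fun i => f i + g i := by
  refine eq_diagOp (C := C + D) (fun i => norm_add_le_of_le (hf i) (hg i)) fun i => ?_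
  rw [add_apply, diagOp_basis hg, diagOp_basis hf, add_smul]

theorem diagOp_smul {C : ℝ} (hf : ∀ i, ‖f i‖ ≤ C) (c : ℂ) :
    c • diagOp b f = diagOp b fun i => c * f i := by
  refine eq_diagOp (C := ‖c‖ * C) (fun i => ?_) fun i => ?_
  · rw [norm_mul]
    exact mul_le_mul_of_nonneg_left (hf i) (norm_nonneg _)
  · rw [smul_apply, diagOp_basis hf, smul_smul]

theorem diagOp_isPositive [CompleteSpace H] {r : ι → ℝ} {C : ℝ} (h0 : ∀ i, 0 ≤ r i)
    (hr : ∀ i, r i ≤ C) : (diagOp b fun i => (r i : ℂ)).IsPositive := by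
  have hf : ∀ i, ‖(r i : ℂ)‖ ≤ C := fun i => by
    rw [Complex.norm_real, Real.norm_of_nonneg (h0 i)]; exact hr i
  rw [ContinuousLinearMap.isPositive_def]
  refine ⟨fun x y => ?_, fun x => ?_⟩
  · change ⟪diagOp b _ x, y⟫_ℂ = ⟪x, diagOp b _ y⟫_ℂ
    rw [← b.repr.inner_map_map, ← b.repr.inner_map_map x, lp.inner_eq_tsum, lp.inner_eq_tsum]
    refine tsum_congr fun i => ?_
    rw [diagOp_repr hf, diagOp_repr hf]
    simp
    ring
  · rw [ContinuousLinearMap.reApplyInnerSelf_apply, ← b.repr.inner_map_map]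
    have h := Complex.hasSum_re
      (lp.hasSum_inner (b.repr (diagOp b (fun i => (r i : ℂ)) x)) (b.repr x))
    refine h.nonneg fun i => ?_
    rw [diagOp_repr hf]
    have : ⟪(r i : ℂ) * b.repr x i, b.repr x i⟫_ℂ = ((r i * ‖b.repr x i‖ ^ 2 : ℝ) : ℂ) := by
      rw [← smul_eq_mul, inner_smul_left, inner_self_eq_norm_sq_to_K]
      simp
    rw [this, Complex.ofReal_re]
    have := h0 i
    positivity

end Diagonal

/-! ### The model operator with eigenvalues `(k + 1)⁻¹` -/

section Harmonic

variable {ι H : Type*} [NormedAddCommGroup H] [InnerProductSpace ℂ H]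

/-- The operator is a finite combination of rank-one projections, each of which factors through the
scalars. -/
theorem isCompactOperator_diagOp_of_finite {b : HilbertBasis ι ℂ H} {f : ι → ℂ}
    (hf : (Function.support f).Finite) : IsCompactOperator (diagOp b f) := by
  classical
  obtain ⟨C, hC⟩ : ∃ C : ℝ, ∀ i, ‖f i‖ ≤ C := by
    refine ⟨∑ i ∈ hf.toFinset, ‖f i‖, fun i => ?_⟩
    by_cases hi : f i = 0
    · rw [hi, norm_zero]; exact Finset.sum_nonneg fun _ _ => norm_nonneg _
    · exact Finset.single_le_sum (f := fun i => ‖f i‖) (fun _ _ => norm_nonneg _)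
        (hf.mem_toFinset.2 hi)
  have h : diagOp b f = ∑ i ∈ hf.toFinset, f i • InnerProductSpace.rankOne ℂ (b i) (b i) := by
    refine (eq_diagOp hC fun j => ?_).symm
    rw [sum_apply]
    simp only [smul_apply, InnerProductSpace.rankOne_apply,
      orthonormal_iff_ite.1 b.orthonormal, ite_smul, one_smul, zero_smul, smul_ite, smul_zero]
    rw [Finset.sum_ite_eq']
    split_ifs with h
    · rfl
    · rw [hf.mem_toFinset, Function.notMem_support] at h
      rw [h, zero_smul]
  rw [h]
  refine Submodule.sum_mem (compactOperator (RingHom.id ℂ) H H) fun i _ => ?_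
  refine Submodule.smul_mem _ _ ?_
  have : IsCompactOperator (innerSL ℂ (b i)) :=
    isCompactOperator_of_locallyCompactSpace_dom (innerSL ℂ (b i))
  exact this.clm_comp (ContinuousLinearMap.toSpanSingleton ℂ (b i))

variable (b : HilbertBasis ℕ ℂ H)

/-- The operator with `harmonicOp b (b k) = (k + 1)⁻¹ • b k`. -/
def harmonicOp : H →L[ℂ] H := diagOp b fun k => (((k + 1 : ℝ)⁻¹ : ℝ) : ℂ)

theorem norm_inv_succ_le (k : ℕ) : ‖(((k + 1 : ℝ)⁻¹ : ℝ) : ℂ)‖ ≤ 1 := by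
  rw [Complex.norm_real, Real.norm_of_nonneg (by positivity)]
  exact inv_le_one_of_one_le₀ (by linarith [(Nat.cast_nonneg k : (0 : ℝ) ≤ k)])

theorem harmonicOp_basis (k : ℕ) : harmonicOp b (b k) = ((k : ℂ) + 1)⁻¹ • b k := by
  rw [harmonicOp, diagOp_basis norm_inv_succ_le]
  push_cast
  rfl

/-- This tail bound serves twice: for compactness, by truncation in norm, and for the bound on the
`m`-th characteristic value. -/
theorem norm_cutoff_le (m k : ℕ) :
    ‖if k < m then (0 : ℂ) else (((k + 1 : ℝ)⁻¹ : ℝ) : ℂ)‖ ≤ (m + 1 : ℝ)⁻¹ := by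
  split_ifs with h
  · rw [norm_zero]; positivity
  · rw [Complex.norm_real, Real.norm_of_nonneg (by positivity)]
    have : (m : ℝ) ≤ k := by exact_mod_cast not_lt.1 h
    gcongr

theorem isCompactOperator_harmonicOp [CompleteSpace H] : IsCompactOperator (harmonicOp b) := by
  refine isCompactOperator_of_tendsto (l := Filter.atTop)
    (F := fun m : ℕ => diagOp b fun k => if k < m then (((k + 1 : ℝ)⁻¹ : ℝ) : ℂ) else 0) ?_
    (Filter.Eventually.of_forall fun m => isCompactOperator_diagOp_of_finite ?_)
  · rw [tendsto_iff_norm_sub_tendsto_zero]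
    refine squeeze_zero (fun _ => norm_nonneg _) (fun m => ?_)
      tendsto_one_div_add_atTop_nhds_zero_nat
    rw [norm_sub_rev, one_div]
    have : harmonicOp b - (diagOp b fun k => if k < m then (((k + 1 : ℝ)⁻¹ : ℝ) : ℂ) else 0) =
        diagOp b fun k => if k < m then (0 : ℂ) else (((k + 1 : ℝ)⁻¹ : ℝ) : ℂ) := by
      refine eq_diagOp (norm_cutoff_le m) fun i => ?_
      rw [sub_apply, harmonicOp, diagOp_basis norm_inv_succ_le, diagOp_basis (C := 1), ← sub_smul]
      · congr 1; split_ifs <;> simp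
      · intro k
        split_ifs
        · exact norm_inv_succ_le k
        · simp
    rw [this]
    exact norm_diagOp_le (by positivity) (norm_cutoff_le m)
  · refine (Set.finite_lt_nat m).subset fun k hk => ?_
    by_contra h
    exact hk (if_neg h)

/-- The test subspace is spanned by the first `m` basis vectors; on its orthogonal complement only
the tail of the eigenvalues acts. -/
theorem charValue_harmonicOp_le (m : ℕ) : charValue m (harmonicOp b) ≤ (m + 1 : ℝ)⁻¹ := by
  classical
  refine charValue_le_of_forall (by positivity)
    (Submodule.span ℂ ((Finset.range m).image b : Set H)) ?_ fun x hx => ?_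
  · exact (finrank_span_finset_le_card _).trans (Finset.card_image_le.trans (by simp))
  · refine norm_diagOp_apply_le norm_inv_succ_le (by positivity) fun k => ?_
    by_cases hk : k < m
    · have : b.repr x k = 0 := by
        rw [b.repr_apply_apply]
        exact (Submodule.mem_orthogonal _ _).1 hx _ (Submodule.subset_span (by
          simp only [Finset.coe_image, Finset.coe_range]
          exact ⟨k, hk, rfl⟩))
      rw [this]; simp
    · rw [norm_mul]
      have := norm_cutoff_le m k
      rw [if_neg hk] at this
      gcongr

theorem harmonicOp_mem [CompleteSpace H] : harmonicOp b ∈ weakTraceClass H := by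
  refine ⟨isCompactOperator_harmonicOp b, 1, fun k => ?_⟩
  calc (k + 1 : ℝ) * charValue k (harmonicOp b) ≤ (k + 1 : ℝ) * (k + 1 : ℝ)⁻¹ := by
        gcongr; exact charValue_harmonicOp_le b k
    _ = 1 := mul_inv_cancel₀ (by positivity)

theorem harmonicOp_isPositive [CompleteSpace H] : (harmonicOp b).IsPositive :=
  diagOp_isPositive (r := fun k : ℕ => (k + 1 : ℝ)⁻¹) (C := 1) (fun _ => by positivity) fun k =>
    inv_le_one_of_one_le₀ (by linarith [(Nat.cast_nonneg k : (0 : ℝ) ≤ k)])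

end Harmonic

/-! ### Normalized positive traces -/

section Trace

variable {ι H : Type*} [NormedAddCommGroup H] [InnerProductSpace ℂ H] [CompleteSpace H]
  {φ : weakTraceClass H →ₗ[ℂ] ℂ}

/-- The linear form `A ↦ φ(A D)` on `𝓛(H)`. -/
def traceMul (φ : weakTraceClass H →ₗ[ℂ] ℂ) {D : H →L[ℂ] H} (hD : D ∈ weakTraceClass H) :
    (H →L[ℂ] H) →ₗ[ℂ] ℂ where
  toFun A := φ ⟨A * D, mul_mem_weakTraceClass A hD⟩
  map_add' A B := by
    rw [← map_add]
    exact congrArg φ (Subtype.ext (add_mul A B D))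
  map_smul' c A := by
    rw [← map_smul]
    exact congrArg φ (Subtype.ext (smul_mul_assoc c A D))

omit [CompleteSpace H] in
theorem traceMul_apply {D : H →L[ℂ] H} (hD : D ∈ weakTraceClass H) (A : H →L[ℂ] H) :
    traceMul φ hD A = φ ⟨A * D, mul_mem_weakTraceClass A hD⟩ := rfl

namespace IsNormalizedPositiveTrace

variable (hφ : IsNormalizedPositiveTrace φ)
include hφ

theorem comm (A : H →L[ℂ] H) {T : H →L[ℂ] H} (hT : T ∈ weakTraceClass H) :
    φ ⟨A * T, mul_mem_weakTraceClass A hT⟩ = φ ⟨T * A, mem_weakTraceClass_mul hT A⟩ := by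
  have h := hφ.commutator A ⟨T, hT⟩
  rw [← sub_eq_zero, ← map_sub]
  exact h

open scoped ComplexOrder in
-- With R = √A, the trace property gives φ(AD) = φ(RDR), and RDR is positive.
theorem traceMul_nonneg {D : H →L[ℂ] H} (hD : D ∈ weakTraceClass H) (hpos : D.IsPositive)
    {A : H →L[ℂ] H} (hA : 0 ≤ A) : 0 ≤ traceMul φ hD A := by
  set R := CFC.sqrt A with hR
  have hRR : R * R = A := CFC.sqrt_mul_sqrt_self A hA
  have hRs : star R = R := (CFC.sqrt_nonneg A).isSelfAdjoint.star_eq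
  have h1 : traceMul φ hD A =
      φ ⟨R * D * R, mem_weakTraceClass_mul (mul_mem_weakTraceClass R hD) R⟩ := by
    rw [traceMul_apply, ← hφ.comm R (mul_mem_weakTraceClass R hD)]
    refine congrArg φ (Subtype.ext ?_)
    change A * D = R * (R * D)
    rw [← mul_assoc, hRR]
  have h2 : (R * D * R).IsPositive := by
    have := hpos.conj_adjoint R
    rw [← ContinuousLinearMap.star_eq_adjoint, hRs] at this
    exact this
  obtain ⟨h3, h4⟩ :=
    hφ.positive ⟨R * D * R, mem_weakTraceClass_mul (mul_mem_weakTraceClass R hD) R⟩ h2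
  rw [h1]
  exact Complex.nonneg_iff.2 ⟨h3, h4.symm⟩

open scoped ComplexOrder in
-- Positive linear forms on a C*-algebra are automatically bounded. This is the only source of
-- continuity in the argument: `φ` itself is a purely algebraic object.
theorem exists_norm_traceMul_le {D : H →L[ℂ] H} (hD : D ∈ weakTraceClass H)
    (hpos : D.IsPositive) : ∃ C : ℝ, 0 ≤ C ∧ ∀ A, ‖traceMul φ hD A‖ ≤ C * ‖A‖ := by
  obtain ⟨C, hC⟩ := PositiveLinearMap.exists_norm_apply_le
    (PositiveLinearMap.mk₀ (traceMul φ hD) fun A hA => hφ.traceMul_nonneg hD hpos hA)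
  exact ⟨C, C.2, hC⟩

theorem continuous_traceMul {D : H →L[ℂ] H} (hD : D ∈ weakTraceClass H)
    (hpos : D.IsPositive) : Continuous (traceMul φ hD) := by
  obtain ⟨C, -, hC⟩ := hφ.exists_norm_traceMul_le hD hpos
  exact AddMonoidHomClass.continuous_of_bound (traceMul φ hD) C hC

/-- All the operators `T₀` are unitarily equivalent. -/
theorem apply_harmonicOp (b : HilbertBasis ℕ ℂ H) : φ ⟨harmonicOp b, harmonicOp_mem b⟩ = 1 := by
  obtain ⟨ξ, ⟨T₀, hT₀⟩, h1, h2⟩ := hφ.normalized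
  set V : H →L[ℂ] H :=
    (ξ.repr.trans b.repr.symm).toContinuousLinearEquiv.toContinuousLinearMap with hV
  set W : H →L[ℂ] H :=
    (b.repr.trans ξ.repr.symm).toContinuousLinearEquiv.toContinuousLinearMap with hW
  have hVξ : ∀ k, V (ξ k) = b k := fun k => by
    classical
    simp [hV, ξ.repr_self, b.repr_symm_single]
  have hWb : ∀ k, W (b k) = ξ k := fun k => by
    classical
    simp [hW, b.repr_self, ξ.repr_symm_single]
  have h3 : harmonicOp b = V * (T₀ * W) := b.clm_ext fun k => by
    change _ = V (T₀ (W (b k)))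
    rw [hWb, h1, map_smul, hVξ, harmonicOp_basis]
  have h4 : T₀ * W * V = T₀ := ξ.clm_ext fun k => by
    change T₀ (W (V (ξ k))) = _
    rw [hVξ, hWb]
  rw [← h2]
  have h5 := hφ.comm V (mem_weakTraceClass_mul hT₀ W)
  refine (congrArg φ (Subtype.ext h3)).trans (h5.trans (congrArg φ (Subtype.ext h4)))

omit hφ in
-- Multiplying by the inverse of the eigenvalue at `b j` exhibits the operator as a bounded operator
-- times `harmonicOp b`, so the ideal property applies.
theorem rankOne_mem (b : HilbertBasis ℕ ℂ H) (i j : ℕ) :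
    InnerProductSpace.rankOne ℂ (b i) (b j) ∈ weakTraceClass H := by
  have : InnerProductSpace.rankOne ℂ (b i) (b j) =
      (((j : ℂ) + 1) • InnerProductSpace.rankOne ℂ (b i) (b j)) * harmonicOp b :=
    b.clm_ext fun k => by
      change _ = (((j : ℂ) + 1) • InnerProductSpace.rankOne ℂ (b i) (b j)) (harmonicOp b (b k))
      rw [harmonicOp_basis]
      simp only [smul_apply, InnerProductSpace.rankOne_apply, inner_smul_right,
        orthonormal_iff_ite.1 b.orthonormal]
      split_ifs with h
      · rw [h, smul_smul, mul_one, mul_inv_cancel₀ (Nat.cast_add_one_ne_zero k)]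
      · simp
  rw [this]
  exact mul_mem_weakTraceClass _ (harmonicOp_mem b)

/-- The two projections are the products of the matrix units e_ij and e_ji in the two possible
orders. -/
theorem apply_rankOne_eq (b : HilbertBasis ℕ ℂ H) (i j : ℕ) :
    φ ⟨_, rankOne_mem b i i⟩ = φ ⟨_, rankOne_mem b j j⟩ := by
  have h := hφ.comm (InnerProductSpace.rankOne ℂ (b i) (b j)) (rankOne_mem b j i)
  have hm : ∀ i j, InnerProductSpace.rankOne ℂ (b i) (b j) *
      InnerProductSpace.rankOne ℂ (b j) (b i) = InnerProductSpace.rankOne ℂ (b i) (b i) := by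
    intro i j
    rw [ContinuousLinearMap.mul_def, InnerProductSpace.rankOne_comp_rankOne,
      orthonormal_iff_ite.1 b.orthonormal]
    simp
  exact (congrArg φ (Subtype.ext (hm i j).symm)).trans
    (h.trans (congrArg φ (Subtype.ext (hm j i))))

/-- The sum of `1 / (j + 1)` diverges, so that a normalized positive trace vanishes on projections
of rank one. -/
theorem apply_rankOne (b : HilbertBasis ℕ ℂ H) (i : ℕ) :
    φ ⟨_, rankOne_mem b i i⟩ = 0 := by
  have hpr : ∀ j, (InnerProductSpace.rankOne ℂ (b j) (b j)).IsPositive := fun j =>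
    InnerProductSpace.isPositive_rankOne_self _
  obtain ⟨hp, him⟩ := hφ.positive ⟨_, rankOne_mem b i i⟩ (hpr i)
  refine Complex.ext (le_antisymm (not_lt.1 fun hlt => ?_) hp) him
  set p := (φ ⟨_, rankOne_mem b i i⟩).re with hpdef
  -- Removing the first `N` spectral components from `harmonicOp b` leaves a positive operator. All
  -- rank-one projections have the same trace, so positivity bounds `p` times the `N`-th harmonic
  -- sum by the trace of `harmonicOp b`.
  have key : ∀ N : ℕ, p * ∑ j ∈ Finset.range N, (1 / ((j : ℝ) + 1)) ≤ 1 := by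
    intro N
    set S : weakTraceClass H := ∑ j ∈ Finset.range N,
      ((1 / ((j : ℝ) + 1) : ℝ) : ℂ) • ⟨_, rankOne_mem b j j⟩ with hS
    set R : weakTraceClass H := ⟨harmonicOp b, harmonicOp_mem b⟩ - S with hRdef
    have hR : (R : H →L[ℂ] H).IsPositive := by
      have : (R : H →L[ℂ] H) =
          diagOp b fun k => ((if k < N then 0 else (k + 1 : ℝ)⁻¹ : ℝ) : ℂ) := by
        refine eq_diagOp (C := 1) (fun k => ?_) fun k => ?_
        · split_ifs
          · simp
          · exact norm_inv_succ_le k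
        · simp only [hRdef, hS, Submodule.coe_sub, Submodule.coe_sum, Submodule.coe_smul,
            sub_apply, harmonicOp_basis, sum_apply, smul_apply,
            InnerProductSpace.rankOne_apply, orthonormal_iff_ite.1 b.orthonormal, ite_smul,
            one_smul, zero_smul, smul_ite, smul_zero, Finset.sum_ite_eq', Finset.mem_range]
          split_ifs with h
          · simp
          · simp
      rw [this]
      refine diagOp_isPositive (C := 1) (fun k => ?_) fun k => ?_
      · split_ifs <;> positivity
      · split_ifs
        · exact zero_le_one
        · exact inv_le_one_of_one_le₀ (by linarith [(Nat.cast_nonneg k : (0 : ℝ) ≤ k)])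
    have h1 := (hφ.positive R hR).1
    have h2 : φ R = 1 - ((∑ j ∈ Finset.range N, (1 / ((j : ℝ) + 1)) : ℝ) : ℂ) *
        φ ⟨_, rankOne_mem b i i⟩ := by
      rw [hRdef, map_sub, hφ.apply_harmonicOp, hS, map_sum]
      congr 1
      rw [Complex.ofReal_sum, Finset.sum_mul]
      refine Finset.sum_congr rfl fun j _ => ?_
      rw [map_smul, hφ.apply_rankOne_eq b j i, smul_eq_mul]
    rw [h2, Complex.sub_re, Complex.one_re, Complex.re_ofReal_mul] at h1
    linarith [mul_comm p (∑ j ∈ Finset.range N, (1 / ((j : ℝ) + 1)))]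
  have htop := Real.tendsto_sum_range_one_div_nat_succ_atTop
  obtain ⟨N, hN⟩ := (htop.eventually_gt_atTop (1 / p)).exists
  have := key N
  rw [div_lt_iff₀ hlt] at hN
  exact absurd this (not_le.2 (by simpa [mul_comm] using hN))

/-- The product with `harmonicOp b` is a finite combination of projections on which `φ` vanishes. -/
theorem traceMul_diagOp_of_finite (b : HilbertBasis ℕ ℂ H) {f : ℕ → ℂ}
    (hf : (Function.support f).Finite) : traceMul φ (harmonicOp_mem b) (diagOp b f) = 0 := by
  obtain ⟨C, hC⟩ : ∃ C : ℝ, ∀ i, ‖f i‖ ≤ C := by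
    refine ⟨∑ i ∈ hf.toFinset, ‖f i‖, fun i => ?_⟩
    by_cases hi : f i = 0
    · rw [hi, norm_zero]; exact Finset.sum_nonneg fun _ _ => norm_nonneg _
    · exact Finset.single_le_sum (f := fun i => ‖f i‖) (fun _ _ => norm_nonneg _)
        (hf.mem_toFinset.2 hi)
  have h : (⟨diagOp b f * harmonicOp b, mul_mem_weakTraceClass _ (harmonicOp_mem b)⟩ :
      weakTraceClass H) = ∑ i ∈ hf.toFinset, (f i * ((i : ℂ) + 1)⁻¹) • ⟨_, rankOne_mem b i i⟩ := by
    refine Subtype.ext (b.clm_ext fun k => ?_)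
    change diagOp b f (harmonicOp b (b k)) = _
    rw [harmonicOp_basis, map_smul, diagOp_basis hC]
    simp only [Submodule.coe_sum, Submodule.coe_smul, sum_apply, smul_apply,
      InnerProductSpace.rankOne_apply, orthonormal_iff_ite.1 b.orthonormal, ite_smul,
      one_smul, zero_smul, smul_ite, smul_zero, Finset.sum_ite_eq', Set.Finite.mem_toFinset]
    split_ifs with h
    · rw [smul_smul, mul_comm]
    · rw [hf.mem_toFinset, Function.notMem_support] at h
      rw [h, zero_smul, smul_zero]
  rw [traceMul_apply, h, map_sum]
  refine Finset.sum_eq_zero fun i _ => ?_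
  rw [map_smul, hφ.apply_rankOne, smul_zero]

/-- A finitely supported head has trace zero, the tail is small in operator norm, and the form A ↦
φ(AD) is norm bounded. -/
theorem traceMul_diagOp_of_tendsto_zero (b : HilbertBasis ℕ ℂ H) {f : ℕ → ℂ}
    (hf : Filter.Tendsto f Filter.atTop (nhds 0)) :
    traceMul φ (harmonicOp_mem b) (diagOp b f) = 0 := by
  obtain ⟨B, hB⟩ : ∃ B : ℝ, ∀ i, ‖f i‖ ≤ B := by
    obtain ⟨B, hB⟩ := (Metric.isBounded_range_of_tendsto f hf).exists_norm_le
    exact ⟨B, fun i => hB _ ⟨i, rfl⟩⟩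
  obtain ⟨C, hC0, hC⟩ := hφ.exists_norm_traceMul_le (harmonicOp_mem b) (harmonicOp_isPositive b)
  refine norm_le_zero_iff.1 (le_of_forall_pos_le_add fun ε hε => ?_)
  -- The denominator `C + 1` instead of `C` covers the case `C = 0`.
  have hδ : 0 < ε / (C + 1) := by positivity
  obtain ⟨N, hN⟩ := Metric.tendsto_atTop.1 hf _ hδ
  have hsum : diagOp b f = diagOp b (fun k => if k < N then f k else 0) +
      diagOp b (fun k => if k < N then 0 else f k) := by
    rw [diagOp_add (C := B) (D := B)]
    · congr 1; ext k; split_ifs <;> simp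
    · intro k
      split_ifs
      · exact hB k
      · rw [norm_zero]; exact (norm_nonneg _).trans (hB k)
    · intro k
      split_ifs
      · rw [norm_zero]; exact (norm_nonneg _).trans (hB k)
      · exact hB k
  rw [hsum, map_add, hφ.traceMul_diagOp_of_finite b
    ((Set.finite_lt_nat N).subset fun k hk => by
      by_contra h
      exact hk (if_neg h)), zero_add, zero_add]
  refine (hC _).trans ?_
  have hn : ‖diagOp b (fun k => if k < N then 0 else f k)‖ ≤ ε / (C + 1) := by
    refine norm_diagOp_le hδ.le fun k => ?_
    split_ifs with h
    · simp [hδ.le]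
    · simpa using (hN k (not_lt.1 h)).le
  calc C * _ ≤ C * (ε / (C + 1)) := by gcongr
    _ ≤ ε := by
      rw [mul_div_assoc', div_le_iff₀ (by positivity)]
      nlinarith

end IsNormalizedPositiveTrace

/-- The Hilbert basis `b ∘ σ`. -/
def HilbertBasis.reindexEquiv {κ : Type*} (b : HilbertBasis ι ℂ H) (σ : κ ≃ ι) :
    HilbertBasis κ ℂ H :=
  HilbertBasis.mk (v := b ∘ σ) (b.orthonormal.comp σ σ.injective)
    (by rw [σ.surjective.range_comp]; exact b.dense_span.ge)

theorem HilbertBasis.reindexEquiv_apply {κ : Type*} (b : HilbertBasis ι ℂ H) (σ : κ ≃ ι) (k : κ) :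
    b.reindexEquiv σ k = b (σ k) :=
  congrFun (HilbertBasis.coe_mk _ _) k

/-- Diagonal operators do not see the ordering of the basis, so the enumeration can be adapted to
each family of entries. -/
theorem diagOp_reindexEquiv {κ : Type*} (b : HilbertBasis ι ℂ H) (σ : κ ≃ ι) {f : ι → ℂ} {C : ℝ}
    (hf : ∀ i, ‖f i‖ ≤ C) : diagOp (b.reindexEquiv σ) (f ∘ σ) = diagOp b f := by
  refine (eq_diagOp (C := C) (fun k => hf (σ k)) fun k => ?_).symm
  rw [b.reindexEquiv_apply, diagOp_basis hf]

/-- Both sequences must be bounded, because `diagOp` has the junk value 0 on unbounded entries. One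
constant works for both since j + 1 ≥ 1. -/
theorem exists_bound_of_tendsto_mul {f : ℕ → ℂ} {c : ℂ}
    (h : Filter.Tendsto (fun j : ℕ => ((j : ℂ) + 1) * f j) Filter.atTop (nhds c)) :
    ∃ B : ℝ, ∀ j : ℕ, ‖((j : ℂ) + 1) * f j‖ ≤ B ∧ ‖f j‖ ≤ B := by
  obtain ⟨B, hB⟩ := (Metric.isBounded_range_of_tendsto _ h).exists_norm_le
  refine ⟨B, fun j => ⟨hB _ ⟨j, rfl⟩, le_trans ?_ (hB _ ⟨j, rfl⟩)⟩⟩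
  rw [norm_mul]
  refine le_mul_of_one_le_left (norm_nonneg _) ?_
  have : ((j : ℂ) + 1) = ((j + 1 : ℝ) : ℂ) := by push_cast; rfl
  rw [this, Complex.norm_real, Real.norm_of_nonneg (by positivity)]
  linarith [(Nat.cast_nonneg j : (0 : ℝ) ≤ j)]

omit [CompleteSpace H] in
theorem diagOp_eq_mul_harmonicOp {b : HilbertBasis ℕ ℂ H} {f : ℕ → ℂ} {B : ℝ}
    (hB : ∀ j : ℕ, ‖((j : ℂ) + 1) * f j‖ ≤ B ∧ ‖f j‖ ≤ B) :
    diagOp b f = (diagOp b fun j => ((j : ℂ) + 1) * f j) * harmonicOp b := by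
  refine b.clm_ext fun k => ?_
  change _ = (diagOp b fun j => ((j : ℂ) + 1) * f j) (harmonicOp b (b k))
  rw [harmonicOp_basis, map_smul, diagOp_basis fun j => (hB j).1, diagOp_basis fun j => (hB j).2,
    smul_smul, inv_mul_cancel_left₀ (Nat.cast_add_one_ne_zero k)]

/-- Split off the limit: entries tending to zero are invisible to `φ`, and the scalar part
contributes `c` times the trace of `harmonicOp b`, which is 1. -/
theorem traceMul_diagOp_of_tendsto {φ : weakTraceClass H →ₗ[ℂ] ℂ}
    (hφ : IsNormalizedPositiveTrace φ) (b : HilbertBasis ℕ ℂ H) {f : ℕ → ℂ} {c : ℂ}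
    (h : Filter.Tendsto f Filter.atTop (nhds c)) :
    traceMul φ (harmonicOp_mem b) (diagOp b f) = c := by
  have h0 : Filter.Tendsto (fun j => f j - c) Filter.atTop (nhds 0) := by
    simpa using h.sub_const c
  obtain ⟨B, hB⟩ := (Metric.isBounded_range_of_tendsto _ h0).exists_norm_le
  have h1 : diagOp b f = diagOp b (fun j => f j - c) + c • 1 := by
    refine b.clm_ext fun k => ?_
    obtain ⟨B', hB'⟩ := (Metric.isBounded_range_of_tendsto _ h).exists_norm_le
    rw [add_apply, diagOp_basis fun j => hB' _ ⟨j, rfl⟩, diagOp_basis fun j => hB _ ⟨j, rfl⟩,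
      sub_smul]
    simp
  rw [h1, map_add, hφ.traceMul_diagOp_of_tendsto_zero b h0, map_smul, traceMul_apply]
  have : φ ⟨1 * harmonicOp b, mul_mem_weakTraceClass 1 (harmonicOp_mem b)⟩ = 1 :=
    (congrArg φ (Subtype.ext (one_mul _))).trans (hφ.apply_harmonicOp b)
  rw [this, zero_add, smul_eq_mul, mul_one]

/-- A diagonal operator whose entries `f`, in a suitable order, satisfy `(j + 1) f_j → c`, is
strongly measurable with NC integral `c`. -/
theorem hasNCIntegral_diagOp (b : HilbertBasis ι ℂ H) (σ : ℕ ≃ ι) {f : ι → ℂ} {c : ℂ}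
    (h : Filter.Tendsto (fun j : ℕ => ((j : ℂ) + 1) * f (σ j)) Filter.atTop (nhds c)) :
    HasNCIntegral (diagOp b f) c := by
  obtain ⟨B, hB⟩ := exists_bound_of_tendsto_mul h
  have hf : ∀ i, ‖f i‖ ≤ B := fun i => by simpa using (hB (σ.symm i)).2
  have h1 : diagOp b f =
      (diagOp (b.reindexEquiv σ) fun j => ((j : ℂ) + 1) * f (σ j)) *
        harmonicOp (b.reindexEquiv σ) := by
    rw [← diagOp_reindexEquiv b σ hf]
    exact diagOp_eq_mul_harmonicOp (f := f ∘ σ) hB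
  rw [h1]
  refine ⟨mul_mem_weakTraceClass _ (harmonicOp_mem _), fun φ hφ => ?_⟩
  exact traceMul_diagOp_of_tendsto hφ _ h

end Trace

/-! ### Enumeration in increasing order -/

/-- A countable infinite set can be enumerated in the increasing order of a function with finite
sublevel sets. -/
theorem exists_equiv_nat_monotone {ι : Type*} [Countable ι] [Infinite ι] (h : ι → ℝ)
    (hfin : ∀ r, {i | h i ≤ r}.Finite) : ∃ σ : ℕ ≃ ι, Monotone (h ∘ σ) := by
  obtain ⟨e, he⟩ := exists_injective_nat ι
  -- Ties in `h` are broken by an injection into ℕ. The resulting linear order has finite initial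
  -- segments and no maximum, hence is isomorphic to ℕ.
  let key : ι → ℝ ×ₗ ℕ := fun i => toLex (h i, e i)
  have hkey : Function.Injective key := fun i j hij => he (congrArg (fun p => (ofLex p).2) hij)
  let : LinearOrder ι := LinearOrder.lift' key hkey
  have hmono : ∀ i j : ι, i ≤ j → h i ≤ h j := fun i j hij => by
    rcases (Prod.Lex.le_iff (x := key i) (y := key j)).1 hij with h1 | h1
    · exact h1.le
    · exact h1.1.le
  have hIic : ∀ i : ι, (Set.Iic i).Finite := fun i => (hfin (h i)).subset fun j hj => hmono j i hj
  let : LocallyFiniteOrder ι := LocallyFiniteOrder.ofFiniteIcc fun a b =>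
    (hIic b).subset Set.Icc_subset_Iic_self
  have : NoMaxOrder ι := ⟨fun a => by
    obtain ⟨b, hb⟩ := (hIic a).infinite_compl.nonempty
    exact ⟨b, not_le.1 hb⟩⟩
  obtain ⟨i₀⟩ : Nonempty ι := inferInstance
  obtain ⟨m, -, hm⟩ := Set.exists_min_image (Set.Iic i₀) id (hIic i₀) ⟨i₀, le_refl i₀⟩
  let : OrderBot ι :=
    { bot := m
      bot_le := fun a => by
        rcases le_total a i₀ with h1 | h1
        · exact hm a h1
        · exact (hm i₀ (le_refl i₀)).trans h1 }
  let : SuccOrder ι := LinearLocallyFiniteOrder.succOrder ι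
  let : PredOrder ι := LinearLocallyFiniteOrder.predOrder ι
  refine ⟨(orderIsoNatOfLinearSuccPredArch (ι := ι)).symm.toEquiv, fun a b hab => hmono _ _ ?_⟩
  exact (orderIsoNatOfLinearSuccPredArch (ι := ι)).symm.monotone hab

/-- If the numbers of `i` with `h i ≤ r` and with `h i < r` are both equivalent to `v rⁿ`, then
`(j + 1) / (h (σ j))ⁿ → v` for the enumeration `σ` in the increasing order of `h`. -/
theorem tendsto_succ_div_pow_of_card {ι : Type*} (h : ι → ℝ) {n : ℕ} {v : ℝ} (σ : ℕ ≃ ι)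
    (hσ : Monotone (h ∘ σ)) (hfin : ∀ r, {i | h i ≤ r}.Finite)
    (hle : Filter.Tendsto (fun r : ℝ =>
      (Nat.card {i | h i ≤ r} : ℝ) / r ^ n)
      Filter.atTop (nhds v))
    (hlt : Filter.Tendsto (fun r : ℝ =>
      (Nat.card {i | h i < r} : ℝ) / r ^ n)
      Filter.atTop (nhds v)) (hn : n ≠ 0) :
    Filter.Tendsto (fun j : ℕ => ((j : ℝ) + 1) / h (σ j) ^ n) Filter.atTop (nhds v) := by
  have htop : Filter.Tendsto (fun j : ℕ => h (σ j)) Filter.atTop Filter.atTop := by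
    refine Filter.tendsto_atTop.2 fun r => ?_
    have h1 : ({i | h i ≤ r}ᶜ) ∈ Filter.cofinite := by
      rw [Filter.mem_cofinite, compl_compl]; exact hfin r
    have h2 := σ.injective.tendsto_cofinite.eventually h1
    rw [Nat.cofinite_eq_atTop] at h2
    exact h2.mono fun j hj => (not_le.1 hj).le
  have h1 := hle.comp htop
  -- This is the lower side of a squeeze. Indices with strictly smaller `h` are among the first `j`,
  -- while the first `j + 1` all have value at most `h (σ j)`; because of ties both counts are
  -- needed. The summand 1 / hⁿ accounts for `j + 1` in place of `j` and vanishes in the limit.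
  have h2 : Filter.Tendsto (fun j : ℕ => (Nat.card {i | h i < h (σ j)} : ℝ) / h (σ j) ^ n +
      1 / h (σ j) ^ n) Filter.atTop (nhds v) := by
    have h3 : Filter.Tendsto (fun j : ℕ => 1 / h (σ j) ^ n) Filter.atTop (nhds 0) := by
      simp only [one_div]
      exact ((Filter.tendsto_pow_atTop hn).comp htop).inv_tendsto_atTop
    simpa using (hlt.comp htop).add h3
  have hpos : ∀ᶠ j : ℕ in Filter.atTop, 0 < h (σ j) := htop.eventually_gt_atTop 0
  refine tendsto_of_tendsto_of_tendsto_of_le_of_le' h2 h1 (hpos.mono fun j hj => ?_)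
    (hpos.mono fun j hj => ?_)
  · rw [← add_div]
    have : Nat.card {i | h i < h (σ j)} ≤ j := by
      have h4 : {i | h i < h (σ j)} ⊆ ((Finset.range j).map σ.toEmbedding : Set ι) := by
        intro i hi
        rw [Finset.coe_map]
        refine ⟨σ.symm i, ?_, by simp⟩
        rw [Finset.coe_range, Set.mem_Iio]
        by_contra hc
        have := hσ (not_lt.1 hc)
        simp only [Function.comp_apply, Equiv.apply_symm_apply] at this
        exact absurd hi (not_lt.2 this)
      have h5 := Nat.card_mono (Finset.finite_toSet _) h4
      rwa [Nat.card_coe_set_eq, Nat.card_coe_set_eq, Set.ncard_coe_finset, Finset.card_map,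
        Finset.card_range] at h5
    have h6 : (Nat.card {i | h i < h (σ j)} : ℝ) ≤ j := by exact_mod_cast this
    gcongr
  · have : j + 1 ≤ Nat.card {i | h i ≤ h (σ j)} := by
      have h4 : ((Finset.range (j + 1)).map σ.toEmbedding : Set ι) ⊆ {i | h i ≤ h (σ j)} := by
        intro i hi
        rw [Finset.coe_map] at hi
        obtain ⟨l, hl, rfl⟩ := hi
        rw [Finset.coe_range, Set.mem_Iio] at hl
        exact hσ (Nat.lt_succ_iff.1 hl)
      have h5 := Nat.card_mono (hfin _) h4
      rwa [Nat.card_coe_set_eq, Nat.card_coe_set_eq, Set.ncard_coe_finset, Finset.card_map,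
        Finset.card_range] at h5
    have h6 : (j : ℝ) + 1 ≤ (Nat.card {i | h i ≤ h (σ j)} : ℝ) := by exact_mod_cast this
    change _ ≤ (Nat.card {i | h i ≤ h (σ j)} : ℝ) / h (σ j) ^ n
    gcongr

/-! ### Counting lattice points -/

namespace NCTorus

section LatticePoints

open scoped Pointwise

variable {n : ℕ}

/-- If the level 1 had positive measure, dilation would give positive measure to every positive
level: uncountably many disjoint sets, which a σ-finite measure does not allow. -/
theorem measure_level_set_eq_zero {h : (Fin n → ℝ) → ℝ} (hc : Continuous h)
    (hhom : ∀ (t : ℝ) (x), 0 < t → h (t • x) = t * h x) : volume {x | h x = 1} = 0 := by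
  by_contra hne
  have hpos : ∀ t ∈ Set.Ioi (0 : ℝ), 0 < volume {x | h x = t} := by
    intro t ht
    rw [Set.mem_Ioi] at ht
    have : {x | h x = t} = t • {x | h x = 1} := by
      ext x
      rw [Set.mem_smul_set_iff_inv_smul_mem₀ ht.ne', Set.mem_ofPred_eq, Set.mem_ofPred_eq,
        hhom _ _ (inv_pos.2 ht), inv_mul_eq_one₀ ht.ne', eq_comm]
    rw [this, Measure.addHaar_smul]
    refine ENNReal.mul_pos ?_ hne
    rw [Ne, ENNReal.ofReal_eq_zero, not_le]
    positivity
  have h1 := Measure.countable_meas_level_set_pos (μ := (volume : Measure (Fin n → ℝ)))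
    hc.measurable
  have h2 : (Set.Ioi (0 : ℝ)).Countable := h1.mono hpos
  have h3 := (Cardinal.le_aleph0_iff_set_countable).2 h2
  rw [Cardinal.mk_Ioi_real] at h3
  exact absurd h3 (not_le.2 Cardinal.aleph0_lt_continuum)

/-- Dilation by r⁻¹ trades a growing region for a refined lattice in a fixed region. The relation
`Q` stands for `≤` or `<`, so that closed and open sublevel sets share one argument. -/
theorem card_lattice_eq (h : (Fin n → ℝ) → ℝ) (hhom : ∀ (t : ℝ) (x), 0 < t → h (t • x) = t * h x)
    {Q : ℝ → ℝ → Prop} (hQ : ∀ r y, 0 < r → (Q (r⁻¹ * y) 1 ↔ Q y r)) {r : ℝ} (hr : 0 < r) :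
    Nat.card {k : Fin n → ℤ | Q (h fun i => (k i : ℝ)) r} =
      Nat.card ↑({x | Q (h x) 1} ∩
        r⁻¹ • (Submodule.span ℤ (Set.range (Pi.basisFun ℝ (Fin n))) : Set (Fin n → ℝ))) := by
  refine Nat.card_congr (Equiv.ofBijective
    (fun k => ⟨r⁻¹ • fun i => ((k : Fin n → ℤ) i : ℝ), ?_, ?_⟩) ⟨?_, ?_⟩)
  · rw [Set.mem_ofPred_eq, hhom _ _ (inv_pos.2 hr), hQ _ _ hr]
    exact k.2
  · refine Set.smul_mem_smul_set ?_
    rw [SetLike.mem_coe, Module.Basis.mem_span_iff_repr_mem]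
    intro i
    exact ⟨k.1 i, by simp⟩
  · rintro ⟨k, hk⟩ ⟨l, hl⟩ hkl
    refine Subtype.ext (funext fun i => ?_)
    have h1 := congrFun (smul_right_injective _ (inv_pos.2 hr).ne' (Subtype.ext_iff.1 hkl)) i
    exact_mod_cast h1
  · rintro ⟨x, hx, y, hy, hxy⟩
    rw [SetLike.mem_coe, Module.Basis.mem_span_iff_repr_mem] at hy
    choose k hk using hy
    have hky : (fun i => (k i : ℝ)) = y := funext fun i => by simpa using hk i
    refine ⟨⟨k, ?_⟩, Subtype.ext ?_⟩
    · rw [Set.mem_ofPred_eq, ← hQ _ _ hr, ← hhom _ _ (inv_pos.2 hr), hky]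
      have : r⁻¹ • y = x := hxy
      rw [this]
      exact hx
    · change r⁻¹ • (fun i => (k i : ℝ)) = x
      rw [hky]
      exact hxy

/-- The volume asymptotics need a bounded measurable set with increasing dilates and null frontier.
Homogeneity and non-negativity give the monotone dilates; nullity of the level set gives the
frontier condition and makes both limits the same volume. -/
theorem tendsto_card_lattice {h : (Fin n → ℝ) → ℝ} (hc : Continuous h)
    (hhom : ∀ (t : ℝ) (x), 0 < t → h (t • x) = t * h x) (h0 : ∀ x, 0 ≤ h x)
    (hbdd : Bornology.IsBounded {x | h x ≤ 1}) :
    Filter.Tendsto (fun r : ℝ =>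
      (Nat.card {k : Fin n → ℤ | h (fun i => (k i : ℝ)) ≤ r} : ℝ) / r ^ n)
      Filter.atTop (nhds (volume.real {x | h x < 1})) ∧
    Filter.Tendsto (fun r : ℝ =>
      (Nat.card {k : Fin n → ℤ | h (fun i => (k i : ℝ)) < r} : ℝ) / r ^ n)
      Filter.atTop (nhds (volume.real {x | h x < 1})) := by
  have hnull := measure_level_set_eq_zero hc hhom
  have hstar : ∀ (Q : ℝ → Prop), (∀ a b : ℝ, 0 ≤ a → a ≤ b → Q b → Q a) →
      ∀ ⦃x y : ℝ⦄, 0 < x → x ≤ y → x • {z | Q (h z)} ⊆ y • {z | Q (h z)} := by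
    intro Q hQ x y hx hxy z hz
    have hy : 0 < y := hx.trans_le hxy
    rw [Set.mem_smul_set_iff_inv_smul_mem₀ hx.ne', Set.mem_ofPred_eq, hhom _ _ (inv_pos.2 hx)] at hz
    rw [Set.mem_smul_set_iff_inv_smul_mem₀ hy.ne', Set.mem_ofPred_eq, hhom _ _ (inv_pos.2 hy)]
    have := h0 z
    exact hQ _ _ (by positivity) (by gcongr) hz
  have hvol : volume.real {x | h x ≤ 1} = volume.real {x | h x < 1} := by
    refine measureReal_congr ?_
    have h1 : ∀ᵐ x, h x ≠ 1 := by
      rw [ae_iff]; simpa using hnull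
    filter_upwards [h1] with x hx
    exact propext ⟨fun hh => lt_of_le_of_ne hh hx, fun hh => le_of_lt hh⟩
  constructor
  · rw [← hvol]
    have h1 := tendsto_card_div_pow_atTop_volume' {x | h x ≤ 1} hbdd
      (measurableSet_le hc.measurable measurable_const)
      (measure_mono_null (frontier_le_subset_eq hc continuous_const) hnull)
      (hstar (· ≤ 1) fun a b _ hab hb => hab.trans hb)
    rw [Fintype.card_fin] at h1
    refine h1.congr' ((Filter.eventually_gt_atTop 0).mono fun r hr => ?_)
    beta_reduce
    rw [card_lattice_eq h hhom (Q := fun a b => a ≤ b) (fun r y hr => by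
      rw [inv_mul_le_iff₀ hr, mul_one]) hr]
  · have h1 := tendsto_card_div_pow_atTop_volume' {x | h x < 1}
      (hbdd.subset fun x hx => show h x ≤ 1 from le_of_lt hx)
      (measurableSet_lt hc.measurable measurable_const)
      (measure_mono_null (frontier_lt_subset_eq hc continuous_const) hnull)
      (hstar (· < 1) fun a b _ hab hb => hab.trans_lt hb)
    rw [Fintype.card_fin] at h1
    refine h1.congr' ((Filter.eventually_gt_atTop 0).mono fun r hr => ?_)
    beta_reduce
    rw [card_lattice_eq h hhom (Q := fun a b => a < b) (fun r y hr => by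
      rw [inv_mul_lt_iff₀ hr, mul_one]) hr]

/-- The volume of a star body in polar coordinates. -/
theorem volume_real_lt_one_eq_integral (hn : n ≠ 0) {h : E n → ℝ} (hc : Continuous h)
    (hhom : ∀ (t : ℝ) (x), 0 < t → h (t • x) = t * h x) (hpos : ∀ x, x ≠ 0 → 0 < h x) :
    volume.real {x | h x < 1} = (1 / (n : ℝ)) *
      ∫ η : Metric.sphere (0 : E n) 1, (h η ^ n)⁻¹ ∂(volume : Measure (E n)).toSphere := by
  have hsph : ∀ η : Metric.sphere (0 : E n) 1, 0 < h η := fun η =>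
    hpos _ (ne_zero_of_mem_unit_sphere η)
  have : Nontrivial (E n) := by
    have : Nonempty (Fin n) := Fin.pos_iff_nonempty.1 (Nat.pos_of_ne_zero hn)
    infer_instance
  have hmeas : MeasurableSet {x | h x < 1} := measurableSet_lt hc.measurable measurable_const
  set A : Set (Metric.sphere (0 : E n) 1 × Set.Ioi (0 : ℝ)) := {p | p.2 * h p.1 < 1} with hA
  have hAm : MeasurableSet A := by
    refine measurableSet_lt ?_ measurable_const
    exact (by fun_prop : Continuous fun p : Metric.sphere (0 : E n) 1 × Set.Ioi (0 : ℝ) =>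
      (p.2 : ℝ) * h p.1).measurable
  have h1 : volume {x | h x < 1} =
      ((volume : Measure (E n)).toSphere.prod (Measure.volumeIoiPow (n - 1))) A := by
    have hmp := (volume : Measure (E n)).measurePreserving_homeomorphUnitSphereProd
    rw [finrank_euclideanSpace_fin] at hmp
    rw [← hmp.measure_preimage hAm.nullMeasurableSet, comap_subtype_coe_apply
      (measurableSet_singleton _).compl]
    have h2 : (Subtype.val '' (homeomorphUnitSphereProd (E n) ⁻¹' A)) = {x | h x < 1} \ {0} := by
      ext x
      constructor
      · rintro ⟨⟨y, hy⟩, hyA, rfl⟩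
        refine ⟨?_, hy⟩
        rw [Set.mem_preimage, hA, Set.mem_ofPred_eq] at hyA
        simp only [homeomorphUnitSphereProd_apply_fst_coe,
          homeomorphUnitSphereProd_apply_snd_coe] at hyA
        rw [← hhom _ _ (norm_pos_iff.2 hy), smul_inv_smul₀ (norm_ne_zero_iff.2 hy)] at hyA
        exact hyA
      · rintro ⟨hx, hx0⟩
        refine ⟨⟨x, hx0⟩, ?_, rfl⟩
        rw [Set.mem_preimage, hA, Set.mem_ofPred_eq]
        simp only [homeomorphUnitSphereProd_apply_fst_coe,
          homeomorphUnitSphereProd_apply_snd_coe]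
        rw [← hhom _ _ (norm_pos_iff.2 hx0), smul_inv_smul₀ (norm_ne_zero_iff.2 hx0)]
        exact hx
    -- Polar coordinates omit only the origin, a null set because `n ≠ 0`.
    rw [h2, measure_sdiff_null (measure_singleton _)]
  -- In the direction `η` the body is the segment of radii below 1 / h(η), and integrating r^{n-1}
  -- over it gives 1 / (n h(η)ⁿ).
  have h3 : ∀ η : Metric.sphere (0 : E n) 1, Measure.volumeIoiPow (n - 1) (Prod.mk η ⁻¹' A) =
      ENNReal.ofReal ((1 / (n : ℝ)) * (h η ^ n)⁻¹) := by
    intro η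
    have h4 : Prod.mk η ⁻¹' A = Set.Iio ⟨(h η)⁻¹, inv_pos.2 (hsph η)⟩ := by
      ext r
      rw [Set.mem_preimage, hA, Set.mem_ofPred_eq, Set.mem_Iio, ← Subtype.coe_lt_coe,
        ← lt_div_iff₀ (hsph η), one_div]
    rw [h4, Measure.volumeIoiPow_apply_Iio, Nat.sub_add_cancel (Nat.pos_of_ne_zero hn),
      Nat.cast_pred (Nat.pos_of_ne_zero hn), sub_add_cancel, inv_pow, div_eq_inv_mul, one_div]
  rw [← integral_const_mul, integral_eq_lintegral_of_nonneg_ae, Measure.real, h1,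
    Measure.prod_apply hAm]
  · simp_rw [h3]
  · exact Filter.Eventually.of_forall fun η => by
      have := hsph η
      change 0 ≤ 1 / (n : ℝ) * (h η ^ n)⁻¹
      positivity
  · refine Continuous.aestronglyMeasurable ?_
    refine continuous_const.mul (Continuous.inv₀ (by fun_prop) fun η => ?_)
    exact (pow_pos (hsph η) n).ne'

theorem norm_coord_le (x : E n) (i : Fin n) : |x i| ≤ ‖x‖ := by
  have := PiLp.norm_apply_le x i
  rwa [Real.norm_eq_abs] at this

theorem finite_latticePoint_norm_le (R : ℝ) :
    {k : Fin n → ℤ | ‖latticePoint k‖ ≤ R}.Finite := by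
  refine (Set.finite_Icc (fun _ : Fin n => -⌈R⌉) (fun _ => ⌈R⌉)).subset fun k hk => ?_
  have h1 : ∀ i, |k i| ≤ ⌈R⌉ := fun i => by
    have h2 : |(k i : ℝ)| ≤ R := (norm_coord_le (latticePoint k) i).trans hk
    have h3 := h2.trans (Int.le_ceil R)
    exact_mod_cast h3
  exact Set.mem_Icc.2 ⟨fun i => (abs_le.1 (h1 i)).1, fun i => (abs_le.1 (h1 i)).2⟩

theorem latticePoint_eq_zero_iff (k : Fin n → ℤ) : latticePoint k = 0 ↔ k = 0 := by
  constructor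
  · intro h
    funext i
    have : (latticePoint k) i = (0 : E n) i := by rw [h]
    have h2 : (k i : ℝ) = 0 := this
    exact_mod_cast h2
  · rintro rfl
    ext i
    simp [latticePoint]

/-- Lattice point asymptotics for a positive function on `ℝⁿ \ 0` that is homogeneous of degree
`-n`: in the decreasing order, its values on `ℤⁿ` are equivalent to `c / j`, where `n c` is the
integral over the sphere. -/
theorem exists_enumeration_tendsto (hn : n ≠ 0) {G : E n → ℝ} (hGc : ContinuousOn G {0}ᶜ)
    (hGhom : ∀ (t : ℝ) (x : E n), 0 < t → x ≠ 0 → G (t • x) = (t ^ n)⁻¹ * G x)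
    (hGpos : ∀ x, x ≠ 0 → 0 < G x) :
    ∃ σ : ℕ ≃ (Fin n → ℤ), Filter.Tendsto (fun j : ℕ => ((j : ℝ) + 1) * G (latticePoint (σ j)))
      Filter.atTop (nhds ((1 / (n : ℝ)) *
        ∫ η : Metric.sphere (0 : E n) 1, G η ∂(volume : Measure (E n)).toSphere)) := by
  classical
  have : Nonempty (Fin n) := Fin.pos_iff_nonempty.1 (Nat.pos_of_ne_zero hn)
  have hn' : (n : ℝ) ≠ 0 := Nat.cast_ne_zero.2 hn
  -- G^{-1/n} is homogeneous of degree 1 and reverses the order of `G`. The value 0 at the origin is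
  -- the one that makes `h` continuous there.
  set h : E n → ℝ := fun x => if x = 0 then 0 else G x ^ (-(1 / (n : ℝ))) with hh
  have h_ne : ∀ x, x ≠ 0 → h x = G x ^ (-(1 / (n : ℝ))) := fun x hx => if_neg hx
  have h_zero : h 0 = 0 := if_pos rfl
  have hpos : ∀ x, x ≠ 0 → 0 < h x := fun x hx => by
    rw [h_ne x hx]; exact Real.rpow_pos_of_pos (hGpos x hx) _
  have hnonneg : ∀ x, 0 ≤ h x := fun x => by
    by_cases hx : x = 0
    · rw [hx, h_zero]
    · exact (hpos x hx).le
  have hpow : ∀ x, x ≠ 0 → (h x ^ n)⁻¹ = G x := fun x hx => by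
    rw [h_ne x hx, Real.rpow_neg (hGpos x hx).le, inv_pow, inv_inv, ← Real.rpow_natCast,
      ← Real.rpow_mul (hGpos x hx).le, one_div, inv_mul_cancel₀ hn', Real.rpow_one]
  have hhom : ∀ (t : ℝ) (x : E n), 0 < t → h (t • x) = t * h x := by
    intro t x ht
    by_cases hx : x = 0
    · rw [hx, smul_zero, h_zero, mul_zero]
    · have htx : t • x ≠ 0 := smul_ne_zero ht.ne' hx
      refine (pow_left_inj₀ (hnonneg _) (mul_nonneg ht.le (hnonneg _)) hn).1 (inv_injective ?_)
      rw [hpow _ htx, hGhom t x ht hx, mul_pow, mul_inv, hpow x hx]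
  have hcont0 : ContinuousOn h {0}ᶜ := by
    refine ContinuousOn.congr (f := fun x => G x ^ (-(1 / (n : ℝ)))) ?_ fun x hx => h_ne x hx
    exact hGc.rpow_const fun x hx => Or.inl (hGpos x hx).ne'
  have hsub : Metric.sphere (0 : E n) 1 ⊆ {0}ᶜ := fun x hx =>
    ne_zero_of_mem_unit_sphere ⟨x, hx⟩
  have hne : (Metric.sphere (0 : E n) 1).Nonempty := NormedSpace.sphere_nonempty.2 zero_le_one
  obtain ⟨x₁, hx₁, hmin⟩ := (isCompact_sphere (0 : E n) 1).exists_isMinOn hne (hcont0.mono hsub)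
  obtain ⟨x₂, hx₂, hmax⟩ := (isCompact_sphere (0 : E n) 1).exists_isMaxOn hne (hcont0.mono hsub)
  have ha : 0 < h x₁ := hpos _ (hsub hx₁)
  have hdec : ∀ x : E n, x ≠ 0 → h x = ‖x‖ * h (‖x‖⁻¹ • x) ∧
      ‖x‖⁻¹ • x ∈ Metric.sphere (0 : E n) 1 := fun x hx => by
    refine ⟨?_, ?_⟩
    · rw [← hhom _ _ (norm_pos_iff.2 hx), smul_inv_smul₀ (norm_ne_zero_iff.2 hx)]
    · rw [mem_sphere_zero_iff_norm, norm_smul, norm_inv, norm_norm,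
        inv_mul_cancel₀ (norm_ne_zero_iff.2 hx)]
  -- The extreme values on the sphere compare `h` with the norm: this lower bound makes the sublevel
  -- sets bounded, and the upper bound below gives continuity at the origin.
  have hlow : ∀ x, ‖x‖ * h x₁ ≤ h x := fun x => by
    by_cases hx : x = 0
    · rw [hx, h_zero, norm_zero, zero_mul]
    · rw [(hdec x hx).1]
      exact mul_le_mul_of_nonneg_left (hmin (hdec x hx).2) (norm_nonneg _)
  have hup : ∀ x, h x ≤ ‖x‖ * h x₂ := fun x => by
    by_cases hx : x = 0
    · rw [hx, h_zero, norm_zero, zero_mul]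
    · rw [(hdec x hx).1]
      exact mul_le_mul_of_nonneg_left (hmax (hdec x hx).2) (norm_nonneg _)
  have hcont : Continuous h := by
    rw [continuous_iff_continuousAt]
    intro x
    by_cases hx : x = 0
    · rw [hx, ContinuousAt, h_zero]
      refine squeeze_zero hnonneg hup ?_
      have : Filter.Tendsto (fun x : E n => ‖x‖ * h x₂) (nhds 0) (nhds (‖(0 : E n)‖ * h x₂)) :=
        (continuous_norm.mul continuous_const).tendsto 0
      simpa using this
    · exact hcont0.continuousAt (isOpen_compl_singleton.mem_nhds hx)
  set h' : (Fin n → ℝ) → ℝ := fun x => h (WithLp.toLp 2 x) with hh'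
  have htoLp : Continuous fun x : Fin n → ℝ => (WithLp.toLp 2 x : E n) :=
    PiLp.continuous_toLp 2 _
  have hbdd : Bornology.IsBounded {x | h' x ≤ 1} := by
    refine (Metric.isBounded_closedBall (x := (0 : Fin n → ℝ)) (r := (h x₁)⁻¹)).subset
      fun x hx => ?_
    rw [mem_closedBall_zero_iff, pi_norm_le_iff_of_nonneg (inv_pos.2 ha).le]
    intro i
    have h1 : ‖(WithLp.toLp 2 x : E n)‖ * h x₁ ≤ 1 := (hlow _).trans hx
    rw [Real.norm_eq_abs, ← one_div, le_div_iff₀ ha]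
    refine le_trans ?_ h1
    gcongr
    exact norm_coord_le (WithLp.toLp 2 x : E n) i
  obtain ⟨hle, hlt⟩ := tendsto_card_lattice (h := h') (hcont.comp htoLp)
    (fun t x ht => hhom t (WithLp.toLp 2 x) ht) (fun x => hnonneg _) hbdd
  have hvol : volume.real {x | h' x < 1} = volume.real {x | h x < 1} := by
    rw [Measure.real, Measure.real]
    congr 1
    exact (PiLp.volume_preserving_toLp (Fin n)).measure_preimage
      (measurableSet_lt hcont.measurable measurable_const).nullMeasurableSet
  have hfin : ∀ r, {k : Fin n → ℤ | h (latticePoint k) ≤ r}.Finite := fun r => by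
    refine (finite_latticePoint_norm_le (r / h x₁)).subset fun k hk => ?_
    rw [Set.mem_ofPred_eq, le_div_iff₀ ha]
    exact (hlow _).trans hk
  rw [hvol, volume_real_lt_one_eq_integral hn hcont hhom hpos] at hle hlt
  obtain ⟨σ, hσ⟩ := exists_equiv_nat_monotone (fun k : Fin n → ℤ => h (latticePoint k)) hfin
  refine ⟨σ, ?_⟩
  have h1 := tendsto_succ_div_pow_of_card _ σ hσ hfin hle hlt hn
  have h2 : ∫ η : Metric.sphere (0 : E n) 1, (h η ^ n)⁻¹ ∂(volume : Measure (E n)).toSphere =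
      ∫ η : Metric.sphere (0 : E n) 1, G η ∂(volume : Measure (E n)).toSphere :=
    integral_congr_ae (Filter.Eventually.of_forall fun η =>
      hpow _ (ne_zero_of_mem_unit_sphere η))
  rw [h2] at h1
  refine h1.congr' ?_
  -- At the lattice point 0 the value of `G` is arbitrary and unrelated to `h`, but only one index
  -- is affected.
  have h3 : ∀ᶠ j : ℕ in Filter.atTop, σ j ≠ 0 := by
    rw [← Nat.cofinite_eq_atTop]
    exact σ.injective.tendsto_cofinite.eventually
      (Set.finite_singleton (0 : Fin n → ℤ)).compl_mem_cofinite
  refine h3.mono fun j hj => ?_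
  beta_reduce
  rw [← hpow _ (mt (latticePoint_eq_zero_iff _).1 hj), div_eq_mul_inv]

end LatticePoints

end NCTorus

/-! ### Linearity of the NC integral -/

section NCIntegral

variable {ι H : Type*} [NormedAddCommGroup H] [InnerProductSpace ℂ H] [CompleteSpace H]

theorem HasNCIntegral.add {S T : H →L[ℂ] H} {L M : ℂ} (hS : HasNCIntegral S L)
    (hT : HasNCIntegral T M) : HasNCIntegral (S + T) (L + M) := by
  obtain ⟨hS, h1⟩ := hS
  obtain ⟨hT, h2⟩ := hT
  refine ⟨Submodule.add_mem _ hS hT, fun φ hφ => ?_⟩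
  rw [← h1 φ hφ, ← h2 φ hφ, ← map_add]
  rfl

theorem HasNCIntegral.smul {T : H →L[ℂ] H} {L : ℂ} (hT : HasNCIntegral T L) (c : ℂ) :
    HasNCIntegral (c • T) (c * L) := by
  obtain ⟨hT, h1⟩ := hT
  refine ⟨Submodule.smul_mem _ c hT, fun φ hφ => ?_⟩
  rw [← h1 φ hφ, ← smul_eq_mul, ← map_smul]
  rfl

/-- `f` is bounded and the diagonal operator with entries `f` is strongly measurable with NC
integral `c`. -/
def HasDiagIntegral (b : HilbertBasis ι ℂ H) (f : ι → ℂ) (c : ℂ) : Prop :=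
  (∃ C : ℝ, ∀ i, ‖f i‖ ≤ C) ∧ HasNCIntegral (diagOp b f) c

variable {b : HilbertBasis ι ℂ H} {f g : ι → ℂ} {c d : ℂ}

theorem HasDiagIntegral.add (hf : HasDiagIntegral b f c) (hg : HasDiagIntegral b g d) :
    HasDiagIntegral b (fun i => f i + g i) (c + d) := by
  obtain ⟨⟨C, hC⟩, hf⟩ := hf
  obtain ⟨⟨D, hD⟩, hg⟩ := hg
  refine ⟨⟨C + D, fun i => norm_add_le_of_le (hC i) (hD i)⟩, ?_⟩
  rw [← diagOp_add hC hD]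
  exact hf.add hg

theorem HasDiagIntegral.const_mul (hf : HasDiagIntegral b f c) (a : ℂ) :
    HasDiagIntegral b (fun i => a * f i) (a * c) := by
  obtain ⟨⟨C, hC⟩, hf⟩ := hf
  refine ⟨⟨‖a‖ * C, fun i => ?_⟩, ?_⟩
  · rw [norm_mul]
    exact mul_le_mul_of_nonneg_left (hC i) (norm_nonneg _)
  rw [← diagOp_smul hC]
  exact hf.smul a

theorem hasDiagIntegral_of_tendsto (b : HilbertBasis ι ℂ H) (σ : ℕ ≃ ι) {f : ι → ℂ} {c : ℂ}
    (h : Filter.Tendsto (fun j : ℕ => ((j : ℂ) + 1) * f (σ j)) Filter.atTop (nhds c)) :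
    HasDiagIntegral b f c := by
  obtain ⟨B, hB⟩ := exists_bound_of_tendsto_mul h
  exact ⟨⟨B, fun i => by simpa using (hB (σ.symm i)).2⟩, hasNCIntegral_diagOp b σ h⟩

end NCIntegral

/-! ### Diagonal operators with asymptotically homogeneous entries of degree −n -/

namespace NCTorus

variable {n : ℕ} {H : Type*} [NormedAddCommGroup H] [InnerProductSpace ℂ H] [CompleteSpace H]

theorem hasDiagIntegral_of_pos (hn : n ≠ 0) (b : HilbertBasis (Fin n → ℤ) ℂ H) {G : E n → ℝ}
    (hGc : ContinuousOn G {0}ᶜ)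
    (hGhom : ∀ (t : ℝ) (x : E n), 0 < t → x ≠ 0 → G (t • x) = (t ^ n)⁻¹ * G x)
    (hGpos : ∀ x, x ≠ 0 → 0 < G x) :
    HasDiagIntegral b (fun k => (G (latticePoint k) : ℂ)) ((1 / (n : ℂ)) *
      ∫ η : Metric.sphere (0 : E n) 1, (G η : ℂ) ∂(volume : Measure (E n)).toSphere) := by
  obtain ⟨σ, hσ⟩ := exists_enumeration_tendsto hn hGc hGhom hGpos
  refine hasDiagIntegral_of_tendsto b σ ?_
  have h1 := (Complex.continuous_ofReal.tendsto _).comp hσ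
  rw [integral_complex_ofReal]
  push_cast at h1
  refine h1.congr fun j => ?_
  simp

theorem continuousOn_inv_norm_pow : ContinuousOn (fun x : E n => (‖x‖ ^ n)⁻¹) {0}ᶜ := by
  refine ContinuousOn.inv₀ (by fun_prop) fun x hx => ?_
  exact pow_ne_zero n (norm_ne_zero_iff.2 hx)

theorem inv_norm_pow_smul (t : ℝ) (x : E n) (ht : 0 < t) (_ : x ≠ 0) :
    (‖t • x‖ ^ n)⁻¹ = (t ^ n)⁻¹ * (‖x‖ ^ n)⁻¹ := by
  rw [norm_smul, Real.norm_of_nonneg ht.le, mul_pow, mul_inv]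

theorem inv_norm_pow_pos (x : E n) (hx : x ≠ 0) : 0 < (‖x‖ ^ n)⁻¹ :=
  inv_pos.2 (pow_pos (norm_pos_iff.2 hx) n)

theorem sphere_subset_compl_zero : Metric.sphere (0 : E n) 1 ⊆ {0}ᶜ := fun x hx =>
  ne_zero_of_mem_unit_sphere ⟨x, hx⟩

theorem integrable_sphere {F : Type*} [NormedAddCommGroup F] {f : E n → F}
    (hf : ContinuousOn f {0}ᶜ) :
    Integrable (fun η : Metric.sphere (0 : E n) 1 => f η)
      (volume : Measure (E n)).toSphere := by
  have : Continuous fun η : Metric.sphere (0 : E n) 1 => f η :=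
    (hf.mono sphere_subset_compl_zero).domRestrict
  exact this.integrable_of_hasCompactSupport (HasCompactSupport.of_compactSpace _)

/-- A multiple of |x|⁻ⁿ exceeding the maximum of |G| on the sphere makes `G` positive, and its
contribution is subtracted afterwards. The two positive functions use unrelated enumerations of ℤⁿ,
which is harmless because the NC integral is linear. -/
theorem hasDiagIntegral_of_real (hn : n ≠ 0) (b : HilbertBasis (Fin n → ℤ) ℂ H) {G : E n → ℝ}
    (hGc : ContinuousOn G {0}ᶜ)
    (hGhom : ∀ (t : ℝ) (x : E n), 0 < t → x ≠ 0 → G (t • x) = (t ^ n)⁻¹ * G x) :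
    HasDiagIntegral b (fun k => (G (latticePoint k) : ℂ)) ((1 / (n : ℂ)) *
      ∫ η : Metric.sphere (0 : E n) 1, (G η : ℂ) ∂(volume : Measure (E n)).toSphere) := by
  obtain ⟨M, hM⟩ := (isCompact_sphere (0 : E n) 1).exists_bound_of_continuousOn
    (hGc.mono sphere_subset_compl_zero)
  have h0 := hasDiagIntegral_of_pos hn b continuousOn_inv_norm_pow inv_norm_pow_smul
    inv_norm_pow_pos
  have h1 := hasDiagIntegral_of_pos hn b (G := fun x => G x + (|M| + 1) * (‖x‖ ^ n)⁻¹)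
    (hGc.add (continuousOn_const.mul continuousOn_inv_norm_pow))
    (fun t x ht hx => by
      beta_reduce
      rw [hGhom t x ht hx, inv_norm_pow_smul t x ht hx]; ring)
    (fun x hx => by
      have hx' : 0 < ‖x‖ := norm_pos_iff.2 hx
      have h2 : ‖x‖⁻¹ • x ∈ Metric.sphere (0 : E n) 1 := by
        rw [mem_sphere_zero_iff_norm, norm_smul, norm_inv, norm_norm, inv_mul_cancel₀ hx'.ne']
      have h3 : G x = (‖x‖ ^ n)⁻¹ * G (‖x‖⁻¹ • x) := by
        rw [← hGhom _ _ hx' (sphere_subset_compl_zero h2), smul_inv_smul₀ hx'.ne']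
      have h4 := abs_le.1 (hM _ h2)
      have h5 : 0 < G (‖x‖⁻¹ • x) + (|M| + 1) := by linarith [le_abs_self M, h4.1]
      have h6 := mul_pos (inv_norm_pow_pos x hx) h5
      rw [h3]
      linarith)
  have h2 := h1.add (h0.const_mul (-(|M| + 1 : ℝ)))
  have hI : ∫ η : Metric.sphere (0 : E n) 1, (((G η + (|M| + 1) * (‖(η : E n)‖ ^ n)⁻¹ : ℝ)) : ℂ)
      ∂(volume : Measure (E n)).toSphere =
      (∫ η : Metric.sphere (0 : E n) 1, (G η : ℂ) ∂(volume : Measure (E n)).toSphere) +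
      (|M| + 1 : ℝ) * ∫ η : Metric.sphere (0 : E n) 1, (((‖(η : E n)‖ ^ n)⁻¹ : ℝ) : ℂ)
        ∂(volume : Measure (E n)).toSphere := by
    rw [← integral_const_mul, ← integral_add]
    · refine integral_congr_ae (Filter.Eventually.of_forall fun η => ?_)
      push_cast
      rfl
    · exact (integrable_sphere hGc).ofReal
    · exact (integrable_sphere continuousOn_inv_norm_pow).ofReal.const_mul _
  rw [hI] at h2
  convert h2 using 1
  · funext k
    push_cast
    ring
  · ring

/-- The NC integral of a diagonal operator on `ℤⁿ` whose entries are asymptotic to a homogeneous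
function of degree `-n`. -/
theorem hasDiagIntegral_of_asymptotic (hn : n ≠ 0) (b : HilbertBasis (Fin n → ℤ) ℂ H)
    {F : E n → ℂ} (hFc : ContinuousOn F {0}ᶜ)
    (hFhom : ∀ (t : ℝ) (x : E n), 0 < t → x ≠ 0 → F (t • x) = ((t ^ n)⁻¹ : ℝ) * F x)
    {f : (Fin n → ℤ) → ℂ} (hf : Filter.Tendsto
      (fun k => ((‖latticePoint k‖ ^ n : ℝ) : ℂ) * (f k - F (latticePoint k)))
      Filter.cofinite (nhds 0)) :
    HasDiagIntegral b f ((1 / (n : ℂ)) *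
      ∫ η : Metric.sphere (0 : E n) 1, F η ∂(volume : Measure (E n)).toSphere) := by
  have hre := hasDiagIntegral_of_real hn b (G := fun x => (F x).re)
    (Complex.continuous_re.comp_continuousOn hFc) fun t x ht hx => by
      beta_reduce
      rw [hFhom t x ht hx, Complex.re_ofReal_mul]
  have him := hasDiagIntegral_of_real hn b (G := fun x => (F x).im)
    (Complex.continuous_im.comp_continuousOn hFc) fun t x ht hx => by
      beta_reduce
      rw [hFhom t x ht hx, Complex.im_ofReal_mul]
  -- In the ordering by the norm, (j + 1)|k_j|⁻ⁿ converges while |k|ⁿ times the error tends to 0, so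
  -- the product required by `hasDiagIntegral_of_tendsto` tends to 0.
  have herr : HasDiagIntegral b (fun k => f k - F (latticePoint k)) 0 := by
    obtain ⟨σ, hσ⟩ := exists_enumeration_tendsto hn continuousOn_inv_norm_pow inv_norm_pow_smul
      inv_norm_pow_pos (n := n)
    refine hasDiagIntegral_of_tendsto b σ ?_
    have hσ' : Filter.Tendsto σ Filter.atTop Filter.cofinite := by
      rw [← Nat.cofinite_eq_atTop]; exact σ.injective.tendsto_cofinite
    have h1 := ((Complex.continuous_ofReal.tendsto _).comp hσ).mul (hf.comp hσ')
    rw [mul_zero] at h1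
    refine h1.congr' ?_
    have h3 : ∀ᶠ j : ℕ in Filter.atTop, σ j ≠ 0 :=
      hσ'.eventually (Set.finite_singleton (0 : Fin n → ℤ)).compl_mem_cofinite
    refine h3.mono fun j hj => ?_
    have h4 : ((‖latticePoint (σ j)‖ : ℝ) : ℂ) ^ n ≠ 0 := by
      refine pow_ne_zero n (Complex.ofReal_ne_zero.2 (norm_ne_zero_iff.2 ?_))
      exact mt (latticePoint_eq_zero_iff _).1 hj
    simp only [Function.comp_apply]
    push_cast
    field_simp
  have h := (hre.add (him.const_mul Complex.I)).add herr
  convert h using 1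
  · funext k
    have := Complex.re_add_im (F (latticePoint k))
    linear_combination -this
  · have hI := integral_re_add_im (𝕜 := ℂ) (integrable_sphere hFc)
    have hI' : ∫ η : Metric.sphere (0 : E n) 1, F η ∂(volume : Measure (E n)).toSphere =
        (∫ η : Metric.sphere (0 : E n) 1, ((F η).re : ℂ) ∂(volume : Measure (E n)).toSphere) +
        (∫ η : Metric.sphere (0 : E n) 1, ((F η).im : ℂ) ∂(volume : Measure (E n)).toSphere) *
          Complex.I := by
      rw [integral_complex_ofReal, integral_complex_ofReal]
      exact hI.symm
    rw [hI']
    ring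

end NCTorus

namespace NCTorus

variable {n : ℕ}

/-! ### Weyl operators -/

section Weyl

theorem toTorus_add (x y : Fin n → ℝ) : toTorus (x + y) = toTorus x + toTorus y := by
  funext i
  simp only [toTorus, Pi.add_apply, add_div]
  exact AddCircle.coe_add 1 _ _

theorem toTorus_zero : toTorus (0 : Fin n → ℝ) = 0 := by
  funext i
  simp [toTorus]

theorem mFourier_apply_add (k : Fin n → ℤ) (x y : UnitAddTorus (Fin n)) :
    UnitAddTorus.mFourier k (x + y) = UnitAddTorus.mFourier k x * UnitAddTorus.mFourier k y := by
  simp only [UnitAddTorus.mFourier, ContinuousMap.coe_mk, ← Finset.prod_mul_distrib]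
  refine Finset.prod_congr rfl fun i _ => ?_
  simp [fourier_apply, smul_add, AddCircle.toCircle_add]

theorem norm_mFourier_apply (k : Fin n → ℤ) (y : UnitAddTorus (Fin n)) :
    ‖UnitAddTorus.mFourier k y‖ = 1 := by
  simp only [UnitAddTorus.mFourier, fourier_apply, ContinuousMap.coe_mk, norm_prod,
    Circle.norm_coe, Finset.prod_const_one]

theorem mFourier_mul (k l : Fin n → ℤ) :
    UnitAddTorus.mFourier k * UnitAddTorus.mFourier l = UnitAddTorus.mFourier (k + l) := by
  ext y
  rw [ContinuousMap.mul_apply, ← UnitAddTorus.mFourier_add]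

/-- Translations and multiplications by characters commute up to a phase. -/
theorem transl_mul_mulOp (v : UnitAddTorus (Fin n)) (k : Fin n → ℤ) :
    transl v * mulOp (UnitAddTorus.mFourier k) =
      UnitAddTorus.mFourier k v • (mulOp (UnitAddTorus.mFourier k) * transl v) := by
  ext1 ξ
  refine Lp.ext ?_
  change transl v (mulOp _ ξ) =ᵐ[torusMeasure n]
    ((UnitAddTorus.mFourier k v • mulOp (UnitAddTorus.mFourier k) (transl v ξ) : L2T n) :
      UnitAddTorus (Fin n) → ℂ)
  filter_upwards [transl_coeFn v (mulOp (UnitAddTorus.mFourier k) ξ),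
    (measurePreserving_add_right (torusMeasure n) v).quasiMeasurePreserving.ae
      (mulOp_coeFn (UnitAddTorus.mFourier k) ξ),
    Lp.coeFn_smul (UnitAddTorus.mFourier k v) (mulOp (UnitAddTorus.mFourier k) (transl v ξ)),
    mulOp_coeFn (UnitAddTorus.mFourier k) (transl v ξ), transl_coeFn v ξ] with y h1 h2 h3 h4 h5
  rw [h1, h2, h3, Pi.smul_apply, h4, h5, mFourier_apply_add, smul_eq_mul]
  ring

theorem mulOp_mul (f g : C(UnitAddTorus (Fin n), ℂ)) : mulOp f * mulOp g = mulOp (f * g) :=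
  ContinuousLinearMap.ext fun ξ => mulOp_mulOp f g ξ

theorem transl_mul (v w : UnitAddTorus (Fin n)) : transl v * transl w = transl (v + w) :=
  ContinuousLinearMap.ext fun ξ => transl_transl v w ξ

theorem transl_zero_eq : transl (0 : UnitAddTorus (Fin n)) = 1 :=
  ContinuousLinearMap.ext fun ξ => transl_zero ξ

variable (θ : Matrix (Fin n) (Fin n) ℝ)

/-- The translation vector of the Weyl operator. -/
def weylShift (k : Fin n → ℤ) : UnitAddTorus (Fin n) :=
  toTorus fun i => ∑ j, Real.pi * θ i j * k j

theorem weylShift_add (k l : Fin n → ℤ) : weylShift θ (k + l) = weylShift θ k + weylShift θ l := by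
  rw [weylShift, weylShift, weylShift, ← toTorus_add]
  congr 1
  funext i
  rw [Pi.add_apply, ← Finset.sum_add_distrib]
  refine Finset.sum_congr rfl fun j _ => ?_
  rw [Pi.add_apply]
  push_cast
  ring

/-- The Weyl operator `(W_k ξ)(x) = e^{i k·x} ξ(x + π θ k)`. -/
def weylOp (k : Fin n → ℤ) : B n := mulOp (UnitAddTorus.mFourier k) * transl (weylShift θ k)

/-- Moving the inner translation past the inner multiplication costs a character value; shifts and
characters are then additive. -/
theorem weylOp_mul (k l : Fin n → ℤ) :
    weylOp θ k * weylOp θ l = UnitAddTorus.mFourier l (weylShift θ k) • weylOp θ (k + l) := by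
  rw [weylOp, weylOp, weylOp, mul_assoc, ← mul_assoc (transl (weylShift θ k)), transl_mul_mulOp,
    smul_mul_assoc, mul_smul_comm, mul_assoc, transl_mul, ← mul_assoc, mulOp_mul, mFourier_mul,
    weylShift_add]

theorem weylOp_zero : weylOp θ 0 = 1 := by
  have h1 : weylShift θ 0 = 0 := by
    rw [weylShift, ← toTorus_zero]
    congr 1
    funext i
    simp
  rw [weylOp, h1, transl_zero_eq, mul_one, UnitAddTorus.mFourier_zero]
  exact ContinuousLinearMap.ext fun ξ => mulOp_one ξ

/-- `V` is a multiple of the Weyl operator `W_k` by a phase. -/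
def IsWeyl (k : Fin n → ℤ) (V : B n) : Prop := ∃ c : ℂ, ‖c‖ = 1 ∧ V = c • weylOp θ k

variable {θ}

/-- Only the modulus of the phase is kept. Its value, which depends on `θ` and on the ordering of
the generators, never enters the argument. -/
theorem IsWeyl.mul {k l : Fin n → ℤ} {V W : B n} (hV : IsWeyl θ k V) (hW : IsWeyl θ l W) :
    IsWeyl θ (k + l) (V * W) := by
  obtain ⟨c, hc, rfl⟩ := hV
  obtain ⟨d, hd, rfl⟩ := hW
  refine ⟨c * d * UnitAddTorus.mFourier l (weylShift θ k), ?_, ?_⟩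
  · rw [norm_mul, norm_mul, hc, hd, norm_mFourier_apply]; norm_num
  · rw [smul_mul_assoc, mul_smul_comm, weylOp_mul, smul_smul, smul_smul]

theorem isWeyl_one : IsWeyl θ 0 1 := ⟨1, norm_one, by rw [weylOp_zero, one_smul]⟩

/-- A multiple of W_{-k} is a right inverse of `V`; since `star V` is a left inverse, the two
coincide. -/
theorem IsWeyl.star {k : Fin n → ℤ} {V : B n} (hV : IsWeyl θ k V) (hu : star V * V = 1) :
    IsWeyl θ (-k) (star V) := by
  obtain ⟨c, hc, rfl⟩ := hV
  have hc0 : c ≠ 0 := by rw [← norm_ne_zero_iff, hc]; exact one_ne_zero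
  set d := UnitAddTorus.mFourier (-k) (weylShift θ k) with hd
  have hd1 : ‖d‖ = 1 := norm_mFourier_apply _ _
  have hd0 : d ≠ 0 := by rw [← norm_ne_zero_iff, hd1]; exact one_ne_zero
  refine ⟨c⁻¹ * d⁻¹, by rw [norm_mul, norm_inv, norm_inv, hc, hd1]; norm_num, ?_⟩
  have h1 : (c • weylOp θ k) * ((c⁻¹ * d⁻¹) • weylOp θ (-k)) = 1 := by
    rw [smul_mul_assoc, mul_smul_comm, weylOp_mul, add_neg_cancel, weylOp_zero, ← hd, smul_smul,
      smul_smul]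
    rw [show c * (c⁻¹ * d⁻¹) * d = 1 by field_simp, one_smul]
  calc Star.star (c • weylOp θ k) = Star.star (c • weylOp θ k) *
      ((c • weylOp θ k) * ((c⁻¹ * d⁻¹) • weylOp θ (-k))) := by rw [h1, mul_one]
    _ = _ := by rw [← mul_assoc, hu, one_mul]

theorem isWeyl_gen (j : Fin n) : IsWeyl θ (Pi.single j 1) (gen θ j : B n) := by
  refine ⟨1, norm_one, ?_⟩
  rw [one_smul]
  change mulOp _ * transl _ = mulOp _ * transl _
  congr 2
  rw [weylShift]
  congr 1
  funext i
  rw [Finset.sum_eq_single j]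
  · simp
  · intro l _ hl
    simp [hl]
  · simp

theorem IsWeyl.unitary_inv {k : Fin n → ℤ} {V : unitary (B n)} (hV : IsWeyl θ k V) :
    IsWeyl θ (-k) ((V⁻¹ : unitary (B n)) : B n) := by
  rw [← Unitary.star_eq_inv, Unitary.coe_star]
  exact hV.star (Unitary.coe_star_mul_self V)

theorem IsWeyl.unitary_pow {k : Fin n → ℤ} {V : unitary (B n)} (hV : IsWeyl θ k V) (m : ℕ) :
    IsWeyl θ (m • k) ((V ^ m : unitary (B n)) : B n) := by
  induction m with
  | zero => simpa using isWeyl_one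
  | succ m ih =>
    rw [pow_succ, succ_nsmul]
    exact ih.mul hV

theorem IsWeyl.unitary_zpow {k : Fin n → ℤ} {V : unitary (B n)} (hV : IsWeyl θ k V) (m : ℤ) :
    IsWeyl θ (m • k) ((V ^ m : unitary (B n)) : B n) := by
  cases m with
  | ofNat m =>
    rw [Int.ofNat_eq_natCast, zpow_natCast, natCast_zsmul]
    exact hV.unitary_pow m
  | negSucc m =>
    rw [zpow_negSucc, negSucc_zsmul]
    exact (hV.unitary_pow (m + 1)).unitary_inv

theorem isWeyl_UOp (k : Fin n → ℤ) : IsWeyl θ k (UOp θ k : B n) := by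
  have hl : ∀ l : List (Fin n), IsWeyl θ ((l.map fun j => (Pi.single j (k j) : Fin n → ℤ)).sum)
      (((l.map fun j => gen θ j ^ k j).prod : unitary (B n)) : B n) := by
    intro l
    induction l with
    | nil => simpa using isWeyl_one
    | cons j l ih =>
      rw [List.map_cons, List.map_cons, List.sum_cons, List.prod_cons]
      refine IsWeyl.mul ?_ ih
      have := (isWeyl_gen (θ := θ) j).unitary_zpow (k j)
      rwa [← Pi.single_smul', smul_eq_mul, mul_one] at this
  have h := hl (List.finRange n)
  rw [← Fin.sum_univ_def, Finset.univ_sum_single] at h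
  exact h

theorem transl_oneL2 (v : UnitAddTorus (Fin n)) : transl v (oneL2 n) = oneL2 n := by
  refine Lp.ext ?_
  have h := Lp.coeFn_const (p := 2) (μ := torusMeasure n) (1 : ℂ)
  filter_upwards [transl_coeFn v (oneL2 n), h,
    (measurePreserving_add_right (torusMeasure n) v).quasiMeasurePreserving.ae h] with y h1 h2 h3
  rw [h1]
  exact h3.trans h2.symm

theorem mulOp_oneL2 (f : C(UnitAddTorus (Fin n), ℂ)) :
    mulOp f (oneL2 n) = ContinuousMap.toLp 2 (torusMeasure n) ℂ f := by
  refine Lp.ext ?_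
  filter_upwards [mulOp_coeFn f (oneL2 n), Lp.coeFn_const (p := 2) (μ := torusMeasure n) (1 : ℂ),
    ContinuousMap.coeFn_toLp (p := 2) (𝕜 := ℂ) (torusMeasure n) f] with y h1 h2 h3
  rw [h1, h3]
  have h4 : (oneL2 n : UnitAddTorus (Fin n) → ℂ) y = 1 := h2
  rw [h4, mul_one]

/-- The constant function is translation invariant, so Weyl operators carry it to the Fourier basis
of L²(𝕋ⁿ). Both the values τ(U^k) and the faithfulness of `τ` come from this. -/
theorem weylOp_oneL2 (k : Fin n → ℤ) :
    weylOp θ k (oneL2 n) = UnitAddTorus.mFourierLp 2 k := by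
  rw [weylOp, mul_apply_eq_comp, transl_oneL2, mulOp_oneL2]
  rfl

theorem oneL2_eq : oneL2 n = UnitAddTorus.mFourierLp 2 0 := by
  rw [← weylOp_oneL2 (θ := (0 : Matrix (Fin n) (Fin n) ℝ)), weylOp_zero, one_apply_eq_self]

theorem inner_oneL2_weylOp (k : Fin n → ℤ) :
    ⟪oneL2 n, weylOp θ k (oneL2 n)⟫_ℂ = if k = 0 then 1 else 0 := by
  rw [weylOp_oneL2, oneL2_eq]
  have h := orthonormal_iff_ite.1 (UnitAddTorus.orthonormal_mFourier (d := Fin n)) 0 k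
  refine Eq.trans h ?_
  simp only [eq_comm]

end Weyl

end NCTorus

namespace NCTorus

variable {n : ℕ}

/-! ### The trace and the Fourier basis of `𝓗_θ` -/

section Basis

variable (θ : Matrix (Fin n) (Fin n) ℝ)

theorem U_mem_unitary (k : Fin n → ℤ) : star (U θ k) * U θ k = 1 ∧ U θ k * star (U θ k) = 1 :=
  ⟨Subtype.ext (Unitary.coe_star_mul_self (UOp θ k)),
    Subtype.ext (Unitary.coe_mul_star_self (UOp θ k))⟩

theorem norm_U_le (k : Fin n → ℤ) : ‖U θ k‖ ≤ 1 := by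
  have h : ‖(UOp θ k : B n)‖ ≤ 1 := by
    refine ContinuousLinearMap.opNorm_le_bound _ zero_le_one fun ξ => ?_
    rw [one_mul]
    exact ((ContinuousLinearMap.norm_map_iff_adjoint_comp_self (UOp θ k : B n)).2
      (Unitary.coe_star_mul_self (UOp θ k)) ξ).le
  exact h

theorem exists_U_mul (k l : Fin n → ℤ) : ∃ c : ℂ, ‖c‖ = 1 ∧ U θ k * U θ l = c • U θ (k + l) := by
  obtain ⟨c, hc, h1⟩ := (isWeyl_UOp (θ := θ) k).mul (isWeyl_UOp l)
  obtain ⟨d, hd, h2⟩ := isWeyl_UOp (θ := θ) (k + l)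
  have hd0 : d ≠ 0 := by rw [← norm_ne_zero_iff, hd]; exact one_ne_zero
  refine ⟨c * d⁻¹, by rw [norm_mul, norm_inv, hc, hd]; norm_num, Subtype.ext ?_⟩
  change (UOp θ k : B n) * (UOp θ l : B n) = (c * d⁻¹) • (UOp θ (k + l) : B n)
  rw [h1, h2, smul_smul, inv_mul_cancel_right₀ hd0]

theorem U_zero : U θ 0 = 1 := by
  refine Subtype.ext ?_
  change ((UOp θ 0 : unitary (B n)) : B n) = 1
  have : UOp θ 0 = 1 := by simp [UOp]
  rw [this]
  rfl

theorem exists_star_U (k : Fin n → ℤ) : ∃ c : ℂ, ‖c‖ = 1 ∧ star (U θ k) = c • U θ (-k) := by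
  obtain ⟨c, hc, h⟩ := exists_U_mul θ k (-k)
  have hc0 : c ≠ 0 := by rw [← norm_ne_zero_iff, hc]; exact one_ne_zero
  rw [add_neg_cancel, U_zero] at h
  refine ⟨c⁻¹, by rw [norm_inv, hc, inv_one], ?_⟩
  have h1 : star (U θ k) * (U θ k * U θ (-k)) = U θ (-k) := by
    rw [← mul_assoc, (U_mem_unitary θ k).1, one_mul]
  rw [h, mul_smul_comm, mul_one] at h1
  rw [← h1, smul_smul, inv_mul_cancel₀ hc0, one_smul]

theorem tau_apply (a : alg θ) : tau θ a = ⟪oneL2 n, (a : B n) (oneL2 n)⟫_ℂ := rfl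

theorem tau_U (k : Fin n → ℤ) : tau θ (U θ k) = if k = 0 then 1 else 0 := by
  split_ifs with hk
  · rw [hk, U_zero, tau_apply]
    change ⟪oneL2 n, oneL2 n⟫_ℂ = 1
    have := inner_oneL2_weylOp (θ := θ) (0 : Fin n → ℤ)
    rwa [weylOp_zero, if_pos rfl] at this
  · obtain ⟨c, hc, h⟩ := isWeyl_UOp (θ := θ) k
    rw [tau_apply]
    change ⟪oneL2 n, (UOp θ k : B n) (oneL2 n)⟫_ℂ = 0
    rw [h, smul_apply, inner_smul_right, inner_oneL2_weylOp, if_neg hk, mul_zero]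

theorem norm_oneL2 : ‖oneL2 n‖ = 1 := by
  rw [oneL2_eq]
  exact (UnitAddTorus.orthonormal_mFourier (d := Fin n)).1 0

theorem norm_tau_le (a : alg θ) : ‖tau θ a‖ ≤ ‖a‖ := by
  rw [tau_apply]
  refine (norm_inner_le_norm _ _).trans ?_
  rw [norm_oneL2, one_mul]
  refine ((a : B n).le_opNorm _).trans ?_
  rw [norm_oneL2, mul_one]
  rfl

/-- `τ` as a continuous linear form. -/
def tauL : alg θ →L[ℂ] ℂ :=
  (tauLin θ).mkContinuous 1 fun a => by rw [one_mul]; exact norm_tau_le θ a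

theorem tauL_apply (a : alg θ) : tauL θ a = tau θ a := rfl

theorem span_UOp_mul {x y : B n} (hx : x ∈ Submodule.span ℂ (Set.range fun k => (UOp θ k : B n)))
    (hy : y ∈ Submodule.span ℂ (Set.range fun k => (UOp θ k : B n))) :
    x * y ∈ Submodule.span ℂ (Set.range fun k => (UOp θ k : B n)) := by
  have h := Submodule.mul_mem_mul hx hy
  rw [Submodule.span_mul_span] at h
  refine Submodule.span_le.2 ?_ h
  rintro _ ⟨_, ⟨k, rfl⟩, _, ⟨l, rfl⟩, rfl⟩
  obtain ⟨c, -, hc⟩ := exists_U_mul θ k l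
  have hc' : (UOp θ k : B n) * (UOp θ l : B n) = c • (UOp θ (k + l) : B n) :=
    congrArg Subtype.val hc
  change (UOp θ k : B n) * (UOp θ l : B n) ∈ _
  rw [hc']
  exact Submodule.smul_mem _ _ (Submodule.subset_span ⟨_, rfl⟩)

theorem span_UOp_star {x : B n} (hx : x ∈ Submodule.span ℂ (Set.range fun k => (UOp θ k : B n))) :
    star x ∈ Submodule.span ℂ (Set.range fun k => (UOp θ k : B n)) := by
  induction hx using Submodule.span_induction with
  | mem x hx =>
    obtain ⟨k, rfl⟩ := hx
    obtain ⟨c, -, hc⟩ := exists_star_U θ k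
    have hc' : star (UOp θ k : B n) = c • (UOp θ (-k) : B n) := congrArg Subtype.val hc
    rw [hc']
    exact Submodule.smul_mem _ _ (Submodule.subset_span ⟨_, rfl⟩)
  | zero => rw [star_zero]; exact Submodule.zero_mem _
  | add x y _ _ hx hy => rw [star_add]; exact Submodule.add_mem _ hx hy
  | smul c x _ hx => rw [star_smul]; exact Submodule.smul_mem _ _ hx

theorem adjoin_le_span {x : B n}
    (hx : x ∈ StarAlgebra.adjoin ℂ (Set.range fun j => (gen θ j : B n))) :
    x ∈ Submodule.span ℂ (Set.range fun k => (UOp θ k : B n)) := by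
  have h1 : (1 : B n) ∈ Submodule.span ℂ (Set.range fun k => (UOp θ k : B n)) :=
    Submodule.subset_span ⟨0, congrArg Subtype.val (U_zero θ)⟩
  induction hx using StarAlgebra.adjoin_induction with
  | mem x hx =>
    obtain ⟨j, rfl⟩ := hx
    obtain ⟨c, hc, h⟩ := isWeyl_gen (θ := θ) j
    obtain ⟨d, hd, h'⟩ := isWeyl_UOp (θ := θ) (Pi.single j 1)
    have hd0 : d ≠ 0 := by rw [← norm_ne_zero_iff, hd]; exact one_ne_zero
    have : (gen θ j : B n) = (c * d⁻¹) • (UOp θ (Pi.single j 1) : B n) := by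
      rw [h, h', smul_smul, inv_mul_cancel_right₀ hd0]
    beta_reduce
    rw [this]
    exact Submodule.smul_mem _ _ (Submodule.subset_span ⟨_, rfl⟩)
  | algebraMap r =>
    rw [Algebra.algebraMap_eq_smul_one]
    exact Submodule.smul_mem _ _ h1
  | add x y _ _ hx hy => exact Submodule.add_mem _ hx hy
  | mul x y _ _ hx hy => exact span_UOp_mul θ hx hy
  | star x _ hx => exact span_UOp_star θ hx

/-- Products and adjoints of the U^k are multiples of some U^l, so their span already contains the
`*`-algebra generated by the U_j. -/
theorem dense_span_U : Dense (Submodule.span ℂ (Set.range (U θ)) : Set (alg θ)) := by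
  intro a
  rw [closure_subtype]
  have h1 : (a : B n) ∈ closure
      (StarAlgebra.adjoin ℂ (Set.range fun j => (gen θ j : B n)) : Set (B n)) := by
    rw [← StarSubalgebra.topologicalClosure_coe]
    exact a.2
  refine closure_mono ?_ h1
  intro x hx
  have h2 := adjoin_le_span θ hx
  clear hx
  induction h2 using Submodule.span_induction with
  | mem x hx =>
    obtain ⟨k, rfl⟩ := hx
    exact ⟨U θ k, Submodule.subset_span ⟨k, rfl⟩, rfl⟩
  | zero => exact ⟨0, Submodule.zero_mem _, rfl⟩
  | add x y _ _ hx hy =>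
    obtain ⟨x, hx, rfl⟩ := hx
    obtain ⟨y, hy, rfl⟩ := hy
    exact ⟨x + y, Submodule.add_mem _ hx hy, rfl⟩
  | smul c x _ hx =>
    obtain ⟨x, hx, rfl⟩ := hx
    exact ⟨c • x, Submodule.smul_mem _ _ hx, rfl⟩

theorem alg_ext_of_U {F : Type*} [NormedAddCommGroup F] [NormedSpace ℂ F] {S T : alg θ →L[ℂ] F}
    (h : ∀ k, S (U θ k) = T (U θ k)) : S = T :=
  ContinuousLinearMap.ext_on (dense_span_U θ) (by rintro _ ⟨k, rfl⟩; exact h k)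

/-- If k + l ≠ 0, both traces vanish. If l = −k, then U^l is a multiple of the inverse of U^k and
the two commute. -/
theorem tau_U_mul_comm (k l : Fin n → ℤ) : tau θ (U θ k * U θ l) = tau θ (U θ l * U θ k) := by
  obtain ⟨c, hc, h⟩ := exists_U_mul θ k l
  obtain ⟨d, hd, h'⟩ := exists_U_mul θ l k
  by_cases hkl : k + l = 0
  · obtain rfl : l = -k := eq_neg_of_add_eq_zero_right hkl
    obtain ⟨z, -, hz⟩ := exists_star_U θ k
    have h1 := U_mem_unitary θ k
    rw [hz, smul_mul_assoc, mul_smul_comm] at h1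
    have hz0 : z ≠ 0 := by
      rintro rfl
      have h2 := congrArg (tau θ) h1.1
      rw [zero_smul, map_zero, ← U_zero, tau_U, if_pos rfl] at h2
      exact zero_ne_one h2
    rw [← inv_smul_smul₀ hz0 (U θ k * U θ (-k)), h1.2, ← h1.1, inv_smul_smul₀ hz0]
  · rw [h, h', map_smul, map_smul, tau_U, tau_U, add_comm l k, if_neg hkl, smul_zero, smul_zero]

/-- `τ` is a trace. -/
theorem tau_mul_comm (a b : alg θ) : tau θ (a * b) = tau θ (b * a) := by
  have h1 : ∀ k (b : alg θ), tau θ (U θ k * b) = tau θ (b * U θ k) := fun k b => by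
    have := alg_ext_of_U θ (S := tauL θ ∘L ContinuousLinearMap.mul ℂ (alg θ) (U θ k))
      (T := tauL θ ∘L (ContinuousLinearMap.mul ℂ (alg θ)).flip (U θ k))
      (fun l => tau_U_mul_comm θ k l)
    exact congrArg (fun S : alg θ →L[ℂ] ℂ => S b) this
  have := alg_ext_of_U θ (S := tauL θ ∘L (ContinuousLinearMap.mul ℂ (alg θ)).flip b)
    (T := tauL θ ∘L ContinuousLinearMap.mul ℂ (alg θ) b) (fun k => h1 k b)
  exact congrArg (fun S : alg θ →L[ℂ] ℂ => S a) this

theorem inner_toHilb (a b : alg θ) : ⟪toHilb θ a, toHilb θ b⟫_ℂ = tau θ (star a * b) := by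
  rw [toHilb, toHilb, UniformSpace.Completion.inner_coe, PositiveLinearMap.preGNS_inner_def]
  rfl

theorem leftRep_toHilb (a b : alg θ) : leftRep θ a (toHilb θ b) = toHilb θ (a * b) := by
  rw [leftRep, toHilb, toHilb]
  exact PositiveLinearMap.gnsNonUnitalStarAlgHom_apply_coe _

theorem norm_leftRep_le (a : alg θ) : ‖leftRep θ a‖ ≤ ‖a‖ :=
  NonUnitalStarAlgHom.norm_apply_le (leftRep θ) a

theorem toHilb_add (a b : alg θ) : toHilb θ (a + b) = toHilb θ a + toHilb θ b := by
  rw [toHilb, map_add, UniformSpace.Completion.coe_add]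
  rfl

theorem toHilb_smul (c : ℂ) (a : alg θ) : toHilb θ (c • a) = c • toHilb θ a := by
  rw [toHilb, map_smul, UniformSpace.Completion.coe_smul]
  rfl

theorem norm_toHilb_le (a : alg θ) : ‖toHilb θ a‖ ≤ ‖a‖ := by
  have h1 : ‖toHilb θ 1‖ ≤ 1 := by
    have h : ‖toHilb θ 1‖ ^ 2 = 1 := by
      rw [← inner_self_eq_norm_sq (𝕜 := ℂ), inner_toHilb, star_one, one_mul, ← U_zero, tau_U,
        if_pos rfl, RCLike.one_re]
    nlinarith [norm_nonneg (toHilb θ 1)]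
  have h2 := (leftRep θ a).le_opNorm (toHilb θ 1)
  rw [leftRep_toHilb, mul_one] at h2
  refine h2.trans ?_
  calc _ ≤ ‖a‖ * 1 := mul_le_mul (norm_leftRep_le θ a) h1 (norm_nonneg _) (norm_nonneg _)
    _ = ‖a‖ := mul_one _

/-- The canonical map `A_θ → 𝓗_θ` as a continuous linear map. -/
def toHilbL : alg θ →L[ℂ] Hilb θ :=
  LinearMap.mkContinuous { toFun := toHilb θ, map_add' := toHilb_add θ, map_smul' := toHilb_smul θ }
    1 fun a => by rw [one_mul]; exact norm_toHilb_le θ a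

theorem denseRange_toHilb : DenseRange (toHilb θ) :=
  UniformSpace.Completion.denseRange_coe.comp (tau θ).toPreGNS.surjective.denseRange
    (UniformSpace.Completion.continuous_coe _)

theorem orthonormal_toHilb_U : Orthonormal ℂ fun k => toHilb θ (U θ k) := by
  rw [orthonormal_iff_ite]
  intro k l
  rw [inner_toHilb]
  split_ifs with h
  · rw [h, (U_mem_unitary θ l).1, ← U_zero, tau_U, if_pos rfl]
  · obtain ⟨c, -, hc⟩ := exists_star_U θ k
    obtain ⟨d, -, hd⟩ := exists_U_mul θ (-k) l
    rw [hc, smul_mul_assoc, hd, map_smul, map_smul, tau_U, if_neg, smul_zero, smul_zero]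
    intro h'
    exact h (neg_add_eq_zero.1 h')

theorem dense_span_toHilb_U :
    ⊤ ≤ (Submodule.span ℂ (Set.range fun k => toHilb θ (U θ k))).topologicalClosure := by
  have h : Dense (toHilbL θ '' (Submodule.span ℂ (Set.range (U θ)) : Set (alg θ))) :=
    (denseRange_toHilb θ).dense_image (toHilbL θ).continuous (dense_span_U θ)
  have h2 : (toHilbL θ '' (Submodule.span ℂ (Set.range (U θ)) : Set (alg θ))) =
      (Submodule.span ℂ (Set.range fun k => toHilb θ (U θ k)) : Set (Hilb θ)) := by
    have h3 := Submodule.map_span (toHilbL θ : alg θ →ₗ[ℂ] Hilb θ) (Set.range (U θ))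
    rw [← Set.range_comp] at h3
    exact congrArg SetLike.coe h3
  rw [h2] at h
  exact (Submodule.dense_iff_topologicalClosure_eq_top.1 h).ge

/-- The orthonormal basis of the `U^k` in `𝓗_θ`. -/
def fourierBasis : HilbertBasis (Fin n → ℤ) ℂ (Hilb θ) :=
  HilbertBasis.mk (orthonormal_toHilb_U θ) (dense_span_toHilb_U θ)

theorem fourierBasis_apply (k : Fin n → ℤ) : fourierBasis θ k = toHilb θ (U θ k) :=
  congrFun (HilbertBasis.coe_mk _ _) k

/-- The Fourier coefficient `a_k = τ(a (U^k)*)`. -/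
def coeff (k : Fin n → ℤ) : alg θ →L[ℂ] ℂ :=
  tauL θ ∘L (ContinuousLinearMap.mul ℂ (alg θ)).flip (star (U θ k))

theorem coeff_apply (k : Fin n → ℤ) (a : alg θ) : coeff θ k a = tau θ (a * star (U θ k)) := rfl

/-- The GNS inner product produces τ((U^k)* a), whereas Fourier coefficients are τ(a (U^k)*);
traciality reconciles them. -/
theorem fourierBasis_repr_toHilb (a : alg θ) (k : Fin n → ℤ) :
    (fourierBasis θ).repr (toHilb θ a) k = coeff θ k a := by
  rw [HilbertBasis.repr_apply_apply, fourierBasis_apply, inner_toHilb, tau_mul_comm, coeff_apply]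

theorem hasSum_toHilb (a : alg θ) :
    HasSum (fun k => coeff θ k a • toHilb θ (U θ k)) (toHilb θ a) := by
  have h := (fourierBasis θ).hasSum_repr (toHilb θ a)
  simp only [fourierBasis_repr_toHilb, fourierBasis_apply] at h
  exact h

theorem coeff_U (k l : Fin n → ℤ) : coeff θ k (U θ l) = if k = l then 1 else 0 := by
  rw [coeff_apply, tau_mul_comm, ← inner_toHilb]
  exact orthonormal_iff_ite.1 (orthonormal_toHilb_U θ) k l

/-- `τ` is faithful. -/
theorem eq_zero_of_toHilb_eq_zero {a : alg θ} (ha : toHilb θ a = 0) : a = 0 := by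
  have h0 : tau θ (star a * a) = 0 := by rw [← inner_toHilb, ha, inner_zero_left]
  -- By traciality τ((aU^k)*(aU^k)) = τ(a*a) = 0, so `a` kills every U^k 1. Up to phases these
  -- vectors are the Fourier basis of L²(𝕋ⁿ).
  have h1 : ∀ k, (a : B n) ((UOp θ k : B n) (oneL2 n)) = 0 := by
    intro k
    have h2 : tau θ (star (a * U θ k) * (a * U θ k)) = 0 := by
      rw [star_mul, tau_mul_comm, mul_assoc a, ← mul_assoc (U θ k), (U_mem_unitary θ k).2, one_mul,
        tau_mul_comm, h0]
    have h3 : ⟪oneL2 n, (star ((a : B n) * (UOp θ k : B n)) * ((a : B n) * (UOp θ k : B n)))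
        (oneL2 n)⟫_ℂ = 0 := h2
    rw [mul_apply_eq_comp, ContinuousLinearMap.star_eq_adjoint,
      ContinuousLinearMap.adjoint_inner_right, inner_self_eq_zero] at h3
    exact h3
  refine Subtype.ext ?_
  have hdense := UnitAddTorus.span_mFourierLp_closure_eq_top (d := Fin n) (p := 2) (by simp)
  refine ContinuousLinearMap.ext_on (Submodule.dense_iff_topologicalClosure_eq_top.2 hdense) ?_
  rintro _ ⟨k, rfl⟩
  obtain ⟨c, hc, h⟩ := isWeyl_UOp (θ := θ) k
  have hc0 : c ≠ 0 := by rw [← norm_ne_zero_iff, hc]; exact one_ne_zero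
  have h2 := h1 k
  rw [h, smul_apply, map_smul, smul_eq_zero_iff_right hc0, weylOp_oneL2] at h2
  exact h2

theorem ext_coeff {a b : alg θ} (h : ∀ k, coeff θ k a = coeff θ k b) : a = b := by
  rw [← sub_eq_zero]
  refine eq_zero_of_toHilb_eq_zero θ ((fourierBasis θ).ext_repr fun k => ?_)
  rw [fourierBasis_repr_toHilb, map_sub, h, sub_self, map_zero]
  rfl

/-- An element with summable Fourier coefficients is the sum of its Fourier series. -/
theorem hasSum_U_of_summable {a : alg θ} (h : Summable fun k => ‖coeff θ k a‖) :
    HasSum (fun k => coeff θ k a • U θ k) a := by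
  have h1 : Summable fun k => coeff θ k a • U θ k :=
    Summable.of_norm_bounded h fun k => (norm_smul_le _ _).trans
      (mul_le_of_le_one_right (norm_nonneg _) (norm_U_le θ k))
  have h2 : ∑' k, coeff θ k a • U θ k = a := ext_coeff θ fun l => by
    rw [(coeff θ l).map_tsum h1, tsum_eq_single l]
    · rw [map_smul, coeff_U, if_pos rfl, smul_eq_mul, mul_one]
    · intro k hk
      rw [map_smul, coeff_U, if_neg hk.symm, smul_zero]
  exact (h1.hasSum_iff).2 h2

end Basis

end NCTorus

namespace NCTorus

variable {n : ℕ}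

/-! ### Derivations and the decay of Fourier coefficients -/

section Decay

/-- The linear form `s ↦ s·l`. -/
def dotL (l : Fin n → ℤ) : E n →L[ℝ] ℝ := ∑ j, (l j : ℝ) • EuclideanSpace.proj j

theorem dotL_apply (l : Fin n → ℤ) (s : E n) : dotL l s = ∑ j, (l j : ℝ) * s j := by
  rw [dotL, sum_apply]
  rfl

theorem norm_dotL_le (l : Fin n → ℤ) : ‖dotL l‖ ≤ n * ‖l‖ := by
  refine ContinuousLinearMap.opNorm_le_bound _ (by positivity) fun s => ?_
  rw [dotL_apply]
  refine (norm_sum_le _ _).trans ?_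
  have : ∀ j ∈ Finset.univ, ‖(l j : ℝ) * s j‖ ≤ ‖l‖ * ‖s‖ := fun j _ => by
    rw [norm_mul]
    refine mul_le_mul ?_ (PiLp.norm_apply_le s j) (norm_nonneg _) (norm_nonneg _)
    rw [Int.norm_cast_real]
    exact norm_le_pi_norm l j
  refine (Finset.sum_le_card_nsmul _ _ _ this).trans (le_of_eq ?_)
  rw [Finset.card_univ, Fintype.card_fin, nsmul_eq_mul, mul_assoc]

/-- The character `e^{i s·l}`. -/
def character (l : Fin n → ℤ) (s : E n) : ℂ := Complex.exp (Complex.I * (dotL l s : ℝ))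

theorem norm_character (l : Fin n → ℤ) (s : E n) : ‖character l s‖ = 1 := by
  rw [character, mul_comm, Complex.norm_exp_ofReal_mul_I]

theorem mFourier_toTorus (l : Fin n → ℤ) (s : E n) :
    UnitAddTorus.mFourier l (toTorus s) = character l s := by
  rw [character, dotL_apply, UnitAddTorus.mFourier, ContinuousMap.coe_mk, Complex.ofReal_sum,
    Finset.mul_sum, Complex.exp_sum]
  refine Finset.prod_congr rfl fun j _ => ?_
  rw [toTorus, fourier_coe_apply]
  congr 1
  have : (Real.pi : ℂ) ≠ 0 := Complex.ofReal_ne_zero.2 Real.pi_ne_zero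
  push_cast
  field_simp

variable (θ : Matrix (Fin n) (Fin n) ℝ)

/-- The coefficient functional on all of `𝓛(L²(𝕋ⁿ))`. -/
def opCoeff (l : Fin n → ℤ) : B n →L[ℂ] ℂ :=
  (innerSL ℂ (oneL2 n)) ∘L ContinuousLinearMap.apply ℂ (L2T n) (star (UOp θ l : B n) (oneL2 n))

theorem opCoeff_apply (l : Fin n → ℤ) (T : B n) :
    opCoeff θ l T = ⟪oneL2 n, T (star (UOp θ l : B n) (oneL2 n))⟫_ℂ := rfl

theorem opCoeff_alg (l : Fin n → ℤ) (a : alg θ) : opCoeff θ l (a : B n) = coeff θ l a := rfl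

theorem norm_opCoeff_le (l : Fin n → ℤ) (T : B n) : ‖opCoeff θ l T‖ ≤ ‖T‖ := by
  rw [opCoeff_apply]
  refine (norm_inner_le_norm _ _).trans ?_
  have h1 : ‖star (UOp θ l : B n) (oneL2 n)‖ ≤ 1 := by
    refine (((ContinuousLinearMap.norm_map_iff_adjoint_comp_self
      (star (UOp θ l : B n))).2 ?_ _).trans norm_oneL2).le
    have := Unitary.coe_mul_star_self (UOp θ l)
    rw [← ContinuousLinearMap.star_eq_adjoint, star_star]
    exact this
  rw [norm_oneL2, one_mul]
  exact (T.le_opNorm _).trans (mul_le_of_le_one_right (norm_nonneg _) h1)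

theorem transl_mul_isWeyl {l : Fin n → ℤ} {V : B n} (hV : IsWeyl θ l V) (s : E n) :
    transl (toTorus s) * V = character l s • (V * transl (toTorus s)) := by
  obtain ⟨c, -, rfl⟩ := hV
  rw [weylOp, mul_smul_comm, ← mul_assoc, transl_mul_mulOp, mFourier_toTorus, smul_mul_assoc,
    mul_assoc, transl_mul, smul_mul_assoc, mul_assoc, transl_mul, add_comm, smul_comm]

theorem character_neg (l : Fin n → ℤ) (s : E n) : character (-l) (-s) = character l s := by
  rw [character, character, dotL_apply, dotL_apply]
  simp

theorem action_UOp (l : Fin n → ℤ) (s : E n) :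
    action s (UOp θ l : B n) = character l s • (UOp θ l : B n) := by
  have h : toTorus s + toTorus (-s : E n) = 0 := by
    have := toTorus_add (n := n) s (-s : E n)
    rw [← this, ← toTorus_zero]
    congr 1
    exact add_neg_cancel (s : Fin n → ℝ)
  rw [action, transl_mul_isWeyl θ (isWeyl_UOp l), smul_mul_assoc, mul_assoc, transl_mul, h,
    transl_zero_eq, mul_one]

/-- The translation on the right of `T` multiplies (U^l)* 1 by the character, and the one on the
left is an isometry fixing the constant function 1. -/
theorem opCoeff_action (l : Fin n → ℤ) (s : E n) (T : B n) :
    opCoeff θ l (action s T) = character l s * opCoeff θ l T := by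
  have hW : IsWeyl θ (-l) (star (UOp θ l : B n)) :=
    (isWeyl_UOp l).star (Unitary.coe_star_mul_self (UOp θ l))
  have h1 : transl (toTorus (-s : E n)) (star (UOp θ l : B n) (oneL2 n)) =
      character l s • star (UOp θ l : B n) (oneL2 n) := by
    have := congrArg (fun S : B n => S (oneL2 n)) (transl_mul_isWeyl θ hW (-s))
    simp only [mul_apply_eq_comp, smul_apply, transl_oneL2, character_neg] at this
    exact this
  rw [opCoeff_apply, opCoeff_apply, action, mul_apply_eq_comp, mul_apply_eq_comp, h1, map_smul,
    map_smul, inner_smul_right]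
  congr 1
  have h2 := LinearIsometry.inner_map_map (Lp.compMeasurePreservingₗᵢ ℂ
    (fun y => y + toTorus s) (measurePreserving_add_right (torusMeasure n) (toTorus s)))
    (oneL2 n) (T (star (UOp θ l : B n) (oneL2 n)))
  have h3 : ⟪transl (toTorus s) (oneL2 n), transl (toTorus s) (T (star (UOp θ l : B n) (oneL2 n)))⟫_ℂ
    = ⟪oneL2 n, T (star (UOp θ l : B n) (oneL2 n))⟫_ℂ := h2
  rwa [transl_oneL2] at h3

/-- `action s` as a continuous linear map. -/
def actionL (s : E n) : B n →L[ℂ] B n :=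
  (ContinuousLinearMap.mul ℂ (B n)).flip (transl (toTorus (-s : E n))) ∘L
    ContinuousLinearMap.mul ℂ (B n) (transl (toTorus s))

theorem actionL_apply (s : E n) (T : B n) : actionL s T = action s T := rfl

theorem action_action (s t : E n) (T : B n) : action s (action t T) = action (s + t) T := by
  have h1 : toTorus (s + t : E n) = toTorus s + toTorus t := toTorus_add (n := n) s t
  have h2 : toTorus (-(s + t) : E n) = toTorus (-t : E n) + toTorus (-s : E n) := by
    have := toTorus_add (n := n) (-t : E n) (-s : E n)
    rw [← this]
    congr 1
    exact neg_add_rev (s : Fin n → ℝ) t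
  rw [action, action, action, h1, h2, ← transl_mul, ← transl_mul]
  simp only [mul_assoc]

theorem differentiable_action {T : B n} (hT : ContDiff ℝ ∞ fun s : E n => action s T) :
    Differentiable ℝ fun s : E n => action s T := hT.differentiable (by simp)

theorem hasDerivAt_action {T : B n} (hT : ContDiff ℝ ∞ fun s : E n => action s T) (j : Fin n) :
    HasDerivAt (fun t : ℝ => action (t • EuclideanSpace.single j 1 : E n) T)
      (lineDeriv ℝ (fun s : E n => action s T) 0 (EuclideanSpace.single j 1)) 0 := by
  have h := ((differentiable_action hT).differentiableAt (x := (0 : E n))).hasFDerivAt.hasLineDerivAt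
    (EuclideanSpace.single j 1)
  have h2 := h.lineDifferentiableAt.hasLineDerivAt
  rw [HasLineDerivAt] at h2
  simpa only [zero_add] using h2

/-- Differentiating e^{is·l} at s = 0 yields i·l_j. Since `opCoeff` is defined on all bounded
operators, there is no need to know that δ_j preserves A_θ. -/
theorem opCoeff_delta {T : B n} (hT : ContDiff ℝ ∞ fun s : E n => action s T) (j : Fin n)
    (l : Fin n → ℤ) : opCoeff θ l (delta j T) = (l j : ℂ) * opCoeff θ l T := by
  have h1 := ((opCoeff θ l).restrictScalars ℝ).hasFDerivAt.comp_hasDerivAt (0 : ℝ)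
    (hasDerivAt_action hT j)
  have h2 : HasDerivAt (fun t : ℝ => Complex.exp (Complex.I * ((l j : ℝ) * t : ℝ)) * opCoeff θ l T)
      (Complex.I * (l j : ℂ) * opCoeff θ l T) 0 := by
    have h3 : HasDerivAt (fun t : ℝ => Complex.I * (((l j : ℝ) * t : ℝ) : ℂ))
        (Complex.I * ((l j : ℝ) : ℂ)) 0 := by
      have h4 := ((hasDerivAt_id (0 : ℝ)).const_mul (l j : ℝ)).ofReal_comp.const_mul Complex.I
      simpa using h4
    have h5 := h3.cexp.mul_const (opCoeff θ l T)
    simpa using h5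
  have h3 : ((opCoeff θ l).restrictScalars ℝ) ∘
      (fun t : ℝ => action (t • EuclideanSpace.single j 1 : E n) T) =
      fun t : ℝ => Complex.exp (Complex.I * ((l j : ℝ) * t : ℝ)) * opCoeff θ l T := by
    funext t
    change opCoeff θ l (action _ T) = _
    rw [opCoeff_action, character, dotL_apply]
    congr 3
    congr 1
    rw [Finset.sum_eq_single j]
    · simp
    · intro i _ hi
      simp [hi]
    · simp
  rw [h3] at h1
  have h4 := h1.unique h2
  rw [delta, map_smul, smul_eq_mul]
  have h5 : opCoeff θ l (lineDeriv ℝ (fun s : E n => action s T) 0 (EuclideanSpace.single j 1)) =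
      Complex.I * (l j : ℂ) * opCoeff θ l T := h4
  rw [h5]
  field_simp

/-- The group law α_s α_t = α_{s+t} transports the derivative at 0 to the derivative at `s`; hence
δ_j preserves smoothness of orbits and can be iterated. -/
theorem action_delta {T : B n} (hT : ContDiff ℝ ∞ fun s : E n => action s T) (j : Fin n) (s : E n) :
    action s (delta j T) = (1 / Complex.I) •
      fderiv ℝ (fun s : E n => action s T) s (EuclideanSpace.single j 1) := by
  rw [delta, ← actionL_apply, map_smul]
  congr 1
  have h1 := ((actionL s).restrictScalars ℝ).hasFDerivAt.comp_hasDerivAt (0 : ℝ)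
    (hasDerivAt_action hT j)
  have h2 := ((differentiable_action hT).differentiableAt (x := s)).hasFDerivAt.hasLineDerivAt
    (EuclideanSpace.single j 1)
  rw [HasLineDerivAt] at h2
  refine h1.unique (h2.congr_of_eventuallyEq (Filter.Eventually.of_forall fun t => ?_))
  exact action_action s _ T

theorem contDiff_action_delta {T : B n} (hT : ContDiff ℝ ∞ fun s : E n => action s T) (j : Fin n) :
    ContDiff ℝ ∞ fun s : E n => action s (delta j T) := by
  have h : (fun s : E n => action s (delta j T)) = fun s => (1 / Complex.I) •
      fderiv ℝ (fun s : E n => action s T) s (EuclideanSpace.single j 1) :=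
    funext fun s => action_delta hT j s
  rw [h]
  have h1 : ContDiff ℝ ∞ (fderiv ℝ fun s : E n => action s T) := hT.fderiv_right (by simp)
  exact (h1.clm_apply contDiff_const).const_smul _

theorem opCoeff_delta_iterate {T : B n} (hT : ContDiff ℝ ∞ fun s : E n => action s T) (j : Fin n)
    (l : Fin n → ℤ) (M : ℕ) : ContDiff ℝ ∞ (fun s : E n => action s ((delta j)^[M] T)) ∧
      opCoeff θ l ((delta j)^[M] T) = (l j : ℂ) ^ M * opCoeff θ l T := by
  induction M with
  | zero => exact ⟨hT, by simp⟩
  | succ M ih =>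
    rw [Function.iterate_succ_apply']
    refine ⟨contDiff_action_delta ih.1 j, ?_⟩
    rw [opCoeff_delta θ ih.1, ih.2, pow_succ]
    ring

theorem deltaPow_single (j : Fin n) (M : ℕ) (T : B n) :
    deltaPow (Pi.single j M) T = (delta j)^[M] T := by
  have h : ∀ L : List (Fin n), L.Nodup →
      L.foldr (fun i S => (delta i)^[(Pi.single j M : Fin n → ℕ) i] S) T =
        if j ∈ L then (delta j)^[M] T else T := by
    intro L
    induction L with
    | nil => simp
    | cons i L ih =>
      intro hL
      rw [List.nodup_cons] at hL
      rw [List.foldr_cons, ih hL.2]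
      by_cases hij : j = i
      · subst hij
        simp [hL.1]
      · simp [hij]
  rw [deltaPow, h _ (List.nodup_finRange n), if_pos (List.mem_finRange j)]

theorem deltaPow_zero (T : B n) : deltaPow 0 T = T := by
  have h : ∀ L : List (Fin n), L.foldr (fun i S => (delta i)^[(0 : Fin n → ℕ) i] S) T = T := by
    intro L
    induction L with
    | nil => rfl
    | cons i L ih => rw [List.foldr_cons, ih]; rfl
  exact h _

/-- The decay of the Fourier coefficients of smooth elements. -/
theorem norm_pow_mul_coeff_le (u : smooth θ) (l : Fin n → ℤ) (M : ℕ) :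
    ‖l‖ ^ M * ‖coeff θ l (u : alg θ)‖ ≤
      ‖((u : alg θ) : B n)‖ + ∑ j, ‖deltaPow (Pi.single j M) ((u : alg θ) : B n)‖ := by
  -- For `n = 0` the sum over `j` is empty, and the first term on the right carries the estimate.
  rcases isEmpty_or_nonempty (Fin n) with h | h
  · have h0 : ‖l‖ = 0 := by rw [Subsingleton.elim l 0, norm_zero]
    have h1 := norm_opCoeff_le θ l ((u : alg θ) : B n)
    rw [opCoeff_alg] at h1
    have h2 : ‖l‖ ^ M ≤ 1 := pow_le_one₀ (norm_nonneg _) (by rw [h0]; exact zero_le_one)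
    have h3 := mul_le_of_le_one_left (norm_nonneg (coeff θ l (u : alg θ))) h2
    have h4 : (0 : ℝ) ≤ ∑ j, ‖deltaPow (Pi.single j M) ((u : alg θ) : B n)‖ :=
      Finset.sum_nonneg fun _ _ => norm_nonneg _
    linarith
  -- The index `j` is a coordinate where the sup norm of `l` is attained, so pure powers of a single
  -- δ_j are enough.
  · obtain ⟨j, hj⟩ : ∃ j, ‖l‖ = ‖l j‖ := by
      obtain ⟨j, hj⟩ := Finite.exists_max fun j => ‖l j‖
      exact ⟨j, le_antisymm ((pi_norm_le_iff_of_nonneg (norm_nonneg _)).2 hj) (norm_le_pi_norm l j)⟩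
    have h1 := norm_opCoeff_le θ l ((delta j)^[M] ((u : alg θ) : B n))
    rw [(opCoeff_delta_iterate θ u.2 j l M).2, opCoeff_alg, norm_mul, norm_pow] at h1
    have h2 : ‖(l j : ℂ)‖ = ‖l‖ := by rw [hj, Complex.norm_intCast, Int.norm_eq_abs]
    rw [h2, ← deltaPow_single] at h1
    refine h1.trans ((Finset.single_le_sum
      (f := fun j => ‖deltaPow (Pi.single j M) ((u : alg θ) : B n)‖)
      (fun _ _ => norm_nonneg _) (Finset.mem_univ j)).trans ?_)
    exact le_add_of_nonneg_left (norm_nonneg _)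

/-- Summability on `ℤⁿ`. -/
theorem summable_weight {M : ℕ} (hM : n < M) :
    Summable fun l : Fin n → ℤ => (1 + ‖l‖ ^ M)⁻¹ := by
  set L : Submodule ℤ (Fin n → ℝ) := Submodule.span ℤ (Set.range (Pi.basisFun ℝ (Fin n))) with hL
  have hmem : ∀ l : Fin n → ℤ, (fun i => (l i : ℝ)) ∈ L := fun l => by
    rw [hL, Module.Basis.mem_span_iff_repr_mem]
    exact fun i => ⟨l i, by simp⟩
  have hinj : Function.Injective fun l : Fin n → ℤ => (⟨fun i => (l i : ℝ), hmem l⟩ : L) := by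
    intro k l hkl
    funext i
    have h : (k i : ℝ) = l i := congrFun (Subtype.ext_iff.1 hkl) i
    exact_mod_cast h
  have hrank : Module.finrank ℤ L = n := by
    rw [ZLattice.rank ℝ L, Module.finrank_fin_fun]
  have h1 := (ZLattice.summable_norm_pow_inv L M (by rw [hrank]; exact hM)).comp_injective hinj
  have hnorm : ∀ l : Fin n → ℤ, ‖(⟨fun i => (l i : ℝ), hmem l⟩ : L)‖ = ‖l‖ := fun l => by
    change ‖fun i => (l i : ℝ)‖ = ‖l‖
    rw [Pi.norm_def, Pi.norm_def]
    congr 2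
  -- The comparison fails at l = 0, where the inverse power is 0 by convention and the weight is
  -- not.
  refine Summable.of_norm_bounded_eventually h1 ?_
  filter_upwards [(Set.finite_singleton (0 : Fin n → ℤ)).compl_mem_cofinite] with l hl
  have hl' : 0 < ‖l‖ := norm_pos_iff.2 hl
  rw [Function.comp_apply, hnorm, Real.norm_of_nonneg (by positivity), inv_pow]
  gcongr
  linarith

theorem iteratedDeriv_exp_I (m : ℕ) : iteratedDeriv m (fun t : ℝ => Complex.exp (Complex.I * t)) =
    fun t : ℝ => Complex.I ^ m * Complex.exp (Complex.I * t) := by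
  induction m with
  | zero => simp
  | succ m ih =>
    rw [iteratedDeriv_succ, ih]
    funext t
    have h1 : HasDerivAt (fun t : ℝ => Complex.I * (t : ℂ)) Complex.I t := by
      simpa using (hasDerivAt_id t).ofReal_comp.const_mul Complex.I
    have h2 := h1.cexp.const_mul (Complex.I ^ m)
    rw [h2.deriv, pow_succ]
    ring

theorem contDiff_exp_I : ContDiff ℝ ∞ fun t : ℝ => Complex.exp (Complex.I * t) :=
  (contDiff_const.mul Complex.ofRealCLM.contDiff).cexp

theorem norm_iteratedFDeriv_character_le (l : Fin n → ℤ) (m : ℕ) (s : E n) :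
    ‖iteratedFDeriv ℝ m (character l) s‖ ≤ (n * ‖l‖) ^ m := by
  have h : character l = (fun t : ℝ => Complex.exp (Complex.I * t)) ∘ dotL l := rfl
  rw [h, (dotL l).iteratedFDeriv_comp_right contDiff_exp_I s (by exact_mod_cast le_top)]
  refine (ContinuousMultilinearMap.norm_compContinuousLinearMap_le _ _).trans ?_
  rw [norm_iteratedFDeriv_eq_norm_iteratedDeriv, iteratedDeriv_exp_I, norm_mul, norm_pow,
    Complex.norm_I, one_pow, one_mul, mul_comm Complex.I, Complex.norm_exp_ofReal_mul_I, one_mul,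
    Finset.prod_const, Finset.card_univ, Fintype.card_fin]
  gcongr
  exact norm_dotL_le l

/-- Adding the decay bounds for the exponents m and m + n + 1 gives domination by the summable
weight (1 + |l|^{n+1})⁻¹. -/
theorem summable_of_decay {c : (Fin n → ℤ) → ℂ} (hc : ∀ M : ℕ, ∃ C : ℝ, ∀ l, ‖l‖ ^ M * ‖c l‖ ≤ C)
    (m : ℕ) : Summable fun l => ‖l‖ ^ m * ‖c l‖ := by
  obtain ⟨C, hC⟩ := hc m
  obtain ⟨D, hD⟩ := hc (m + (n + 1))
  refine Summable.of_norm_bounded ((summable_weight (Nat.lt_succ_self n)).mul_left (C + D))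
    fun l => ?_
  rw [Real.norm_of_nonneg (by positivity), ← div_eq_mul_inv, le_div_iff₀ (by positivity)]
  have h1 := hC l
  have h2 := hD l
  rw [pow_add] at h2
  rw [Nat.succ_eq_add_one]
  linarith

/-- An element with rapidly decaying Fourier coefficients is smooth. -/
theorem mem_smooth_of_decay {a : alg θ}
    (ha : ∀ M : ℕ, ∃ C : ℝ, ∀ l, ‖l‖ ^ M * ‖coeff θ l a‖ ≤ C) : a ∈ smooth θ := by
  have hs := summable_of_decay ha
  have hsum : HasSum (fun l => coeff θ l a • (UOp θ l : B n)) (a : B n) := by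
    have h1 := hasSum_U_of_summable θ (a := a) (by simpa using hs 0)
    exact h1.mapL (alg θ).toSubalgebra.toSubmodule.subtypeL
  -- The action turns the Fourier series into a series of scalar characters times fixed operators.
  -- An m-th derivative costs only a factor (n|l|)^m, which the rapid decay absorbs.
  have heq : (fun s : E n => action s (a : B n)) =
      fun s => ∑' l, (ContinuousLinearMap.smulRight (1 : ℂ →L[ℂ] ℂ)
        (coeff θ l a • (UOp θ l : B n))).restrictScalars ℝ (character l s) := by
    funext s
    rw [← actionL_apply, ← hsum.tsum_eq, (actionL s).map_tsum hsum.summable]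
    refine tsum_congr fun l => ?_
    rw [map_smul, actionL_apply, action_UOp, smul_comm]
    rfl
  have hchar : ∀ l : Fin n → ℤ, ContDiff ℝ ∞ (character l) := fun l =>
    contDiff_exp_I.comp (dotL l).contDiff
  change ContDiff ℝ ∞ fun s : E n => action s (a : B n)
  rw [heq]
  refine contDiff_tsum (v := fun m l => ‖coeff θ l a‖ * (n * ‖l‖) ^ m)
    (fun l => (ContinuousLinearMap.contDiff _).comp (hchar l)) (fun m _ => ?_) fun m l s _ => ?_
  · refine ((hs m).mul_left ((n : ℝ) ^ m)).congr fun l => ?_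
    rw [mul_pow]
    ring
  · refine (ContinuousLinearMap.norm_iteratedFDeriv_comp_left _ ((hchar l).contDiffAt)
      (by exact_mod_cast le_top)).trans ?_
    refine mul_le_mul ?_ (norm_iteratedFDeriv_character_le l m s) (norm_nonneg _) (norm_nonneg _)
    rw [ContinuousLinearMap.norm_restrictScalars]
    refine ContinuousLinearMap.opNorm_le_bound _ (norm_nonneg _) fun z => ?_
    rw [ContinuousLinearMap.smulRight_apply, norm_smul, norm_smul, mul_comm]
    have h1 : ‖(UOp θ l : B n)‖ ≤ 1 := norm_U_le θ l
    gcongr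
    · exact mul_le_of_le_one_right (norm_nonneg _) h1
    · simp

end Decay

end NCTorus

namespace NCTorus

variable {n : ℕ}

/-! ### Traces on products with diagonal operators -/

section TorusTrace

variable (θ : Matrix (Fin n) (Fin n) ℝ)

/-- `leftRep` as a continuous linear map. -/
def leftRepL : alg θ →L[ℂ] (Hilb θ →L[ℂ] Hilb θ) :=
  LinearMap.mkContinuous (leftRep θ).toAlgHom.toLinearMap 1 fun a => by
    rw [one_mul]; exact norm_leftRep_le θ a

theorem character_add (k l : Fin n → ℤ) (s : E n) :
    character (k + l) s = character k s * character l s := by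
  rw [character, character, character, ← Complex.exp_add, ← mul_add, ← Complex.ofReal_add,
    dotL_apply, dotL_apply, dotL_apply, ← Finset.sum_add_distrib]
  congr 4
  funext j
  rw [Pi.add_apply]
  push_cast
  ring

theorem character_mul_neg (k : Fin n → ℤ) (s : E n) : character k s * character k (-s) = 1 := by
  rw [character, character, ← Complex.exp_add, map_neg]
  simp

theorem exists_character_ne_one {m : Fin n → ℤ} (hm : m ≠ 0) : ∃ s : E n, character m s ≠ 1 := by
  obtain ⟨j, hj⟩ := Function.ne_iff.1 hm
  have hj' : (m j : ℂ) ≠ 0 := by exact_mod_cast hj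
  -- This choice makes s·m = π, so the character takes the value −1.
  refine ⟨EuclideanSpace.single j (Real.pi / m j), ?_⟩
  have : dotL m (EuclideanSpace.single j (Real.pi / m j)) = m j * (Real.pi / m j) := by
    rw [dotL_apply, Finset.sum_eq_single j]
    · simp
    · intro i _ hi
      simp [hi]
    · simp
  rw [character, this]
  push_cast
  rw [mul_div_cancel₀ _ hj', mul_comm, Complex.exp_pi_mul_I]
  norm_num

omit θ in
/-- The dual action of `ℝⁿ` on shifts. -/
theorem conj_shift {H : Type*} [NormedAddCommGroup H] [InnerProductSpace ℂ H]
    (e : HilbertBasis (Fin n → ℤ) ℂ H) {A : H →L[ℂ] H} {m : Fin n → ℤ} {c : (Fin n → ℤ) → ℂ}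
    (hA : ∀ k, A (e k) = c k • e (m + k)) (s : E n) :
    diagOp e (fun k => character k s) * A * diagOp e (fun k => character k (-s)) =
      character m s • A := by
  have hb : ∀ s : E n, ∀ k, ‖character k s‖ ≤ 1 := fun s k => (norm_character k s).le
  refine e.clm_ext fun k => ?_
  rw [mul_apply_eq_comp, mul_apply_eq_comp, diagOp_basis (hb (-s)), map_smul, map_smul, smul_apply,
    hA, map_smul, diagOp_basis (hb s), character_add, smul_smul, smul_smul, smul_smul]
  congr 1
  linear_combination c k * character m s * character_mul_neg k s

omit θ in
-- Conjugation by the unitary diag(e^{is·k}) fixes the diagonal factor and multiplies the shift by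
-- e^{is·m}. Invariance of the trace then forces it to vanish once e^{is·m} ≠ 1.
theorem trace_shift_mul_diagOp {H : Type*} [NormedAddCommGroup H] [InnerProductSpace ℂ H]
    [CompleteSpace H] {φ : weakTraceClass H →ₗ[ℂ] ℂ} (hφ : IsNormalizedPositiveTrace φ)
    (e : HilbertBasis (Fin n → ℤ) ℂ H) {A : H →L[ℂ] H} {m : Fin n → ℤ} (hm : m ≠ 0)
    {c : (Fin n → ℤ) → ℂ} (hA : ∀ k, A (e k) = c k • e (m + k)) {f : (Fin n → ℤ) → ℂ} {C : ℝ}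
    (hf : ∀ k, ‖f k‖ ≤ C) (hmem : diagOp e f ∈ weakTraceClass H) :
    φ ⟨A * diagOp e f, mul_mem_weakTraceClass _ hmem⟩ = 0 := by
  obtain ⟨s, hs⟩ := exists_character_ne_one hm
  have hb : ∀ s : E n, ∀ k, ‖character k s‖ ≤ 1 := fun s k => (norm_character k s).le
  set V := diagOp e (fun k => character k s) with hV
  set V' := diagOp e (fun k => character k (-s)) with hV'
  set X := diagOp e f with hX
  have h1 : V * A * V' = character m s • A := conj_shift e hA s
  have h2 : V' * X = X * V' := by
    rw [hV', hX, diagOp_mul (hb (-s)) hf, diagOp_mul hf (hb (-s))]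
    congr 1
    funext k
    ring
  have h3 : V' * V = 1 := e.clm_ext fun k => by
    rw [mul_apply_eq_comp, hV, diagOp_basis (hb s), map_smul, hV', diagOp_basis (hb (-s)),
      smul_smul, character_mul_neg, one_smul]
    rfl
  have hmem1 : A * X ∈ weakTraceClass H := mul_mem_weakTraceClass A hmem
  have hmem2 : A * X * V' ∈ weakTraceClass H := mem_weakTraceClass_mul hmem1 V'
  have h4 := hφ.comm V hmem2
  have h5 : V * (A * X * V') = character m s • (A * X) := by
    rw [← smul_mul_assoc, ← h1, mul_assoc A, ← h2]
    simp only [mul_assoc]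
  have h6 : A * X * V' * V = A * X := by rw [mul_assoc (A * X), h3, mul_one]
  have h7 : character m s * φ ⟨A * X, hmem1⟩ = φ ⟨A * X, hmem1⟩ := by
    rw [← smul_eq_mul, ← map_smul]
    refine (congrArg φ (Subtype.ext ?_)).trans (h4.trans (congrArg φ (Subtype.ext h6)))
    exact h5.symm
  have h8 : (character m s - 1) * φ ⟨A * X, hmem1⟩ = 0 := by rw [sub_mul, h7, one_mul, sub_self]
  exact (mul_eq_zero.1 h8).resolve_left (sub_ne_zero.2 hs)

omit θ in
theorem traceMul_shift_mul_diagOp {H : Type*} [NormedAddCommGroup H] [InnerProductSpace ℂ H]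
    [CompleteSpace H] {φ : weakTraceClass H →ₗ[ℂ] ℂ} (hφ : IsNormalizedPositiveTrace φ)
    (e : HilbertBasis (Fin n → ℤ) ℂ H) {A : H →L[ℂ] H} {m : Fin n → ℤ} (hm : m ≠ 0)
    {c : (Fin n → ℤ) → ℂ} (hA : ∀ k, A (e k) = c k • e (m + k)) {f r : (Fin n → ℤ) → ℂ} {C R : ℝ}
    (hf : ∀ k, ‖f k‖ ≤ C) (hr : ∀ k, ‖r k‖ ≤ R) (hD : diagOp e r ∈ weakTraceClass H) :
    traceMul φ hD (A * diagOp e f) = 0 := by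
  have hfr : ∀ k, ‖f k * r k‖ ≤ C * R := fun k => by
    rw [norm_mul]
    exact mul_le_mul (hf k) (hr k) (norm_nonneg _) ((norm_nonneg _).trans (hf k))
  have h1 := diagOp_mul (b := e) hf hr
  have hmem : diagOp e (fun k => f k * r k) ∈ weakTraceClass H := by
    rw [← h1]; exact mul_mem_weakTraceClass _ hD
  refine Eq.trans (congrArg φ (Subtype.ext ?_)) (trace_shift_mul_diagOp hφ e hm hA hfr hmem)
  change A * diagOp e f * diagOp e r = _
  rw [mul_assoc, h1]

theorem exists_leftRep_U_basis (m : Fin n → ℤ) : ∃ c : (Fin n → ℤ) → ℂ,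
    ∀ k, leftRep θ (U θ m) (fourierBasis θ k) = c k • fourierBasis θ (m + k) := by
  choose c hc using exists_U_mul θ m
  refine ⟨c, fun k => ?_⟩
  rw [fourierBasis_apply, fourierBasis_apply, leftRep_toHilb, (hc k).2, toHilb_smul]

variable {θ} in
/-- Traces of `c · diag(f)`, `c ∈ A_θ`, factor through `τ(c)`. -/
theorem traceMul_rep_mul_diagOp {H : Type*} [NormedAddCommGroup H] [InnerProductSpace ℂ H]
    [CompleteSpace H] {φ : weakTraceClass H →ₗ[ℂ] ℂ} (hφ : IsNormalizedPositiveTrace φ)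
    (e : HilbertBasis (Fin n → ℤ) ℂ H) (π : alg θ →L[ℂ] (H →L[ℂ] H)) (hπ1 : π 1 = 1)
    (hπ : ∀ m, ∃ c : (Fin n → ℤ) → ℂ, ∀ k, π (U θ m) (e k) = c k • e (m + k))
    {r : (Fin n → ℤ) → ℂ} {R : ℝ} (hr : ∀ k, ‖r k‖ ≤ R)
    (hD : diagOp e r ∈ weakTraceClass H) (hpos : (diagOp e r).IsPositive)
    {f : (Fin n → ℤ) → ℂ} {C : ℝ} (hf : ∀ k, ‖f k‖ ≤ C) (c : alg θ) :
    traceMul φ hD (π c * diagOp e f) = tauL θ c * traceMul φ hD (diagOp e f) := by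
  -- Norm continuity makes both sides continuous linear forms in `c`, so that it suffices to compare
  -- them on the U^m.
  set Ψ : (H →L[ℂ] H) →L[ℂ] ℂ := ⟨traceMul φ hD, hφ.continuous_traceMul hD hpos⟩ with hΨ
  have h := alg_ext_of_U θ
    (S := Ψ ∘L (ContinuousLinearMap.mul ℂ (H →L[ℂ] H)).flip (diagOp e f) ∘L π)
    (T := (traceMul φ hD (diagOp e f)) • tauL θ) fun m => ?_
  · have h1 := congrArg (fun S : alg θ →L[ℂ] ℂ => S c) h
    refine Eq.trans h1 ?_
    rw [mul_comm]
    rfl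
  · change traceMul φ hD (π (U θ m) * diagOp e f) = traceMul φ hD (diagOp e f) * tau θ (U θ m)
    rw [tau_U]
    split_ifs with hm
    · rw [hm, U_zero, hπ1, one_mul, mul_one]
    · obtain ⟨d, hd⟩ := hπ m
      rw [mul_zero, traceMul_shift_mul_diagOp hφ e hm hd hf hr hD]

end TorusTrace

end NCTorus

namespace NCTorus

variable {n : ℕ}

/-! ### Operators of order `-n` -/

section Symbol

theorem one_le_norm_latticePoint {k : Fin n → ℤ} (hk : k ≠ 0) : 1 ≤ ‖latticePoint k‖ := by
  obtain ⟨j, hj⟩ := Function.ne_iff.1 hk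
  have h1 : (1 : ℝ) ≤ |(k j : ℝ)| := by
    have : 1 ≤ |k j| := Int.one_le_abs hj
    exact_mod_cast this
  exact h1.trans (norm_coord_le (latticePoint k) j)

theorem tendsto_norm_latticePoint :
    Filter.Tendsto (fun k : Fin n → ℤ => ‖latticePoint k‖) Filter.cofinite Filter.atTop := by
  refine Filter.tendsto_atTop.2 fun R => ?_
  have h := (finite_latticePoint_norm_le (n := n) R).compl_mem_cofinite
  filter_upwards [h] with k hk
  exact (not_le.1 (show ¬ ‖latticePoint k‖ ≤ R from hk)).le

variable {θ : Matrix (Fin n) (Fin n) ℝ} {ρ : E n → smooth θ} {hom : ℕ → E n → smooth θ}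

theorem IsClassicalSymbol.norm_deltaPow_le (h : IsClassicalSymbol θ (-(n : ℂ)) ρ hom)
    (α : Fin n → ℕ) : ∃ C : ℝ, ∀ k : Fin n → ℤ, k ≠ 0 →
      ‖latticePoint k‖ ^ n * ‖deltaPow α ((ρ (latticePoint k) : alg θ) : B n)‖ ≤ C := by
  obtain ⟨C, hC⟩ := h.asymptotic 0 α 0
  refine ⟨C, fun k hk => ?_⟩
  have h1 := hC _ (one_le_norm_latticePoint hk)
  have hpos : 0 < ‖latticePoint k‖ := zero_lt_one.trans_le (one_le_norm_latticePoint hk)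
  have h2 : ‖latticePoint k‖ ^ ((-(n : ℂ)).re - (0 : ℕ) - (0 : ℕ)) = (‖latticePoint k‖ ^ n)⁻¹ := by
    rw [Complex.neg_re, Complex.natCast_re, Nat.cast_zero, sub_zero, sub_zero,
      Real.rpow_neg hpos.le, Real.rpow_natCast]
  rw [norm_iteratedFDeriv_zero, Finset.sum_range_zero, sub_zero, h2, ← div_eq_mul_inv,
    le_div_iff₀ (pow_pos hpos n)] at h1
  rwa [mul_comm]

/-- This is the case N = 1 of the expansion: removing the leading term gains one factor |k|⁻¹,
enough for an o(|k|⁻ⁿ) error. -/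
theorem IsClassicalSymbol.norm_sub_le (h : IsClassicalSymbol θ (-(n : ℂ)) ρ hom) :
    ∃ C : ℝ, ∀ k : Fin n → ℤ, k ≠ 0 → ‖latticePoint k‖ ^ n *
      ‖(ρ (latticePoint k) : alg θ) - (hom 0 (latticePoint k) : alg θ)‖ ≤
        C * ‖latticePoint k‖⁻¹ := by
  obtain ⟨C, hC⟩ := h.asymptotic 1 0 0
  refine ⟨C, fun k hk => ?_⟩
  have h1 := hC _ (one_le_norm_latticePoint hk)
  have hpos : 0 < ‖latticePoint k‖ := zero_lt_one.trans_le (one_le_norm_latticePoint hk)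
  have h2 : ‖latticePoint k‖ ^ ((-(n : ℂ)).re - (1 : ℕ) - (0 : ℕ)) =
      ‖latticePoint k‖⁻¹ * (‖latticePoint k‖ ^ n)⁻¹ := by
    rw [Complex.neg_re, Complex.natCast_re, Nat.cast_zero, Nat.cast_one, sub_zero,
      Real.rpow_sub_one hpos.ne', Real.rpow_neg hpos.le, Real.rpow_natCast, div_eq_inv_mul]
  rw [norm_iteratedFDeriv_zero, Finset.sum_range_one, deltaPow_zero, h2, ← mul_assoc,
    ← div_eq_mul_inv, le_div_iff₀ (pow_pos hpos n)] at h1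
  rw [mul_comm]
  exact h1

theorem IsHomogeneousSymbol.continuousOn_deltaPow {q : ℂ} {σ : E n → smooth θ}
    (h : IsHomogeneousSymbol θ q σ) (α : Fin n → ℕ) :
    ContinuousOn (fun ξ => deltaPow α ((σ ξ : alg θ) : B n)) {0}ᶜ := (h.contDiffOn α).continuousOn

theorem IsHomogeneousSymbol.continuousOn {q : ℂ} {σ : E n → smooth θ}
    (h : IsHomogeneousSymbol θ q σ) : ContinuousOn (fun ξ => (σ ξ : alg θ)) {0}ᶜ := by
  have h1 := h.continuousOn_deltaPow 0
  simp only [deltaPow_zero] at h1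
  exact Topology.IsInducing.subtypeVal.continuousOn_iff.2 h1

theorem coeff_sphereIntegral {q : ℂ} {σ : E n → smooth θ} (h : IsHomogeneousSymbol θ q σ)
    (l : Fin n → ℤ) : coeff θ l (sphereIntegral θ σ) =
      ∫ η : Metric.sphere (0 : E n) 1, coeff θ l (σ η : alg θ)
        ∂(volume : Measure (E n)).toSphere := by
  rw [sphereIntegral, ContinuousLinearMap.integral_comp_comm]
  exact integrable_sphere h.continuousOn

/-- The decay estimate for a smooth element involves finitely many seminorms, which are bounded on
the compact sphere, and so passes through the integral. -/
theorem sphereIntegral_decay {q : ℂ} {σ : E n → smooth θ} (h : IsHomogeneousSymbol θ q σ) (M : ℕ) :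
    ∃ C : ℝ, ∀ l, ‖l‖ ^ M * ‖coeff θ l (sphereIntegral θ σ)‖ ≤ C := by
  have hc : ContinuousOn (fun ξ => ‖((σ ξ : alg θ) : B n)‖ +
      ∑ j, ‖deltaPow (Pi.single j M) ((σ ξ : alg θ) : B n)‖) (Metric.sphere (0 : E n) 1) := by
    have h0 := h.continuousOn_deltaPow 0
    simp only [deltaPow_zero] at h0
    refine ContinuousOn.mono (ContinuousOn.add h0.norm ?_) sphere_subset_compl_zero
    exact continuousOn_finsetSum _ fun j _ => (h.continuousOn_deltaPow _).norm
  obtain ⟨K, hK⟩ := (isCompact_sphere (0 : E n) 1).exists_bound_of_continuousOn hc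
  refine ⟨K * (volume : Measure (E n)).toSphere.real Set.univ, fun l => ?_⟩
  have h1 : ‖∫ η : Metric.sphere (0 : E n) 1, ((‖l‖ ^ M : ℝ) : ℂ) * coeff θ l (σ η : alg θ)
      ∂(volume : Measure (E n)).toSphere‖ ≤
        K * (volume : Measure (E n)).toSphere.real Set.univ := by
    refine norm_integral_le_of_norm_le_const (Filter.Eventually.of_forall fun η => ?_)
    rw [norm_mul, Complex.norm_real, Real.norm_of_nonneg (by positivity)]
    exact (norm_pow_mul_coeff_le θ (σ η) l M).trans ((le_abs_self _).trans (hK η η.2))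
  rwa [integral_const_mul, ← coeff_sphereIntegral h, norm_mul, Complex.norm_real,
    Real.norm_of_nonneg (by positivity)] at h1

theorem IsHomogeneousSymbol.coeff_smul {σ : E n → smooth θ}
    (h : IsHomogeneousSymbol θ (-(n : ℂ) - (0 : ℕ)) σ) (l : Fin n → ℤ) (t : ℝ) (x : E n)
    (ht : 0 < t) (hx : x ≠ 0) :
    coeff θ l (σ (t • x) : alg θ) = ((t ^ n)⁻¹ : ℝ) * coeff θ l (σ x : alg θ) := by
  rw [h.homogeneous t x ht hx, Submodule.coe_smul, map_smul, Nat.cast_zero, sub_zero,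
    Complex.cpow_neg, Complex.cpow_natCast, smul_eq_mul]
  push_cast
  rfl

/-- The diagonal operators made of the Fourier coefficients of a symbol of order `-n`. -/
theorem IsClassicalSymbol.hasDiagIntegral {H : Type*} [NormedAddCommGroup H]
    [InnerProductSpace ℂ H] [CompleteSpace H] (hn : n ≠ 0)
    (h : IsClassicalSymbol θ (-(n : ℂ)) ρ hom) (e : HilbertBasis (Fin n → ℤ) ℂ H)
    (l : Fin n → ℤ) : HasDiagIntegral e
      (fun k => coeff θ l (ρ (latticePoint k) : alg θ))
      ((1 / (n : ℂ)) * coeff θ l (sphereIntegral θ (hom 0))) := by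
  have h0 : IsHomogeneousSymbol θ (-(n : ℂ) - (0 : ℕ)) (hom 0) := h.homogeneous 0
  rw [coeff_sphereIntegral h0]
  refine hasDiagIntegral_of_asymptotic hn e
    (F := fun ξ => coeff θ l (hom 0 ξ : alg θ))
    ((coeff θ l).continuous.comp_continuousOn h0.continuousOn)
    (fun t x ht hx => h0.coeff_smul l t x ht hx) ?_
  obtain ⟨C, hC⟩ := h.norm_sub_le
  have h1 : Filter.Tendsto (fun k : Fin n → ℤ => C * ‖latticePoint k‖⁻¹)
      Filter.cofinite (nhds 0) := by
    simpa using (tendsto_norm_latticePoint.inv_tendsto_atTop).const_mul C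
  refine squeeze_zero_norm' ?_ h1
  filter_upwards [(Set.finite_singleton (0 : Fin n → ℤ)).compl_mem_cofinite] with k hk
  refine le_trans ?_ (hC k hk)
  rw [norm_mul, Complex.norm_real, Real.norm_of_nonneg (by positivity), ← map_sub]
  gcongr
  exact norm_opCoeff_le θ l
    (((ρ (latticePoint k) : alg θ) - (hom 0 (latticePoint k) : alg θ) : alg θ) : B n)

/-- Uniform decay of the Fourier coefficients of a symbol of order `-n`. -/
theorem IsClassicalSymbol.coeff_decay (h : IsClassicalSymbol θ (-(n : ℂ)) ρ hom)
    {μ : (Fin n → ℤ) → ℝ} (hμ : ∀ k, 0 ≤ μ k) {D : ℝ}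
    (hμD : ∀ k, k ≠ 0 → μ k ≤ D * ‖latticePoint k‖ ^ n) (M : ℕ) :
    ∃ C : ℝ, ∀ k l, ‖l‖ ^ M * (μ k * ‖coeff θ l (ρ (latticePoint k) : alg θ)‖) ≤ C := by
  set g : (Fin n → ℤ) → ℝ := fun k => ‖((ρ (latticePoint k) : alg θ) : B n)‖ +
    ∑ j, ‖deltaPow (Pi.single j M) ((ρ (latticePoint k) : alg θ) : B n)‖ with hg
  have hg0 : ∀ k, 0 ≤ g k := fun k => by positivity
  obtain ⟨A, hA⟩ := h.norm_deltaPow_le 0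
  choose A' hA' using fun j : Fin n => h.norm_deltaPow_le (Pi.single j M)
  simp only [deltaPow_zero] at hA
  have h1 : ∀ k, k ≠ 0 → ‖latticePoint k‖ ^ n * g k ≤ A + ∑ j, A' j := fun k hk => by
    rw [hg, mul_add, Finset.mul_sum]
    exact add_le_add (hA k hk) (Finset.sum_le_sum fun j _ => hA' j k hk)
  -- The symbol estimates hold only for |ξ| ≥ 1, so the lattice point 0 is covered by a term of its
  -- own.
  refine ⟨max (μ 0 * g 0) (|D| * (A + ∑ j, A' j)), fun k l => ?_⟩
  have h2 : ‖l‖ ^ M * (μ k * ‖coeff θ l (ρ (latticePoint k) : alg θ)‖) ≤ μ k * g k := by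
    rw [mul_left_comm]
    exact mul_le_mul_of_nonneg_left (norm_pow_mul_coeff_le θ (ρ (latticePoint k)) l M) (hμ k)
  refine h2.trans ?_
  by_cases hk : k = 0
  · rw [hk]; exact le_max_left _ _
  · refine le_trans ?_ (le_max_right _ _)
    calc μ k * g k ≤ (|D| * ‖latticePoint k‖ ^ n) * g k := by
          refine mul_le_mul_of_nonneg_right ((hμD k hk).trans ?_) (hg0 k)
          gcongr
          exact le_abs_self D
      _ = |D| * (‖latticePoint k‖ ^ n * g k) := mul_assoc _ _ _
      _ ≤ _ := by gcongr; exact h1 k hk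

/-- An enumeration of `ℤⁿ` for which `j = O(|k_j|ⁿ)`. -/
theorem exists_enumeration_le (hn : n ≠ 0) : ∃ σ : ℕ ≃ (Fin n → ℤ), ∃ D : ℝ,
    ∀ k : Fin n → ℤ, k ≠ 0 → (σ.symm k : ℝ) + 1 ≤ D * ‖latticePoint k‖ ^ n := by
  obtain ⟨σ, hσ⟩ := exists_enumeration_tendsto hn continuousOn_inv_norm_pow inv_norm_pow_smul
    inv_norm_pow_pos (n := n)
  -- `D` bounds the convergent sequence (j + 1)|k_j|⁻ⁿ.
  obtain ⟨D, hD⟩ := (Metric.isBounded_range_of_tendsto _ hσ).exists_norm_le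
  refine ⟨σ, D, fun k hk => ?_⟩
  have h1 := (le_abs_self _).trans (hD _ ⟨σ.symm k, rfl⟩)
  have hpos : 0 < ‖latticePoint k‖ := zero_lt_one.trans_le (one_le_norm_latticePoint hk)
  simp only [Equiv.apply_symm_apply] at h1
  rwa [← div_eq_mul_inv, div_le_iff₀ (pow_pos hpos n)] at h1

end Symbol

end NCTorus

/-! ### Operators of order −n as a bounded operator times a harmonic operator -/

theorem harmonicOp_reindexEquiv {ι H : Type*} [NormedAddCommGroup H] [InnerProductSpace ℂ H]
    [CompleteSpace H] (e : HilbertBasis ι ℂ H) (σ : ℕ ≃ ι) : harmonicOp (e.reindexEquiv σ) =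
      diagOp e fun k => (((σ.symm k + 1 : ℝ)⁻¹ : ℝ) : ℂ) := by
  refine eq_diagOp (fun k => norm_inv_succ_le (σ.symm k)) fun k => ?_
  have h := harmonicOp_basis (e.reindexEquiv σ) (σ.symm k)
  rw [e.reindexEquiv_apply, Equiv.apply_symm_apply] at h
  rw [h]
  push_cast
  rfl

namespace NCTorus

variable {n : ℕ} {θ : Matrix (Fin n) (Fin n) ℝ}

section Symbol

variable {H : Type*} [NormedAddCommGroup H] [InnerProductSpace ℂ H] [CompleteSpace H]

/-- Let `f l k` be the Fourier coefficients of elements `g k` of `A_θ`, with a summable bound for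
the operators `diag (f l)` in `𝓛^{1,∞}`. Then `e k ↦ g k • e k` defines an operator in
`𝓛^{1,∞}`, and its products with elements of `A_θ` are strongly measurable. -/
theorem exists_hasNCIntegral_mul (e : HilbertBasis (Fin n → ℤ) ℂ H)
    (π : alg θ →L[ℂ] (H →L[ℂ] H)) (hπ1 : π 1 = 1) (hπmul : ∀ a b, π (a * b) = π a * π b)
    (hπ : ∀ m, ∃ c : (Fin n → ℤ) → ℂ, ∀ k, π (U θ m) (e k) = c k • e (m + k))
    (σ : ℕ ≃ (Fin n → ℤ)) {f : (Fin n → ℤ) → (Fin n → ℤ) → ℂ} {w : (Fin n → ℤ) → ℝ}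
    (hw : Summable w) (hfw : ∀ l k, (σ.symm k + 1 : ℝ) * ‖f l k‖ ≤ w l)
    {g : (Fin n → ℤ) → alg θ} (hg : ∀ k, HasSum (fun l => f l k • U θ l) (g k))
    {I : (Fin n → ℤ) → ℂ} (hI : ∀ l, HasDiagIntegral e (f l) (I l))
    {c : alg θ} (hc : HasSum (fun l => I l • U θ l) c) :
    ∃ T : H →L[ℂ] H, (∀ k, T (e k) = π (g k) (e k)) ∧
      ∀ a, HasNCIntegral (π a * T) (tauL θ (a * c)) := by
  -- The entries factor as f_l = s_l r: `diagOp e r` is a harmonic operator common to all `l`, and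
  -- s_l is bounded by `w l`.
  set r : (Fin n → ℤ) → ℝ := fun k => (σ.symm k + 1 : ℝ)⁻¹ with hr
  set s : (Fin n → ℤ) → (Fin n → ℤ) → ℂ := fun l k => ((σ.symm k + 1 : ℝ) : ℂ) * f l k with hs
  have hpos : ∀ k, (0 : ℝ) < σ.symm k + 1 := fun k => by positivity
  have hr1 : ∀ k, ‖(r k : ℂ)‖ ≤ 1 := fun k => norm_inv_succ_le (σ.symm k)
  have hs1 : ∀ l k, ‖s l k‖ ≤ w l := fun l k => by
    rw [hs, norm_mul, Complex.norm_real, Real.norm_of_nonneg (hpos k).le]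
    exact hfw l k
  have hw0 : ∀ l, 0 ≤ w l := fun l => (norm_nonneg _).trans (hs1 l 0)
  have hsr : ∀ l, diagOp e (s l) * diagOp e (fun k => (r k : ℂ)) = diagOp e (f l) := fun l => by
    rw [diagOp_mul (hs1 l) hr1]
    congr 1
    funext k
    have : ((σ.symm k + 1 : ℝ) : ℂ) ≠ 0 := Complex.ofReal_ne_zero.2 (hpos k).ne'
    rw [hs, hr, mul_right_comm, Complex.ofReal_inv, mul_inv_cancel₀ this, one_mul]
  have hD : diagOp e (fun k => (r k : ℂ)) ∈ weakTraceClass H := by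
    rw [← harmonicOp_reindexEquiv]; exact harmonicOp_mem _
  have hDpos : (diagOp e fun k => (r k : ℂ)).IsPositive := by
    rw [← harmonicOp_reindexEquiv]; exact harmonicOp_isPositive _
  have hsum : Summable fun l => π (U θ l) * diagOp e (s l) := by
    refine Summable.of_norm_bounded (hw.mul_left ‖π‖) fun l => (norm_mul_le _ _).trans ?_
    refine mul_le_mul ((π.le_opNorm _).trans ?_) (norm_diagOp_le (hw0 l) (hs1 l))
      (norm_nonneg _) (ContinuousLinearMap.opNorm_nonneg π)
    exact mul_le_of_le_one_right (ContinuousLinearMap.opNorm_nonneg π) (norm_U_le θ l)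
  -- The sum is taken in operator norm before multiplying by the harmonic operator, so membership in
  -- 𝓛^{1,∞} is just the ideal property.
  set S := ∑' l, π (U θ l) * diagOp e (s l) with hS
  have hST : HasSum (fun l => π (U θ l) * diagOp e (s l)) S := hsum.hasSum
  refine ⟨S * diagOp e fun k => (r k : ℂ), fun k => ?_, fun a => ⟨?_, fun φ hφ => ?_⟩⟩
  · have h1 := (hST.mapL ((ContinuousLinearMap.mul ℂ (H →L[ℂ] H)).flip
      (diagOp e fun k => (r k : ℂ)))).mapL (ContinuousLinearMap.apply ℂ H (e k))
    have h2 := ((hg k).mapL π).mapL (ContinuousLinearMap.apply ℂ H (e k))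
    refine h1.unique (h2.congr_fun fun l => ?_)
    change (π (U θ l) * diagOp e (s l) * diagOp e fun k => (r k : ℂ)) (e k) =
      π (f l k • U θ l) (e k)
    obtain ⟨C, hC⟩ := (hI l).1
    rw [mul_assoc, hsr, mul_apply_eq_comp, diagOp_basis hC, map_smul, map_smul, smul_apply]
  · exact mul_mem_weakTraceClass _ (mul_mem_weakTraceClass _ hD)
  -- Continuity of `Ψ` allows the trace of aSD to be computed termwise. The l-th term is τ(aU^l)
  -- times the NC integral of diag(f_l), and these sum to τ(ac).
  · set Ψ : (H →L[ℂ] H) →L[ℂ] ℂ := ⟨traceMul φ hD, hφ.continuous_traceMul hD hDpos⟩ with hΨ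
    have h1 := (hST.mapL (ContinuousLinearMap.mul ℂ (H →L[ℂ] H) (π a))).mapL Ψ
    have h2 := (hc.mapL (ContinuousLinearMap.mul ℂ (alg θ) a)).mapL (tauL θ)
    have h3 : φ ⟨π a * (S * diagOp e fun k => (r k : ℂ)),
        mul_mem_weakTraceClass _ (mul_mem_weakTraceClass _ hD)⟩ = Ψ (π a * S) :=
      congrArg φ (Subtype.ext (mul_assoc _ _ _).symm)
    rw [h3]
    refine h1.unique (h2.congr_fun fun l => ?_)
    change traceMul φ hD (π a * (π (U θ l) * diagOp e (s l))) = tauL θ (a * I l • U θ l)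
    obtain ⟨hf, h4⟩ := (hI l).2
    rw [← mul_assoc, ← hπmul, traceMul_rep_mul_diagOp hφ e π hπ1 hπ hr1 hD hDpos (hs1 l),
      mul_smul_comm, map_smul, smul_eq_mul, mul_comm, ← h4 φ hφ]
    congr 1
    exact congrArg φ (Subtype.ext (hsr l))

/-- The extension of an operator of order `-n` and its NC integrals, on the Hilbert space of a
representation. -/
theorem IsClassicalSymbol.exists_hasNCIntegral_mul (hn : n ≠ 0)
    {ρ : E n → smooth θ} {hom : ℕ → E n → smooth θ} (h : IsClassicalSymbol θ (-(n : ℂ)) ρ hom)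
    (e : HilbertBasis (Fin n → ℤ) ℂ H)
    (π : alg θ →L[ℂ] (H →L[ℂ] H)) (hπ1 : π 1 = 1) (hπmul : ∀ a b, π (a * b) = π a * π b)
    (hπ : ∀ m, ∃ c : (Fin n → ℤ) → ℂ, ∀ k, π (U θ m) (e k) = c k • e (m + k)) :
    ∃ T : H →L[ℂ] H, (∀ k, T (e k) = π (ρ (latticePoint k) : alg θ) (e k)) ∧
      ∀ a, HasNCIntegral (π a * T)
        ((1 / (n : ℂ)) * tau θ (a * sphereIntegral θ (hom 0))) := by
  obtain ⟨σ, D, hD⟩ := exists_enumeration_le hn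
  have hpos : ∀ k, (0 : ℝ) ≤ σ.symm k + 1 := fun k => by positivity
  have hdec := h.coeff_decay hpos hD
  -- The decay exponents 0 and n + 1 together give the summable weight (1 + |l|^{n+1})⁻¹, uniformly
  -- in `k`.
  obtain ⟨A, hA⟩ := hdec 0
  obtain ⟨A', hA'⟩ := hdec (n + 1)
  have hw := (summable_weight (Nat.lt_succ_self n)).mul_left (A + A')
  have hfw : ∀ l k, (σ.symm k + 1 : ℝ) * ‖coeff θ l (ρ (latticePoint k) : alg θ)‖ ≤
      (A + A') * (1 + ‖l‖ ^ (n + 1))⁻¹ := fun l k => by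
    rw [← div_eq_mul_inv, le_div_iff₀ (by positivity)]
    have h1 := hA k l
    have h2 := hA' k l
    rw [pow_zero, one_mul] at h1
    linarith
  have hg : ∀ k, HasSum (fun l => coeff θ l (ρ (latticePoint k) : alg θ) • U θ l)
      (ρ (latticePoint k) : alg θ) := fun k =>
    hasSum_U_of_summable θ <| Summable.of_norm_bounded hw fun l => by
      rw [norm_norm]
      refine le_trans (le_mul_of_one_le_left (norm_nonneg _) ?_) (hfw l k)
      linarith [(Nat.cast_nonneg (σ.symm k) : (0 : ℝ) ≤ σ.symm k)]
  have hc : HasSum (fun l => ((1 / (n : ℂ)) * coeff θ l (sphereIntegral θ (hom 0))) • U θ l)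
      ((1 / (n : ℂ)) • sphereIntegral θ (hom 0)) := by
    have h1 := summable_of_decay (sphereIntegral_decay (h.homogeneous 0)) 0
    simp only [pow_zero, one_mul] at h1
    refine ((hasSum_U_of_summable θ h1).const_smul (1 / (n : ℂ))).congr_fun fun l => ?_
    rw [mul_smul]
  obtain ⟨T, hT, hI⟩ := NCTorus.exists_hasNCIntegral_mul e π hπ1 hπmul hπ σ hw hfw hg
    (fun l => h.hasDiagIntegral hn e l) hc
  refine ⟨T, hT, fun a => ?_⟩
  have h1 := hI a
  rwa [mul_smul_comm, map_smul, smul_eq_mul, tauL_apply] at h1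

end Symbol

/-! ### The bounded extension to 𝓗_θ -/

section Extension

variable {P : smooth θ →ₗ[ℂ] smooth θ} {ρ : E n → smooth θ} {T : Hilb θ →L[ℂ] Hilb θ}

theorem U_mem_smooth (k : Fin n → ℤ) : U θ k ∈ smooth θ := by
  refine mem_smooth_of_decay θ fun M => ⟨‖k‖ ^ M, fun l => ?_⟩
  rw [coeff_U]
  split_ifs with h
  · rw [h, norm_one, mul_one]
  · rw [norm_zero, mul_zero]; positivity

/-- The Fourier series of `u` converges in 𝓗_θ and the series defining `P u` converges in A_θ. After
applying `T` to the first and the canonical map to the second, the terms agree. -/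
theorem extends_of_basis (hP : IsOperatorOf θ P ρ)
    (hT : ∀ k, T (toHilb θ (U θ k)) = toHilb θ ((ρ (latticePoint k) : alg θ) * U θ k)) :
    Extends θ T P := fun u => by
  have h1 := (hasSum_toHilb θ (u : alg θ)).mapL T
  have h2 := (hP u).mapL (toHilbL θ)
  refine h1.unique (h2.congr_fun fun k => ?_)
  rw [map_smul, hT, map_smul, coeff_apply]
  rfl

/-- Each U^k is smooth, so the extension is prescribed on an orthonormal basis. -/
theorem Extends.eq {T' : Hilb θ →L[ℂ] Hilb θ} (hT : Extends θ T P) (hT' : Extends θ T' P) :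
    T = T' := (fourierBasis θ).clm_ext fun k => by
  rw [fourierBasis_apply]
  exact (hT ⟨U θ k, U_mem_smooth k⟩).trans (hT' ⟨U θ k, U_mem_smooth k⟩).symm

theorem IsPsiDOWithSymbol.exists_extends (hn : n ≠ 0) {hom : ℕ → E n → smooth θ}
    (hP : IsPsiDOWithSymbol θ (-(n : ℂ)) P ρ hom) : ∃ T : Hilb θ →L[ℂ] Hilb θ,
      Extends θ T P ∧ ∀ a, HasNCIntegral (leftRep θ a * T)
        ((1 / (n : ℂ)) * tau θ (a * sphereIntegral θ (hom 0))) := by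
  obtain ⟨T, hT, hI⟩ := hP.symbol.exists_hasNCIntegral_mul hn (fourierBasis θ) (leftRepL θ)
    (map_one (leftRep θ)) (map_mul (leftRep θ)) (exists_leftRep_U_basis θ)
  refine ⟨T, extends_of_basis hP.operator fun k => ?_, hI⟩
  rw [← leftRep_toHilb, ← fourierBasis_apply, hT]
  rfl

end Extension

end NCTorus

end

theorem corollary7p2 {n : ℕ} (hn : 2 ≤ n) (θ : Matrix (Fin n) (Fin n) ℝ) (hθ : θ.transpose = -θ)
    (P : NCTorus.smooth θ →ₗ[ℂ] NCTorus.smooth θ)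
    (ρ : NCTorus.E n → NCTorus.smooth θ) (hom : ℕ → NCTorus.E n → NCTorus.smooth θ)
    (hP : NCTorus.IsPsiDOWithSymbol θ (-(n : ℂ)) P ρ hom) :
    (∃! T : NCTorus.Hilb θ →L[ℂ] NCTorus.Hilb θ, NCTorus.Extends θ T P) ∧
      NCTorus.sphereIntegral θ (hom 0) ∈ NCTorus.smooth θ ∧
      ∀ T : NCTorus.Hilb θ →L[ℂ] NCTorus.Hilb θ, NCTorus.Extends θ T P →
        ∀ a : NCTorus.alg θ,
          IsStronglyMeasurableOp (NCTorus.leftRep θ a * T) ∧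
            HasNCIntegral (NCTorus.leftRep θ a * T)
              ((1 / (n : ℂ)) * NCTorus.tau θ (a * NCTorus.sphereIntegral θ (hom 0))) := by
  obtain ⟨T, hT, hI⟩ := hP.exists_extends (by omega)
  refine ⟨⟨T, hT, fun T' hT' => hT'.eq hT⟩, ?_, fun T' hT' a => ?_⟩
  · exact NCTorus.mem_smooth_of_decay θ
      (NCTorus.sphereIntegral_decay (hP.symbol.homogeneous 0))
  · rw [hT'.eq hT]
    exact ⟨⟨_, hI a⟩, hI a⟩
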